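/- **Setting.** Let $(V,d)$ be a chain complex of complex vector spaces ($d$ lowers the degree by one) with finite-dimensional homogeneous subspaces, and let $B:V\otimes V\to\mathbb C$ be a non-degenerate bilinear form of odd degree $k$ (so $B(x,y)=0$ unless $\deg x+\deg y=k$; the basic case is $k=1$) which is anti-symmetric, $B(y,x)=-(-1)^{\deg x\deg y}B(x,y)$, and satisfies $B(dx,y)+(-1)^{\deg x}B(x,dy)=0$. Write $|x|=1-\deg x$ for the cohomological degree and $\kappa=2-k$ for the degree of $B$ with respect to it. *The twisted modular operad $\mathcal E_V$.* $\mathcal E_V((n,b))=V^{\otimes n}$ with $v_1\otimes\cdots\otimes v_n$ in degree $n-\sum\deg v_i=\sum|v_i|$, with the usual differential $d_{\mathcal E_V}$ and the action of $\mathbb S_n$ with Koszul signs (for $\deg$). Along an edge $(f,f')$ joining two vertices, oriented by $f\wedge f'$, tensors $v=v_1\otimes\cdots\otimes v_{r}$ (with $v_f=v_r$ last) and $w=w_1\otimes\cdots\otimes w_m$ (with $w_{f'}=w_\beta$) are composed to $$v\circ_\beta w=(-1)^{\epsilon}B(v_f,w_{f'})\,w_1\otimes\cdots\otimes w_{\beta-1}\otimes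 v_1\otimes\cdots\otimes v_{r-1}\otimes w_{\beta+1}\otimes\cdots\otimes w_m,$$ $$\epsilon=\sum_{j<\beta}\deg w_j(\deg w-\deg w_j)+k(\deg v-\deg v_f)+\sum_{l<\beta}\deg w_l(\deg v+\deg w-\deg v_f-\deg w_{f'}-\deg w_l);$$ along a loop one contracts the two flags $f,f'$ of one vertex by $B$, with the corresponding Koszul sign. *The modular operad $\gamma\tilde{\mathbb S}[t]$.* For stable $(n,b)$ ($n\ge1$, $2b+n>2$), $\gamma\tilde{\mathbb S}[t]((n,b))$ has the basis $\sigma t^g$ with $\sigma\in\mathbb S_n$, $b=2g+i_\sigma-1$, where $i_\sigma$ is the number of cycles of $\sigma$; $\mathbb S_n$ acts by conjugation times the sign. Composition along an edge $(ff')$ is $\sigma t^g\otimes\tau t^{g'}\mapsto\pm\pi_{ff'}(\sigma\tau(ff'))t^{g+g'}$, where $\pi_{ff'}$ erases $f,f'$ from the cycles and the sign $\pm$ (the orientation of the edge, coming from the sign twist) compares (flags of the first vertex)$\wedge$(flags of the second vertex) with $1\wedge\cdots\wedge n\wedge f\wedge f'$; along a loop it is $\sigma t^g\mapsto\pi_{ff'}(\sigma(ff'))t^{g'}$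 with $g'=g$ if a cycle is cut and $g'=g+1$ if two cycles are merged (the result being $0$ if it does not lie in arity $n$ and genus label $b+1$). *Quantum $A_\infty$-relations.* Let $\Omega$ be a family of $\mathbb S_n$-equivariant linear maps $\Omega_{n,b}:(\gamma\tilde{\mathbb S}[t]((n,b)))^*\to\mathcal E_V((n,b))$ with values in degree $2+(n-1)(\kappa-1)+(\kappa-3)b$; for $k=1$ this is $2-2b$, the degree of the source, so $\Omega$ is of degree $0$. The quantum $A_\infty$-relation in $(n,b)$ is the equation $d_{\mathcal E_V}\circ\Omega=\Omega\circ d_{\mathcal F}$ on $(\gamma\tilde{\mathbb S}[t]((n,b)))^*$, that is $$d_{\mathcal E_V}\circ\Omega_{n,b}=\mu^{\mathcal E_V}_{\rm loop}\circ\Omega_{n+2,b-1}\circ(\mu_{\rm loop}^{\gamma\tilde{\mathbb S}[t]})^*+\sum_H\mu_H^{\mathcal E_V}\circ(\Omega_{k_1,b_1}\otimes\Omega_{k_2,b_2})\circ(\mu_H^{\gamma\tilde{\mathbb S}[t]})^*,$$ where $H$ runs over the isomorphism classes of trees with one edge, legs $1,\dots,n$, and vertices of genus labels $b_1+b_2=b$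 (the loop term is absent if $b=0$). *The associated operations.* For $n\ge3$ let $\overline\mu_{n-1}\in V^{\otimes n}$ be the image of $\Omega_{n,0}\big((1\,2\cdots n)^*\big)$ under the shift isomorphism $s(v_1\otimes\cdots\otimes v_n)=(-1)^{\sum_i i|v_i|}v_1\otimes\cdots\otimes v_n$. For $d\ge2$ let $m_d:V^{\otimes d}\to V$ correspond to $\overline\mu_d$ under $v_1\otimes\cdots\otimes v_{d+1}\mapsto\big((a_d,\dots,a_1)\mapsto\prod_{i\le d}B(v_i,a_i)\,v_{d+1}\big)$, and let $m_1(x)=(-1)^{\deg x}dx$. **Theorem.** For $b=0$ the quantum $A_\infty$-relations reduce to the usual $A_\infty$-relations: 1. The quantum $A_\infty$-relations in $(n,0)$ hold for all $n$ if and only if $(V,(m_d)_{d\ge1})$, graded by $|\cdot|$, is a non-unital $A_\infty$-algebra: $m_d$ has degree $2-d$ and, for all $d\ge1$ and homogeneous $a_1,\dots,a_d$, $$\sum_{\substack{1\le p\le d\\0\le q\le d-p}}(-1)^{|a_1|+\cdots+|a_q|-q}\,m_{d-p+1}(a_d,\dots,a_{p+q+1},m_p(a_{p+q},\dots,a_{q+1}),a_q,\dots,a_1)=0.$$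 2. More precisely, for each $d\ge2$ the following are equivalent: the quantum $A_\infty$-relation in $(d+1,0)$; the $A_\infty$-relation with $d$ inputs; and its tensor form $$\sum_{\substack{1\le p\le d\\0\le q\le d-p}}(-1)^{|q_1|+\cdots+|q_q|}\,\overline\mu_{d-p+1}\circ_{q+1}\overline\mu_p=0,$$ where $q_1,q_2,\dots$ denote the tensor factors of $\overline\mu_{d-p+1}$ and $\overline\mu_{d-p+1}\circ_{q+1}\overline\mu_p$ is the sign-free insertion of $\overline\mu_p$ into the slot $q+1$, pairing $q_{q+1}$ (first argument) with the last factor of $\overline\mu_p$ by $B$. In the terms with $p=1$ and $p=d$, contraction with the tensor of $m_1$ means applying $-d$ (the adjoint of $m_1$ for $B$) to the factor $q_{q+1}$ of $\overline\mu_d$, respectively $m_1$ to the last factor of $\overline\mu_d$. 3. The sign of each term is Seidel's sign: let $H$ be a one-edge tree whose first vertex carries a set of consecutive legs $\beta,\dots,\beta+r-2$ and $f$, let $p=p_1\otimes\cdots\otimes p_r$ and $q=q_1\otimes\cdots\otimes q_m$ be tensors of homogeneous elements with $\sum|p_i|=2+(r-1)(\kappa-1)$ and $\sum|q_j|=2+(m-1)(\kappa-1)$,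 and let $\pm$ be the orientation sign of $H$. Then $$s(\pm\,p\circ_\beta q)=(-1)^{\sum_{i<\beta}|q_i|}\;s(p)\bullet_\beta s(q),$$ where $\bullet_\beta$ is the contraction $p\otimes q\mapsto B(p_r,q_\beta)\,q_1\otimes\cdots\otimes q_{\beta-1}\otimes p_1\otimes\cdots\otimes p_{r-1}\otimes q_{\beta+1}\otimes\cdots\otimes q_m$ without sign. -/

import Mathlib

open scoped TensorProduct

noncomputable section

namespace QuantumAInf

/-! ### Permutations with genus: the modular operad of boundary cycles, twisted by sign -/

/-- The number of disjoint cycles of `σ`, fixed points being cycles of length one. -/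
def numCycles {n : ℕ} (σ : Equiv.Perm (Fin n)) : ℕ :=
  σ.cycleType.card + Fintype.card {i : Fin n // σ i = i}

/-- `σ t ^ g` is a generator in arity `n` and genus label `b` : the pair `(n, b)` is stable and
`b = 2 g + i_σ - 1`, with `i_σ` the number of cycles of `σ`. -/
def IsGen (n b : ℕ) (x : Equiv.Perm (Fin n) × ℕ) : Prop :=
  1 ≤ n ∧ 2 < 2 * b + n ∧ b + 1 = 2 * x.2 + numCycles x.1

/-- The generators `σ t ^ g` in arity `n` and genus label `b`. -/
abbrev Gen (n b : ℕ) : Type := {x : Equiv.Perm (Fin n) × ℕ // IsGen n b x}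

instance finite_gen (n b : ℕ) : Finite (Gen n b) := by
  refine Finite.of_injective
    (fun x : Gen n b => ((x.1.1, ⟨x.1.2, ?_⟩) : Equiv.Perm (Fin n) × Fin (b + 2))) ?_
  · have := x.2.2.2
    omega
  · intro x y h
    have h1 := congrArg Prod.fst h
    have h2 := congrArg (fun z => (Prod.snd z).val) h
    exact Subtype.ext (Prod.ext h1 h2)

/-- The vector space underlying `γ S̃[t]((n, b))`. -/
abbrev STilde (n b : ℕ) : Type := Gen n b →₀ ℂ

/-- The element `σ t ^ g` of `γ S̃[t]((n, b))`; zero if `σ t ^ g` does not lie in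
`S̃[t]((n, b))`. -/
def gen (n b : ℕ) (σ : Equiv.Perm (Fin n)) (g : ℕ) : STilde n b :=
  open Classical in
  if h : IsGen n b (σ, g) then Finsupp.single ⟨(σ, g), h⟩ 1 else 0

/-- The element `(σ t ^ g)^*` of the basis dual to the generators. -/
def dualGen (n b : ℕ) (σ : Equiv.Perm (Fin n)) (g : ℕ) : Module.Dual ℂ (STilde n b) :=
  open Classical in
  if h : IsGen n b (σ, g) then Finsupp.lapply ⟨(σ, g), h⟩ else 0

/-- The action of the symmetric group on `γ S̃[t]((n, b))` : conjugation, twisted by the sign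
representation. -/
def sAct (n b : ℕ) (π : Equiv.Perm (Fin n)) : STilde n b →ₗ[ℂ] STilde n b :=
  Finsupp.linearCombination ℂ fun x : Gen n b =>
    (((Equiv.Perm.sign π : ℤˣ) : ℤ) : ℂ) • gen n b (π * x.1.1 * π⁻¹) x.1.2

/-! ### One-edge graphs and their flags -/

/-- Erase the two distinguished flags `none`, `some none` from the cycles of a permutation. -/
def eraseFlags {L : Type*} (σ : Equiv.Perm (Option (Option L))) : Equiv.Perm L :=
  Equiv.removeNone (Equiv.removeNone σ)

/-- The numbering of the legs `1, …, n` followed by the flags `f = none` and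
`f' = some none`. -/
def flagEquiv (n : ℕ) : Option (Option (Fin n)) ≃ Fin (n + 2) :=
  (Equiv.optionCongr (finSuccEquiv' (Fin.last n)).symm).trans
    (finSuccEquiv' (Fin.last n).castSucc).symm

/-- Distribute the two flags `f = none`, `f' = some none` of an edge to its two ends. -/
def splitFlags (X Y : Type*) : Option (Option (X ⊕ Y)) ≃ Option X ⊕ Option Y where
  toFun
    | none => Sum.inl none
    | some none => Sum.inr none
    | some (some (Sum.inl x)) => Sum.inl (some x)
    | some (some (Sum.inr y)) => Sum.inr (some y)
  invFun
    | Sum.inl none => none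
    | Sum.inr none => some none
    | Sum.inl (some x) => some (some (Sum.inl x))
    | Sum.inr (some y) => some (some (Sum.inr y))
  left_inv := by rintro (_ | _ | _ | _) <;> rfl
  right_inv := by rintro ((_ | _) | (_ | _)) <;> rfl

/-! A tree with one edge `(f f')` and legs `Fin n` is given by the set `I` of legs at its first
vertex, which carries the flag `f`; the second vertex carries the legs in the complement of `I`,
and the flag `f'`. At the first vertex the flags are listed as: `I` in increasing order, then
`f`. At the second vertex they are listed as: the legs smaller than all of `I`, then `f'`,
then the other legs, each group in increasing order. -/

/-- The legs of the two vertices, each listed in increasing order. -/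
def legEquiv {n : ℕ} (I : Finset (Fin n)) : Fin I.card ⊕ Fin Iᶜ.card ≃ Fin n :=
  finSumEquivOfFinset rfl rfl

/-- The position of `f'` at the second vertex. -/
def slot {n : ℕ} (I : Finset (Fin n)) : Fin (Iᶜ.card + 1) :=
  ⟨(Iᶜ.filter fun j => ∀ i ∈ I, j < i).card,
    Nat.lt_succ_of_le (Finset.card_le_card (Finset.filter_subset _ _))⟩

/-- The flags of a one-edge tree, in terms of their positions at the two vertices. -/
def treeFlags {n : ℕ} (I : Finset (Fin n)) :
    Option (Option (Fin n)) ≃ Fin (I.card + 1) ⊕ Fin (Iᶜ.card + 1) :=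
  (Equiv.optionCongr (Equiv.optionCongr (legEquiv I).symm)).trans
    ((splitFlags _ _).trans
      (Equiv.sumCongr (finSuccEquiv' (Fin.last I.card)).symm (finSuccEquiv' (slot I)).symm))

lemma card_add_card_compl {n : ℕ} (I : Finset (Fin n)) : I.card + Iᶜ.card = n := by
  simp

/-- The orientation of a one-edge tree: the sign that compares
`(flags of the first vertex) ∧ (flags of the second vertex)` with `1 ∧ ⋯ ∧ n ∧ f ∧ f'`.
It is the contribution of the sign representations, with values in the orientation line
`Λ² ℂ^{f, f'}` of the edge, trivialised by `f ∧ f'`. -/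
def orientation {n : ℕ} (I : Finset (Fin n)) : ℤˣ :=
  Equiv.Perm.sign
    ((flagEquiv n).symm.trans
      ((treeFlags I).trans
        (finSumFinEquiv.trans
          (finCongr (show I.card + 1 + (Iᶜ.card + 1) = n + 2 by
            have := card_add_card_compl I
            omega)))))

/-- `π_{f f'}(σ τ (f f'))` for a one-edge tree. -/
def glueTree {n : ℕ} (I : Finset (Fin n)) (σ : Equiv.Perm (Fin (I.card + 1)))
    (τ : Equiv.Perm (Fin (Iᶜ.card + 1))) : Equiv.Perm (Fin n) :=
  eraseFlags ((treeFlags I).symm.permCongr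
    (Equiv.Perm.sumCongr σ τ * Equiv.swap (treeFlags I none) (treeFlags I (some none))))

/-- `π_{f f'}(σ (f f'))` for the graph with one vertex and one loop, its flags being the legs
`1, …, n` followed by `f` and `f'`. -/
def glueLoop {n : ℕ} (σ : Equiv.Perm (Fin (n + 2))) : Equiv.Perm (Fin n) :=
  eraseFlags ((flagEquiv n).symm.permCongr
    (σ * Equiv.swap (flagEquiv n none) (flagEquiv n (some none))))

/-- Composition of `γ S̃[t]` along a one-edge tree with vertices of genus label `b₁`, `b₂` :
`σ t ^ g ⊗ τ t ^ g' ↦ ± π_{f f'}(σ τ (f f')) t ^ (g + g')`. -/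
def muTree {n : ℕ} (I : Finset (Fin n)) (b₁ b₂ b : ℕ) :
    STilde (I.card + 1) b₁ ⊗[ℂ] STilde (Iᶜ.card + 1) b₂ →ₗ[ℂ] STilde n b :=
  TensorProduct.lift <|
    Finsupp.linearCombination ℂ fun x : Gen (I.card + 1) b₁ =>
      Finsupp.linearCombination ℂ fun y : Gen (Iᶜ.card + 1) b₂ =>
        (((orientation I : ℤˣ) : ℤ) : ℂ) •
          gen n b (glueTree I x.1.1 y.1.1) (x.1.2 + y.1.2)

/-- Composition of `γ S̃[t]` along the loop: `σ t ^ g ↦ π_{f f'}(σ (f f')) t ^ g'`, where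
`g' = g` if a cycle is cut into two, and `g' = g + 1` if two cycles are merged. -/
def muLoop (n b : ℕ) : STilde (n + 2) b →ₗ[ℂ] STilde n (b + 1) :=
  open Classical in
  Finsupp.linearCombination ℂ fun x : Gen (n + 2) b =>
    gen n (b + 1) (glueLoop x.1.1)
      (if x.1.1.SameCycle (flagEquiv n none) (flagEquiv n (some none)) then x.1.2
        else x.1.2 + 1)

/-! ### Graded linear algebra -/

variable {V : Type*} [AddCommGroup V] [Module ℂ V]

/-- The `n`-fold tensor power of `V`. -/
abbrev T (V : Type*) [AddCommGroup V] [Module ℂ V] (n : ℕ) : Type _ := ⨂[ℂ] _ : Fin n, V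

/-- `(-1) ^ ε`. -/
def sgn (ε : ZMod 2) : ℂ := if ε = 0 then 1 else -1

/-- Projection to the part of even (`ε = 0`) or odd (`ε = 1`) degree. -/
def parityProj (𝒱 : ℤ → Submodule ℂ V) [DirectSum.Decomposition 𝒱] (ε : ZMod 2) :
    V →ₗ[ℂ] V :=
  (DirectSum.toModule ℂ ℤ V fun i => if (i : ZMod 2) = ε then (𝒱 i).subtype else 0) ∘ₗ
    (DirectSum.decomposeLinearEquiv 𝒱).toLinearMap

/-- The operator that multiplies a tensor `v₁ ⊗ ⋯ ⊗ v_n` of homogeneous elements whose degrees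
have the parities `c` by `(-1) ^ (s c)`. -/
def signOp (𝒱 : ℤ → Submodule ℂ V) [DirectSum.Decomposition 𝒱] {n : ℕ}
    (s : (Fin n → ZMod 2) → ZMod 2) : T V n →ₗ[ℂ] T V n :=
  ∑ c : Fin n → ZMod 2, sgn (s c) • PiTensorProduct.map fun i => parityProj 𝒱 (c i)

/-- The action of the symmetric group on `V ^ {⊗ n}` with the Koszul sign: the `i`-th factor
moves to the position `π i`. -/
def kAct (𝒱 : ℤ → Submodule ℂ V) [DirectSum.Decomposition 𝒱] {n : ℕ}
    (π : Equiv.Perm (Fin n)) : T V n →ₗ[ℂ] T V n :=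
  (PiTensorProduct.reindex ℂ (fun _ => V) π).toLinearMap ∘ₗ
    signOp 𝒱 fun c => ∑ i, ∑ j, if i < j ∧ π j < π i then c i * c j else 0

/-- Apply `φ` to the factor at `i`, without sign. -/
def applyAt {n : ℕ} (i : Fin n) (φ : V →ₗ[ℂ] V) : T V n →ₗ[ℂ] T V n :=
  PiTensorProduct.map (Function.update (fun _ => LinearMap.id) i φ)

/-- `w₁ ⊗ ⋯ ⊗ w_{m+1} ↦ (the product of the other factors) ⊗ w_β`. -/
def extract {m : ℕ} (β : Fin (m + 1)) : T V (m + 1) ≃ₗ[ℂ] T V m ⊗[ℂ] V :=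
  ((PiTensorProduct.reindex ℂ (fun _ => V)
      ((finSuccEquiv' β).trans (Equiv.optionEquivSumPUnit.{0} (Fin m)))).trans
    (PiTensorProduct.tmulEquiv ℂ V).symm).trans
    (TensorProduct.congr (LinearEquiv.refl ℂ _)
      (PiTensorProduct.subsingletonEquiv PUnit.unit.{1}))

/-- The positions of the factors after the insertion of `k` factors at `β` into `m` factors. -/
def insertEquiv {k m n : ℕ} (h : k + m = n) (β : Fin (m + 1)) : Fin k ⊕ Fin m ≃ Fin n where
  toFun
    | Sum.inl i => ⟨β + i, by have := β.2; have := i.2; omega⟩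
    | Sum.inr j => if j.1 < β.1 then ⟨j, by omega⟩ else ⟨j + k, by omega⟩
  invFun x :=
    if h1 : x.1 < β.1 then Sum.inr ⟨x, by omega⟩
    else if h2 : x.1 < β.1 + k then Sum.inl ⟨x - β, by omega⟩
    else Sum.inr ⟨x - k, by omega⟩
  left_inv := by
    rintro (i | j)
    · simp
    · by_cases hj : j.1 < β.1
      · simp [hj]
      · have h1 : ¬ (j.1 + k < β.1) := by omega
        have h2 : ¬ (j.1 + k < β.1 + k) := by omega
        simp [hj, h1]
  right_inv := by
    intro x
    by_cases h1 : x.1 < β.1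
    · simp [h1]
    · by_cases h2 : x.1 < β.1 + k
      · simp only [h1, h2, dite_true, dite_false]
        ext
        simp
        omega
      · have h3 : ¬ (x.1 - k < β.1) := by omega
        simp only [h1, h2, h3, dite_false, if_false]
        ext
        simp
        omega

/-- Contraction without sign: `v₁ ⊗ ⋯ ⊗ v_{k+1}` and `w₁ ⊗ ⋯ ⊗ w_{m+1}` go to
`B(v_{k+1}, w_β) w₁ ⊗ ⋯ ⊗ w_{β-1} ⊗ v₁ ⊗ ⋯ ⊗ v_k ⊗ w_{β+1} ⊗ ⋯ ⊗ w_{m+1}`. -/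
def contract (B : V →ₗ[ℂ] V →ₗ[ℂ] ℂ) {k m n : ℕ} (h : k + m = n) (β : Fin (m + 1)) :
    T V (k + 1) ⊗[ℂ] T V (m + 1) →ₗ[ℂ] T V n :=
  (TensorProduct.rid ℂ (T V n)).toLinearMap ∘ₗ
    TensorProduct.map
      ((PiTensorProduct.reindex ℂ (fun _ => V) (insertEquiv h β)).toLinearMap ∘ₗ
        (PiTensorProduct.tmulEquiv ℂ V).toLinearMap)
      (TensorProduct.lift B) ∘ₗ
    (TensorProduct.tensorTensorTensorComm ℂ (T V k) V (T V m) V).toLinearMap ∘ₗ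
    TensorProduct.map (extract (Fin.last k)).toLinearMap (extract β).toLinearMap

/-- `V ^ {⊗ d} → V` from a tensor: `v₁ ⊗ ⋯ ⊗ v_{d+1}` goes to the map
`a₁ ⊗ ⋯ ⊗ a_d ↦ B(v₁, a₁) ⋯ B(v_d, a_d) v_{d+1}`. -/
def toHom (B : V →ₗ[ℂ] V →ₗ[ℂ] ℂ) (d : ℕ) : T V (d + 1) →ₗ[ℂ] (T V d →ₗ[ℂ] V) :=
  dualTensorHom ℂ (T V d) V ∘ₗ
    TensorProduct.map (PiTensorProduct.dualDistrib ∘ₗ PiTensorProduct.map fun _ => B)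
      LinearMap.id ∘ₗ
    (extract (Fin.last d)).toLinearMap

/-! ### The chain complex with inner product and the twisted modular operad `E_V` -/

/-- A chain complex structure on the graded vector space `V = ⨁ 𝒱 i`, with finite-dimensional
homogeneous subspaces, and an anti-symmetric inner product `B` of degree `degB` on it. -/
structure InnerComplex (𝒱 : ℤ → Submodule ℂ V) where
  finite_dim : ∀ i, FiniteDimensional ℂ (𝒱 i)
  d : V →ₗ[ℂ] V
  d_mem : ∀ i, ∀ x ∈ 𝒱 i, d x ∈ 𝒱 (i - 1)
  d_d : ∀ x, d (d x) = 0
  B : V →ₗ[ℂ] V →ₗ[ℂ] ℂ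
  degB : ℤ
  B_degree : ∀ i j, ∀ x ∈ 𝒱 i, ∀ y ∈ 𝒱 j, i + j ≠ degB → B x y = 0
  B_antisymm : ∀ i j, ∀ x ∈ 𝒱 i, ∀ y ∈ 𝒱 j, B y x = -((i * j).negOnePow • B x y)
  B_nondegenerate : ∀ x, (∀ y, B x y = 0) → x = 0
  B_d : ∀ i, ∀ x ∈ 𝒱 i, ∀ y, B (d x) y + i.negOnePow • B x (d y) = 0

/-- The degree of `B` for the cohomological degree `1 - deg` on `V`. It is `1` if `B` has
degree `1`. -/
def InnerComplex.cohDegB {𝒱 : ℤ → Submodule ℂ V} (C : InnerComplex 𝒱) : ℤ := 2 - C.degB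

/-- The part of degree `D` of `E_V((n, b)) = V ^ {⊗ n}`, where `v₁ ⊗ ⋯ ⊗ v_n` has degree
`n - ∑ deg v_i`. -/
def evDegree (𝒱 : ℤ → Submodule ℂ V) (n : ℕ) (D : ℤ) : Submodule ℂ (T V n) :=
  Submodule.span ℂ
    {t | ∃ (c : Fin n → ℤ) (v : Fin n → V),
      (∀ i, v i ∈ 𝒱 (c i)) ∧ (n : ℤ) - ∑ i, c i = D ∧ t = PiTensorProduct.tprod ℂ v}

section Operad

variable {𝒱 : ℤ → Submodule ℂ V} [DirectSum.Decomposition 𝒱] (C : InnerComplex 𝒱)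

/-- The differential of `E_V`. -/
def dEV (n : ℕ) : T V n →ₗ[ℂ] T V n :=
  ∑ i : Fin n, applyAt i C.d ∘ₗ signOp 𝒱 fun c => ∑ l ∈ Finset.univ.filter (· < i), c l

/-- The exponent of the sign in the contraction of `v = v₁ ⊗ ⋯ ⊗ v_{k+1}`, at its last factor
`v_f`, with `w = w₁ ⊗ ⋯ ⊗ w_{m+1}`, at its factor `w_{f'}` in position `β` :
`∑_{j<β} |w_j| (|w| - |w_j|) + |B| (|v| - |v_f|)
  + ∑_{l<β} |w_l| (|v| + |w| - |v_f| - |w_{f'}| - |w_l|)`. -/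
def treeExponent (degB : ℤ) {k m : ℕ} (β : Fin (m + 1)) (v : Fin (k + 1) → ZMod 2)
    (w : Fin (m + 1) → ZMod 2) : ZMod 2 :=
  ∑ j ∈ Finset.univ.filter (· < β), w j * (∑ i, w i - w j) +
    (degB : ZMod 2) * (∑ i, v i - v (Fin.last k)) +
    ∑ l ∈ Finset.univ.filter (· < β),
      w l * (∑ i, v i + ∑ i, w i - v (Fin.last k) - w β - w l)

/-- The contraction `v ∘_β w` of `E_V`, with its sign. -/
def compEV {k m n : ℕ} (h : k + m = n) (β : Fin (m + 1)) :
    T V (k + 1) ⊗[ℂ] T V (m + 1) →ₗ[ℂ] T V n :=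
  ∑ v : Fin (k + 1) → ZMod 2, ∑ w : Fin (m + 1) → ZMod 2,
    sgn (treeExponent C.degB β v w) •
      (contract C.B h β ∘ₗ
        TensorProduct.map (PiTensorProduct.map fun i => parityProj 𝒱 (v i))
          (PiTensorProduct.map fun j => parityProj 𝒱 (w j)))

/-- The legs of a one-edge tree in the order in which the contraction at `slot I` produces
them. -/
def shuffle {n : ℕ} (I : Finset (Fin n)) : Equiv.Perm (Fin n) :=
  (insertEquiv (card_add_card_compl I) (slot I)).symm.trans (legEquiv I)

/-- Composition of `E_V` along a one-edge tree, on the generator of the twist given by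
`f ∧ f'` : contraction of `f` with `f'`, and then the factors are moved to the positions given by
the labels of the legs. -/
def evTree {n : ℕ} (I : Finset (Fin n)) :
    T V (I.card + 1) ⊗[ℂ] T V (Iᶜ.card + 1) →ₗ[ℂ] T V n :=
  kAct 𝒱 (shuffle I) ∘ₗ compEV C (card_add_card_compl I) (slot I)

/-- Composition of `E_V` along the loop that joins the last two flags `f`, `f'`, with the sign
`(-1) ^ (|B| ((∑_{j < n + 2} |v_j|) - |v_f|))`. -/
def evLoop (n : ℕ) : T V (n + 2) →ₗ[ℂ] T V n :=
  ((TensorProduct.rid ℂ (T V n)).toLinearMap ∘ₗ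
    TensorProduct.map LinearMap.id (TensorProduct.lift C.B) ∘ₗ
    (TensorProduct.assoc ℂ (T V n) V V).toLinearMap ∘ₗ
    TensorProduct.map (extract (Fin.last n)).toLinearMap LinearMap.id ∘ₗ
    (extract (Fin.last (n + 1))).toLinearMap) ∘ₗ
  signOp 𝒱 fun c =>
    (C.degB : ZMod 2) *
      (∑ j ∈ Finset.univ.filter (· < Fin.last (n + 1)), c j - c (Fin.last n).castSucc)

/-! ### Quantum A-infinity relations -/

/-- A morphism of stable `𝕊`-modules `Ω : (γ S̃[t])^* → E_V`, in the degree for which the quantum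
relations are homogeneous; if `B` has degree `1`, this degree is `2 - 2 b`, which is the degree of
`(γ S̃[t]((n, b)))^*`, so that `Ω` has degree `0`. -/
structure StableMorphism where
  Ω : ∀ n b : ℕ, Module.Dual ℂ (STilde n b) →ₗ[ℂ] T V n
  equivariant : ∀ (n b : ℕ) (π : Equiv.Perm (Fin n)) (ξ : Module.Dual ℂ (STilde n b)),
    Ω n b ((sAct n b π⁻¹).dualMap ξ) = kAct 𝒱 π (Ω n b ξ)
  degree : ∀ (n b : ℕ) (ξ : Module.Dual ℂ (STilde n b)),
    Ω n b ξ ∈ evDegree 𝒱 n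
      (2 + ((n : ℤ) - 1) * (C.cohDegB - 1) + (C.cohDegB - 3) * (b : ℤ))

variable {C} (Ω : StableMorphism C)

/-- The part of `Ω ∘ d_F` given by the graph with one loop; there is none for `b = 0`. -/
def loopTerm (n : ℕ) : ∀ b : ℕ, Module.Dual ℂ (STilde n b) →ₗ[ℂ] T V n
  | 0 => 0
  | b + 1 => evLoop C n ∘ₗ Ω.Ω (n + 2) b ∘ₗ (muLoop n b).dualMap

/-- The part of `Ω ∘ d_F` given by the one-edge tree with the legs `I` at its first vertex, and
genus labels `b₁`, `b₂`. -/
def treeTerm {n : ℕ} (I : Finset (Fin n)) (b₁ b₂ b : ℕ) :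
    Module.Dual ℂ (STilde n b) →ₗ[ℂ] T V n :=
  evTree C I ∘ₗ
    TensorProduct.map (Ω.Ω (I.card + 1) b₁) (Ω.Ω (Iᶜ.card + 1) b₂) ∘ₗ
    (TensorProduct.dualDistribEquiv ℂ (STilde (I.card + 1) b₁)
      (STilde (Iᶜ.card + 1) b₂)).symm.toLinearMap ∘ₗ
    (muTree I b₁ b₂ b).dualMap

/-- The quantum A-infinity relation in arity `n` and genus label `b` : the equation
`d_{E_V} ∘ Ω = Ω ∘ d_F` on `(γ S̃[t]((n, b)))^*`. The sum is over the isomorphism classes of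
graphs with one edge; the first vertex of a tree is the one that does not carry the last leg. -/
def QuantumRelation (n b : ℕ) : Prop :=
  ∀ ξ : Module.Dual ℂ (STilde n b),
    dEV C n (Ω.Ω n b ξ) =
      loopTerm Ω n b ξ +
        ∑ I ∈ Finset.univ.filter (fun I : Finset (Fin n) => ∀ i ∈ I, i.1 + 1 ≠ n),
          ∑ e ∈ Finset.HasAntidiagonal.antidiagonal b, treeTerm Ω I e.1 e.2 b ξ

/-! ### The operations and tensors in genus zero -/

/-- The shift isomorphism: `v₁ ⊗ ⋯ ⊗ v_n ↦ (-1) ^ (∑ i |v_i|) v₁ ⊗ ⋯ ⊗ v_n`, with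
`|v_i| = 1 - deg v_i`. -/
def decalage (𝒱 : ℤ → Submodule ℂ V) [DirectSum.Decomposition 𝒱] (n : ℕ) :
    T V n →ₗ[ℂ] T V n :=
  signOp 𝒱 fun c => ∑ i : Fin n, ((i.1 + 1 : ℕ) : ZMod 2) * (1 - c i)

/-- The tensor of the disc with `n` marked points: the value of `Ω` on the dual of the cycle
`(1 2 ⋯ n)`, shifted. -/
def discTensor (n : ℕ) : T V n :=
  decalage 𝒱 n (Ω.Ω n 0 (dualGen n 0 (finRotate n) 0))

variable (C) in
/-- `m₁(x) = (-1) ^ (deg x) d x`. -/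
def m₁ : V →ₗ[ℂ] V := C.d ∘ₗ (parityProj 𝒱 0 - parityProj 𝒱 1)

/-- The operations `m_d : V ^ {⊗ d} → V`; `m_d (a₁ ⊗ ⋯ ⊗ a_d)` stands for
`m_d (a_d, …, a_1)`. -/
def operations : ∀ d : ℕ, T V d →ₗ[ℂ] V
  | 0 => 0
  | 1 => m₁ C ∘ₗ (PiTensorProduct.subsingletonEquiv (0 : Fin 1)).toLinearMap
  | d + 2 => toHom C.B (d + 2) (discTensor Ω (d + 3))

/-- The A-infinity relation with `d` inputs in tensor form:
`∑_{p, q} (-1) ^ (|w₁| + ⋯ + |w_q|) μ_{d-p+1} ∘_{q+1} μ_p = 0` for the tensors `μ_i` of `m_i`,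
where `w₁, w₂, …` are the factors of `μ_{d-p+1}`, of degree `|w| = 1 - deg w`, and `∘_{q+1}`
pairs `w_{q+1}` with the last factor of `μ_p` by `B`. In the terms with `p = d` and `p = 1`,
contraction with the tensor of `m₁` is written as the application of `m₁` to the last factor, and
as the application of `-d`, the adjoint of `m₁` for `B`, to the factor in position `q + 1`. -/
def TensorRelation (d : ℕ) : Prop :=
  applyAt (Fin.last d) (m₁ C) (discTensor Ω (d + 1)) +
    ∑ q : Fin d, applyAt q.castSucc (-C.d)
      (signOp 𝒱 (fun c => ∑ l ∈ Finset.univ.filter (· < q.castSucc), (1 - c l))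
        (discTensor Ω (d + 1))) +
    ∑ p ∈ Finset.univ.filter (fun p : Fin d => 2 ≤ p.1 + 1 ∧ p.1 + 1 ≤ d - 1),
      ∑ q : Fin (d - p.1),
        contract C.B.flip (show p.1 + 1 + (d - p.1) = d + 1 by omega) q.castSucc
          (discTensor Ω (p.1 + 1 + 1) ⊗ₜ[ℂ]
            signOp 𝒱 (fun c => ∑ l ∈ Finset.univ.filter (· < q.castSucc), (1 - c l))
              (discTensor Ω (d - p.1 + 1))) = 0

end Operad

/-! ### A-infinity algebras -/

/-- The A-infinity relation with `d` inputs for operations `m_d` on a cohomologically graded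
vector space, with `m_d (a_d, …, a_1)` written as `m_d (a₁ ⊗ ⋯ ⊗ a_d)`; the elements
`a₁, a₂, …` are `a 0, a 1, …`. -/
def AInfRelation (𝒜 : ℤ → Submodule ℂ V) (m : ∀ d : ℕ, T V d →ₗ[ℂ] V) (d : ℕ) : Prop :=
  ∀ (a : ℕ → V) (c : ℕ → ℤ), (∀ i, a i ∈ 𝒜 (c i)) →
    ∑ p ∈ Finset.Icc 1 d, ∑ q ∈ Finset.range (d - p + 1),
      (∑ i ∈ Finset.range q, c i - (q : ℤ)).negOnePow •
        m (d - p + 1) (PiTensorProduct.tprod ℂ fun j : Fin (d - p + 1) =>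
          if j.1 < q then a j
          else if j.1 = q then m p (PiTensorProduct.tprod ℂ fun i : Fin p => a (q + i))
          else a (j + p - 1)) = 0

/-- Non-unital A-infinity algebras. -/
structure IsAInfAlgebra (𝒜 : ℤ → Submodule ℂ V) (m : ∀ d : ℕ, T V d →ₗ[ℂ] V) : Prop where
  degree : ∀ d : ℕ, 1 ≤ d → ∀ (c : Fin d → ℤ) (a : Fin d → V), (∀ i, a i ∈ 𝒜 (c i)) →
    m d (PiTensorProduct.tprod ℂ a) ∈ 𝒜 (∑ i, c i + 2 - (d : ℤ))
  relation : ∀ d : ℕ, 1 ≤ d → AInfRelation 𝒜 m d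

/-- The cohomological grading of a chain complex: the part of degree `i` consists of the elements
`x` with `1 - deg x = i`. -/
def cohomological (𝒱 : ℤ → Submodule ℂ V) : ℤ → Submodule ℂ V := fun i => 𝒱 (1 - i)

end QuantumAInf

end

noncomputable section

namespace QuantumAInf

open Finset

section

/-! ### Signs -/

/-! Combinatorics. For genus label `0` the equation `1 = 2 g + i_σ` forces `g = 0` and one cycle, so
the generators are the long cycles. They are all conjugate under permutations that fix the last leg
(`exists_genConj_rotGen`), and both sides of the quantum relation are equivariant (`dEV_kAct`,
`treeSum_genConj`). Hence the relation need only be tested on the dual of `(1 2 ⋯ n)`. A one-edge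
tree contributes there only if the legs at its first vertex form an interval without the last leg,
and then both vertices must carry the standard rotation (`ordConnected_of_glue_eq`,
`glue_finRotate`, `glue_injective`). Such intervals are indexed by length and starting point: these
are the `p` and `q` of the A-infinity relation.

Signs. The orientation is the Koszul sign for odd flags, so together with the sign of the
contraction it forms one exponent `edgeExponent`, defined for every distribution of flags to two
vertices. Koszul exponents satisfy a cocycle rule (`koszul_trans`), which gives equivariance. The
identity `1 + c c' = (1 - c)(1 - c') + c + c'` turns the product of the two Koszul signs into one
for the shifted degrees `1 - deg`, up to weights by position, which are the décalage signs
(`koszul_shift`). For an interval, with even total shifted degree at both vertices, all that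
survives is the shifted degree in front of the insertion slot (`edgeExponent_of_ordConnected`): this
is Seidel's sign. The same shift applied to `d` yields the terms with `m₁` (`decalage_dEV`).

Operations. Since `B` is non-degenerate, a tensor is determined by its operation
(`toHom_injective`), and contraction of tensors becomes composition of operations
(`toHom_contract`). A factor `w` that pairs non-trivially with an argument `a` satisfies `|w| = |a|
- 1` modulo 2, because `B` has odd degree; this turns signs read from the tensor into signs read
from the arguments (`sgn_slot_mul`). -/

@[simp] lemma sgn_zero : sgn 0 = 1 := by simp [sgn]

@[simp] lemma sgn_one : sgn 1 = -1 := by simp [sgn]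

lemma sgn_add (a b : ZMod 2) : sgn (a + b) = sgn a * sgn b := by
  have h : ∀ x : ZMod 2, x = 0 ∨ x = 1 := by decide
  have h2 : (1 + 1 : ZMod 2) = 0 := by decide
  rcases h a with rfl | rfl <;> rcases h b with rfl | rfl <;> simp [h2]

@[simp] lemma sgn_mul_self (a : ZMod 2) : sgn a * sgn a = 1 := by
  rw [← sgn_add, CharTwo.add_self_eq_zero, sgn_zero]

lemma sgn_intCast (z : ℤ) : sgn (z : ZMod 2) = ((z.negOnePow : ℤ) : ℂ) := by
  rcases Int.even_or_odd z with h | h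
  · rw [Int.negOnePow_even z h, (ZMod.intCast_eq_zero_iff_even (n := z)).2 h]
    simp
  · rw [Int.negOnePow_odd z h, (ZMod.intCast_eq_one_iff_odd (n := z)).2 h]
    simp

lemma units_smul_eq {M : Type*} [AddCommGroup M] [Module ℂ M] (u : ℤˣ) (x : M) :
    u • x = ((u : ℤ) : ℂ) • x := by
  rw [Units.smul_def, Int.cast_smul_eq_zsmul]

lemma negOnePow_smul {M : Type*} [AddCommGroup M] [Module ℂ M] (z : ℤ) (x : M) :
    z.negOnePow • x = sgn (z : ZMod 2) • x := by
  rw [units_smul_eq, sgn_intCast]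

/-! ### Homogeneous tensors -/

variable {V : Type*} [AddCommGroup V] [Module ℂ V]

section Graded

variable {𝒱 : ℤ → Submodule ℂ V} [DirectSum.Decomposition 𝒱]

lemma parityProj_of_mem {i : ℤ} {x : V} (hx : x ∈ 𝒱 i) (ε : ZMod 2) :
    parityProj 𝒱 ε x = if (i : ZMod 2) = ε then x else 0 := by
  rw [parityProj, LinearMap.comp_apply, LinearEquiv.coe_coe, DirectSum.decomposeLinearEquiv_apply,
    DirectSum.decompose_of_mem 𝒱 hx, ← DirectSum.lof_eq_of ℂ, DirectSum.toModule_lof]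
  split_ifs <;> simp

lemma tprod_parityProj {n : ℕ} {c : Fin n → ℤ} {v : Fin n → V} (hv : ∀ i, v i ∈ 𝒱 (c i))
    (e : Fin n → ZMod 2) :
    PiTensorProduct.tprod ℂ (fun i => parityProj 𝒱 (e i) (v i)) =
      if (fun i => (c i : ZMod 2)) = e then PiTensorProduct.tprod ℂ v else 0 := by
  split_ifs with h
  · subst h
    congr 1
    ext i
    rw [parityProj_of_mem (hv i), if_pos rfl]
  · obtain ⟨i, hi⟩ := Function.ne_iff.1 h
    apply MultilinearMap.map_coord_zero _ i
    rw [parityProj_of_mem (hv i), if_neg hi]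

lemma signOp_tprod {n : ℕ} {c : Fin n → ℤ} {v : Fin n → V} (hv : ∀ i, v i ∈ 𝒱 (c i))
    (s : (Fin n → ZMod 2) → ZMod 2) :
    signOp 𝒱 s (PiTensorProduct.tprod ℂ v) =
      sgn (s fun i => c i) • PiTensorProduct.tprod ℂ v := by
  classical
  simp only [signOp, LinearMap.sum_apply, LinearMap.smul_apply, PiTensorProduct.map_tprod,
    tprod_parityProj hv, smul_ite, smul_zero]
  rw [sum_ite_eq, if_pos (mem_univ _)]

variable (𝒱) in
/-- Linear maps on tensor powers that agree on products of homogeneous elements are equal. -/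
lemma tensor_ext {n : ℕ} {M : Type*} [AddCommGroup M] [Module ℂ M] {f g : T V n →ₗ[ℂ] M}
    (h : ∀ (c : Fin n → ℤ) (v : Fin n → V), (∀ i, v i ∈ 𝒱 (c i)) →
      f (PiTensorProduct.tprod ℂ v) = g (PiTensorProduct.tprod ℂ v)) : f = g := by
  classical
  apply PiTensorProduct.ext
  apply MultilinearMap.ext
  intro v
  -- The set `s` contains the positions whose factors may still be inhomogeneous; each induction
  -- step decomposes one of them.
  have key : ∀ s : Finset (Fin n), ∀ v : Fin n → V, (∀ i ∉ s, ∃ j, v i ∈ 𝒱 j) →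
      f (PiTensorProduct.tprod ℂ v) = g (PiTensorProduct.tprod ℂ v) := by
    intro s
    induction s using Finset.induction_on with
    | empty =>
      intro v hv
      choose c hc using fun i => hv i (by simp)
      exact h c v hc
    | insert i s his ih =>
      intro v hv
      have h2 : (f.compMultilinearMap (PiTensorProduct.tprod ℂ)).toLinearMap v i =
          (g.compMultilinearMap (PiTensorProduct.tprod ℂ)).toLinearMap v i := by
        apply LinearMap.ext
        intro x
        induction x using DirectSum.Decomposition.inductionOn 𝒱 with
        | zero => simp
        | homogeneous x =>
          simp only [MultilinearMap.toLinearMap_apply, LinearMap.compMultilinearMap_apply]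
          apply ih
          intro k hk
          by_cases hki : k = i
          · subst hki
            exact ⟨_, by rw [Function.update_self]; exact x.2⟩
          · rw [Function.update_of_ne hki]
            exact hv k (by simp [hki, hk])
        | add x y hx hy => rw [map_add, map_add, hx, hy]
      have := LinearMap.congr_fun h2 (v i)
      simpa using this
  exact key univ v (by simp)

variable (𝒱) in
lemma tensor_ext₂ {k m : ℕ} {M : Type*} [AddCommGroup M] [Module ℂ M]
    {f g : T V k ⊗[ℂ] T V m →ₗ[ℂ] M}
    (h : ∀ (a : Fin k → ℤ) (v : Fin k → V), (∀ i, v i ∈ 𝒱 (a i)) →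
      ∀ (c : Fin m → ℤ) (w : Fin m → V), (∀ i, w i ∈ 𝒱 (c i)) →
      f (PiTensorProduct.tprod ℂ v ⊗ₜ PiTensorProduct.tprod ℂ w) =
        g (PiTensorProduct.tprod ℂ v ⊗ₜ PiTensorProduct.tprod ℂ w)) : f = g := by
  apply TensorProduct.ext
  apply tensor_ext 𝒱
  intro a v hv
  apply tensor_ext 𝒱
  intro c w hw
  simpa using h a v hv c w hw

/-! ### Values of the structure maps on pure tensors -/

lemma applyAt_tprod {n : ℕ} (i : Fin n) (φ : V →ₗ[ℂ] V) (v : Fin n → V) :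
    applyAt i φ (PiTensorProduct.tprod ℂ v) =
      PiTensorProduct.tprod ℂ (Function.update v i (φ (v i))) := by
  rw [applyAt, PiTensorProduct.map_tprod]
  congr 1
  ext j
  by_cases h : j = i
  · subst h; simp
  · simp [h]

lemma extract_tprod {m : ℕ} (β : Fin (m + 1)) (w : Fin (m + 1) → V) :
    extract β (PiTensorProduct.tprod ℂ w) =
      PiTensorProduct.tprod ℂ (fun j => w (β.succAbove j)) ⊗ₜ[ℂ] w β := by
  simp only [extract, LinearEquiv.trans_apply, PiTensorProduct.reindex_tprod,
    PiTensorProduct.tmulEquiv_symm_apply, TensorProduct.congr_tmul, LinearEquiv.refl_apply,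
    PiTensorProduct.subsingletonEquiv_apply_tprod]
  congr 2

lemma contract_tprod (B : V →ₗ[ℂ] V →ₗ[ℂ] ℂ) {k m n : ℕ} (h : k + m = n) (β : Fin (m + 1))
    (v : Fin (k + 1) → V) (w : Fin (m + 1) → V) :
    contract B h β (PiTensorProduct.tprod ℂ v ⊗ₜ PiTensorProduct.tprod ℂ w) =
      B (v (Fin.last k)) (w β) • PiTensorProduct.tprod ℂ (fun x =>
        Sum.elim (fun i => v (Fin.castSucc i)) (fun j => w (β.succAbove j))
          ((insertEquiv h β).symm x)) := by
  simp only [contract, LinearMap.comp_apply, TensorProduct.map_tmul, LinearEquiv.coe_coe,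
    extract_tprod, TensorProduct.tensorTensorTensorComm_tmul, PiTensorProduct.tmulEquiv_apply,
    PiTensorProduct.reindex_tprod, TensorProduct.lift.tmul, TensorProduct.rid_tmul,
    Fin.succAbove_last]
lemma toHom_tprod (B : V →ₗ[ℂ] V →ₗ[ℂ] ℂ) (d : ℕ) (w : Fin (d + 1) → V) (a : Fin d → V) :
    toHom B d (PiTensorProduct.tprod ℂ w) (PiTensorProduct.tprod ℂ a) =
      (∏ i, B (w (Fin.castSucc i)) (a i)) • w (Fin.last d) := by
  simp only [toHom, LinearMap.comp_apply, LinearEquiv.coe_coe, extract_tprod,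
    TensorProduct.map_tmul, PiTensorProduct.map_tprod, dualTensorHom_apply,
    PiTensorProduct.dualDistrib_apply, LinearMap.id_apply, Fin.succAbove_last]

lemma kAct_tprod {n : ℕ} (π : Equiv.Perm (Fin n)) {c : Fin n → ℤ} {v : Fin n → V}
    (hv : ∀ i, v i ∈ 𝒱 (c i)) :
    kAct 𝒱 π (PiTensorProduct.tprod ℂ v) =
      sgn (∑ i, ∑ j, if i < j ∧ π j < π i then (c i * c j : ZMod 2) else 0) •
        PiTensorProduct.tprod ℂ (fun i => v (π.symm i)) := by
  rw [kAct, LinearMap.comp_apply, signOp_tprod hv, map_smul, LinearEquiv.coe_coe,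
    PiTensorProduct.reindex_tprod]

lemma dEV_tprod (C : InnerComplex 𝒱) {n : ℕ} {c : Fin n → ℤ} {v : Fin n → V}
    (hv : ∀ i, v i ∈ 𝒱 (c i)) :
    dEV C n (PiTensorProduct.tprod ℂ v) =
      ∑ i, sgn (∑ l ∈ univ.filter (· < i), (c l : ZMod 2)) •
        PiTensorProduct.tprod ℂ (Function.update v i (C.d (v i))) := by
  simp only [dEV, LinearMap.sum_apply, LinearMap.comp_apply, signOp_tprod hv, map_smul,
    applyAt_tprod]

lemma compEV_tprod (C : InnerComplex 𝒱) {k m n : ℕ} (h : k + m = n) (β : Fin (m + 1))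
    {a : Fin (k + 1) → ℤ} {v : Fin (k + 1) → V} (hv : ∀ i, v i ∈ 𝒱 (a i))
    {c : Fin (m + 1) → ℤ} {w : Fin (m + 1) → V} (hw : ∀ i, w i ∈ 𝒱 (c i)) :
    compEV C h β (PiTensorProduct.tprod ℂ v ⊗ₜ PiTensorProduct.tprod ℂ w) =
      sgn (treeExponent C.degB β (fun i => a i) (fun i => c i)) •
        contract C.B h β (PiTensorProduct.tprod ℂ v ⊗ₜ PiTensorProduct.tprod ℂ w) := by
  classical
  simp only [compEV, LinearMap.sum_apply, LinearMap.smul_apply, LinearMap.comp_apply,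
    TensorProduct.map_tmul, PiTensorProduct.map_tprod, tprod_parityProj hv, tprod_parityProj hw]
  rw [sum_eq_single (fun i => (a i : ZMod 2)), sum_eq_single (fun i => (c i : ZMod 2))]
  · simp
  · intro b _ hb
    simp [hb.symm]
  · simp
  · intro b _ hb
    simp [hb.symm]
  · simp

end Graded

/-- If `B x y` does not vanish, the two degrees have odd sum, so one of them is even and the Koszul
sign in the antisymmetry is trivial. -/
lemma InnerComplex.B_flip {𝒱 : ℤ → Submodule ℂ V} [DirectSum.Decomposition 𝒱]
    (C : InnerComplex 𝒱) (hB : Odd C.degB) : C.B.flip = -C.B := by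
  have key : ∀ i j, ∀ x ∈ 𝒱 i, ∀ y ∈ 𝒱 j, C.B y x = - C.B x y := by
    intro i j x hx y hy
    by_cases h : i + j = C.degB
    · have : Even (i * j) := by
        rw [← h] at hB
        rcases Int.even_or_odd i with hi | hi
        · exact hi.mul_right _
        · rcases Int.even_or_odd j with hj | hj
          · exact hj.mul_left _
          · exact absurd (hi.add_odd hj) (by simpa using hB)
      rw [C.B_antisymm i j x hx y hy, Int.negOnePow_even _ this, one_smul]
    · rw [C.B_degree i j x hx y hy h, C.B_degree j i y hy x hx (by omega), neg_zero]
  ext x y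
  simp only [LinearMap.flip_apply, LinearMap.neg_apply]
  induction x using DirectSum.Decomposition.inductionOn 𝒱 with
  | zero => simp
  | add x x' hx hx' => simp only [map_add, LinearMap.add_apply, hx, hx']; ring
  | homogeneous x =>
    induction y using DirectSum.Decomposition.inductionOn 𝒱 with
    | zero => simp
    | add y y' hy hy' => simp only [map_add, LinearMap.add_apply, hy, hy']; ring
    | homogeneous y => exact key _ _ _ x.2 _ y.2

end

section

/-! ### Koszul signs -/

/-- The exponent of the Koszul sign for reordering elements of parities `c`, from the order given by
the positions `r` to the order given by the positions `s`. -/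
def koszul {F : Type*} [Fintype F] (r s : F → ℕ) (c : F → ZMod 2) : ZMod 2 :=
  ∑ a, ∑ b, if r a < r b ∧ s b < s a then c a * c b else 0

section Koszul

variable {F : Type*} [Fintype F]

lemma koszul_equiv {F' : Type*} [Fintype F'] (e : F' ≃ F) (r s : F → ℕ) (c : F → ZMod 2) :
    koszul (fun a => r (e a)) (fun a => s (e a)) (fun a => c (e a)) = koszul r s c := by
  unfold koszul
  rw [← e.sum_comp]
  refine sum_congr rfl fun a _ => ?_
  rw [← e.sum_comp]

lemma koszul_self (r : F → ℕ) (c : F → ZMod 2) : koszul r r c = 0 := by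
  unfold koszul
  refine sum_eq_zero fun a _ => sum_eq_zero fun b _ => if_neg ?_
  omega

/-- Collects the two orders of each pair, so that inversions with respect to different orders can be
compared pair by pair. -/
lemma sum_sum_eq_sum_ordered {A : Type*} [AddCommMonoid A] {r : F → ℕ} (hr : r.Injective)
    (G : F → F → A) (hG : ∀ a, G a a = 0) :
    ∑ a, ∑ b, G a b = ∑ a, ∑ b, if r a < r b then G a b + G b a else 0 := by
  have h1 : ∀ a b, G a b = (if r a < r b then G a b else 0) + if r b < r a then G a b else 0 := by
    intro a b
    rcases lt_trichotomy (r a) (r b) with h | h | h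
    · simp [h, h.not_gt]
    · simp [hr h, hG]
    · simp [h, h.not_gt]
  have h2 : ∑ a, ∑ b, (if r b < r a then G a b else 0) =
      ∑ a, ∑ b, if r a < r b then G b a else 0 := sum_comm
  calc ∑ a, ∑ b, G a b
      = ∑ a, ∑ b, ((if r a < r b then G a b else 0) + if r b < r a then G a b else 0) :=
        sum_congr rfl fun a _ => sum_congr rfl fun b _ => h1 a b
    _ = _ := by
      simp only [sum_add_distrib]
      rw [h2]
      simp only [← sum_add_distrib]
      refine sum_congr rfl fun a _ => sum_congr rfl fun b _ => ?_
      split_ifs <;> simp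

/-- A pair is inverted from `r` to `t` exactly when it is inverted in just one of the two successive
reorderings; modulo 2 the contributions add up. -/
lemma koszul_trans {r s t : F → ℕ} (hr : r.Injective) (hs : s.Injective) (ht : t.Injective)
    (c : F → ZMod 2) : koszul r s c + koszul s t c = koszul r t c := by
  have h : koszul s t c = _ := sum_sum_eq_sum_ordered hr _ (by simp)
  rw [h]
  unfold koszul
  rw [← sum_add_distrib]
  refine sum_congr rfl fun a _ => ?_
  rw [← sum_add_distrib]
  refine sum_congr rfl fun b _ => ?_
  by_cases hab : r a < r b
  · have hne : a ≠ b := by rintro rfl; omega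
    have h1 : s a ≠ s b := hs.ne hne
    have h2 : t a ≠ t b := ht.ne hne
    have h3 : c a * c b + c a * c b = 0 := CharTwo.add_self_eq_zero _
    rcases lt_or_gt_of_ne h1 with h1 | h1 <;> rcases lt_or_gt_of_ne h2 with h2 | h2 <;>
      simp [hab, h1, h2, h1.not_gt, h2.not_gt, h3, mul_comm (c b)]
  · simp [hab]

lemma koszul_comm {r s : F → ℕ} (hr : r.Injective) (hs : s.Injective) (c : F → ZMod 2) :
    koszul r s c = koszul s r c := by
  have := koszul_trans hr hs hr c
  rw [koszul_self] at this
  exact CharTwo.add_eq_zero.1 this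

/-- Sum `1 + c c' = (1 - c)(1 - c') + c + c'` over the inverted pairs. The linear part counts each
`c a` with the number of inversions at `a`, and modulo 2 this number is the sum of the ranks of `a`
in the two orders. -/
lemma koszul_shift {r s : F → ℕ} (hr : r.Injective) (hs : s.Injective) (c : F → ZMod 2) :
    koszul r s (fun _ => 1) + koszul r s c = koszul r s (fun a => 1 - c a) +
      ∑ a, c a * ((#{b | r b < r a} : ZMod 2) + (#{b | s b < s a} : ZMod 2)) := by
  have h0 : ∀ x : ZMod 2, x + x = 0 := CharTwo.add_self_eq_zero
  have h : ∑ a, c a * ((#{b | r b < r a} : ZMod 2) + (#{b | s b < s a} : ZMod 2)) =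
      ∑ a, ∑ b, if r a < r b ∧ s b < s a then c a + c b else 0 := by
    have h1 : ∑ a, c a * ((#{b | r b < r a} : ZMod 2) + (#{b | s b < s a} : ZMod 2)) =
        ∑ a, ∑ b, c a * ((if r b < r a then 1 else 0) + if s b < s a then 1 else 0) := by
      refine sum_congr rfl fun a _ => ?_
      rw [← mul_sum, sum_add_distrib, sum_boole, sum_boole]
    rw [h1, sum_sum_eq_sum_ordered hr _ (by simp)]
    refine sum_congr rfl fun a _ => sum_congr rfl fun b _ => ?_
    by_cases hab : r a < r b
    · have hne : a ≠ b := by rintro rfl; omega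
      have h1 : s a ≠ s b := hs.ne hne
      rcases lt_or_gt_of_ne h1 with h1 | h1 <;>
        simp [hab, h1, h1.not_gt, hab.not_gt, h0]
    · simp [hab]
  rw [h]
  unfold koszul
  simp only [← sum_add_distrib]
  refine sum_congr rfl fun a _ => sum_congr rfl fun b _ => ?_
  split_ifs
  · ring
  · simp

end Koszul

lemma sgn_koszul_one {n : ℕ} (π : Equiv.Perm (Fin n)) :
    sgn (koszul (fun i => i.1) (fun i => (π i).1) fun _ => 1) = ((π.sign : ℤ) : ℂ) := by
  have hsum : ∀ (s : Finset (Fin n)) (f : Fin n → ZMod 2), sgn (∑ i ∈ s, f i) =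
      ∏ i ∈ s, sgn (f i) := by
    intro s f
    induction s using Finset.cons_induction with
    | empty => simp
    | cons a s ha ih => rw [sum_cons, prod_cons, sgn_add, ih]
  rw [Equiv.Perm.sign_eq_prod_prod_Iio, koszul, sum_comm, hsum]
  push_cast
  refine prod_congr rfl fun j _ => ?_
  rw [hsum, ← prod_subset (subset_univ (Iio j))]
  · refine prod_congr rfl fun i hi => ?_
    have hi : i < j := by simpa using hi
    have hne : π i ≠ π j := π.injective.ne hi.ne
    rcases lt_or_gt_of_ne hne with h | h
    · have h' : ¬ (π j).1 < (π i).1 := by have : (π i).1 < (π j).1 := h; omega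
      simp [h, h']
    · have h1 : (π j).1 < (π i).1 := h
      have h2 : i.1 < j.1 := hi
      simp [h1, h2, h.not_gt]
  · intro i _ hi
    have hi : ¬ i.1 < j.1 := by simpa using hi
    simp [hi]

end

section

/-! ### The signs of a one-edge tree -/

/-- The positions of the flags in the order `1, …, n, f, f'`. -/
def stdPos (n : ℕ) (a : Option (Option (Fin n))) : ℕ := (flagEquiv n a).1

/-- The positions of the flags in the order given by the two vertices of a tree. -/
def listPos {n k m : ℕ} (e : Option (Option (Fin n)) ≃ Fin (k + 1) ⊕ Fin (m + 1))
    (a : Option (Option (Fin n))) : ℕ := (finSumFinEquiv (e a)).1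

@[simp] lemma optionCongr_symm_none {α β : Type*} (e : α ≃ β) :
    (Equiv.optionCongr e).symm none = none := rfl

@[simp] lemma optionCongr_symm_some {α β : Type*} (e : α ≃ β) (x : β) :
    (Equiv.optionCongr e).symm (some x) = some (e.symm x) := rfl

@[simp] lemma flagEquiv_none (n : ℕ) : flagEquiv n none = (Fin.last n).castSucc := by
  simp [flagEquiv]

@[simp] lemma flagEquiv_some_none (n : ℕ) : flagEquiv n (some none) = Fin.last (n + 1) := by
  simp only [flagEquiv, Equiv.trans_apply, Equiv.optionCongr_apply, Option.map_some,
    finSuccEquiv'_symm_none, finSuccEquiv'_symm_some]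
  rw [Fin.succAbove_of_le_castSucc _ _ le_rfl, Fin.succ_last]

@[simp] lemma flagEquiv_some_some {n : ℕ} (i : Fin n) :
    flagEquiv n (some (some i)) = i.castSucc.castSucc := by
  simp only [flagEquiv, Equiv.trans_apply, Equiv.optionCongr_apply, Option.map_some,
    finSuccEquiv'_symm_some, Fin.succAbove_last]
  rw [Fin.succAbove_of_castSucc_lt]
  simp [Fin.lt_def]

@[simp] lemma stdPos_none (n : ℕ) : stdPos n none = n := by simp [stdPos]

@[simp] lemma stdPos_some_none (n : ℕ) : stdPos n (some none) = n + 1 := by simp [stdPos]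

@[simp] lemma stdPos_some_some {n : ℕ} (i : Fin n) : stdPos n (some (some i)) = i := by
  simp [stdPos]

lemma stdPos_injective (n : ℕ) : (stdPos n).Injective :=
  Fin.val_injective.comp (flagEquiv n).injective

lemma listPos_injective {n k m : ℕ} (e : Option (Option (Fin n)) ≃ Fin (k + 1) ⊕ Fin (m + 1)) :
    (listPos e).Injective :=
  Fin.val_injective.comp (finSumFinEquiv.injective.comp e.injective)

@[simp] lemma treeFlags_none {n : ℕ} (I : Finset (Fin n)) :
    treeFlags I none = Sum.inl (Fin.last I.card) := by
  simp [treeFlags, splitFlags]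

@[simp] lemma treeFlags_some_none {n : ℕ} (I : Finset (Fin n)) :
    treeFlags I (some none) = Sum.inr (slot I) := by
  simp [treeFlags, splitFlags]

lemma treeFlags_legEquiv_inl {n : ℕ} (I : Finset (Fin n)) (i : Fin I.card) :
    treeFlags I (some (some (legEquiv I (Sum.inl i)))) = Sum.inl i.castSucc := by
  simp [treeFlags, splitFlags]

lemma treeFlags_legEquiv_inr {n : ℕ} (I : Finset (Fin n)) (j : Fin Iᶜ.card) :
    treeFlags I (some (some (legEquiv I (Sum.inr j)))) = Sum.inr ((slot I).succAbove j) := by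
  simp [treeFlags, splitFlags]

/-- With this form the orientation obeys the same cocycle rule as the Koszul sign of the degrees. -/
lemma orientation_eq {n : ℕ} (I : Finset (Fin n)) :
    ((orientation I : ℤ) : ℂ) =
      sgn (koszul (stdPos n) (listPos (treeFlags I)) fun _ => 1) := by
  rw [orientation, ← sgn_koszul_one, ← koszul_equiv (flagEquiv n)]
  simp
  rfl

lemma val_succAbove {m : ℕ} (β : Fin (m + 1)) (j : Fin m) :
    (β.succAbove j).1 = if j.1 < β.1 then j.1 else j.1 + 1 := by
  unfold Fin.succAbove
  simp only [Fin.lt_def, Fin.val_castSucc]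
  split_ifs <;> simp

lemma val_insertEquiv_inl {k m n : ℕ} (h : k + m = n) (β : Fin (m + 1)) (i : Fin k) :
    (insertEquiv h β (Sum.inl i)).1 = β + i := rfl

lemma val_insertEquiv_inr {k m n : ℕ} (h : k + m = n) (β : Fin (m + 1)) (j : Fin m) :
    (insertEquiv h β (Sum.inr j)).1 = if j.1 < β.1 then j.1 else j.1 + k := by
  simp only [insertEquiv, Equiv.coe_fn_mk]
  split_ifs <;> rfl

/-- The Koszul sign for moving the flags `f`, `f'` of an edge to the end, and the other flags of the
first vertex to the position of `f'`. -/
lemma koszul_insert {k m n : ℕ} (h : k + m = n) (β : Fin (m + 1))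
    {r s : Option (Option (Fin k ⊕ Fin m)) → ℕ}
    (hr1 : r none = k) (hr2 : r (some none) = k + 1 + β)
    (hr3 : ∀ i, r (some (some (Sum.inl i))) = i)
    (hr4 : ∀ j, r (some (some (Sum.inr j))) = k + 1 + (β.succAbove j).1)
    (hs1 : s none = n) (hs2 : s (some none) = n + 1)
    (hs3 : ∀ x, s (some (some x)) = (insertEquiv h β x).1)
    (c : Option (Option (Fin k ⊕ Fin m)) → ZMod 2) :
    koszul r s c = (∑ i, c (some (some (Sum.inl i)))) *
        (∑ j : Fin m, if j.1 < β.1 then c (some (some (Sum.inr j))) else 0) +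
      c none * (∑ j, c (some (some (Sum.inr j)))) +
      c (some none) * (∑ j : Fin m, if j.1 < β.1 then 0 else c (some (some (Sum.inr j)))) := by
  -- Three kinds of pairs are inverted: `f` with every leg of the second vertex (`e1`), `f'` with
  -- the legs after it (`e2`), and a leg of the first vertex with the legs before the slot (`e3`).
  -- The remaining facts exclude all other pairs.
  have e1 : ∀ j, (if r none < r (some (some (Sum.inr j))) ∧ s (some (some (Sum.inr j))) < s none
      then c none * c (some (some (Sum.inr j))) else 0) = c none * c (some (some (Sum.inr j))) := by
    intro j
    rw [if_pos]
    have := (insertEquiv h β (Sum.inr j)).2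
    rw [hr1, hr4, hs1, hs3]
    omega
  have e2 : ∀ j, (if r (some none) < r (some (some (Sum.inr j))) ∧
      s (some (some (Sum.inr j))) < s (some none)
      then c (some none) * c (some (some (Sum.inr j))) else 0) =
      c (some none) * (if j.1 < β.1 then 0 else c (some (some (Sum.inr j)))) := by
    intro j
    have := (insertEquiv h β (Sum.inr j)).2
    rw [hr2, hr4, hs2, hs3, val_succAbove]
    by_cases hj : j.1 < β.1
    · rw [if_neg (by simp only [hj, if_true]; omega), if_pos hj, mul_zero]
    · rw [if_pos (by simp only [hj, if_false]; omega), if_neg hj]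
  have e3 : ∀ i j, (if r (some (some (Sum.inl i))) < r (some (some (Sum.inr j))) ∧
      s (some (some (Sum.inr j))) < s (some (some (Sum.inl i)))
      then c (some (some (Sum.inl i))) * c (some (some (Sum.inr j))) else 0) =
      c (some (some (Sum.inl i))) * (if j.1 < β.1 then c (some (some (Sum.inr j))) else 0) := by
    intro i j
    have := i.2
    rw [hr3, hr4, hs3, hs3, val_insertEquiv_inl, val_insertEquiv_inr]
    by_cases hj : j.1 < β.1
    · rw [if_pos (by simp only [hj, if_true]; omega), if_pos hj]
    · rw [if_neg (by simp only [hj, if_false]; omega), if_neg hj, mul_zero]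
  have e4 : ∀ i x, ¬ (r (some (some (Sum.inl i))) < r x ∧ s x < s (some (some (Sum.inl i)))) ∨
      ∃ j, x = some (some (Sum.inr j)) := by
    intro i x
    have := i.2
    have h1 := (insertEquiv h β (Sum.inl i)).2
    rcases x with _ | _ | x | j
    · left; rw [hs1, hs3]; omega
    · left; rw [hs2, hs3]; omega
    · left; rw [hr3, hr3, hs3, hs3, val_insertEquiv_inl, val_insertEquiv_inl]; omega
    · exact Or.inr ⟨j, rfl⟩
  have e5 : ∀ j x, ¬ (r (some (some (Sum.inr j))) < r x ∧ s x < s (some (some (Sum.inr j)))) := by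
    intro j x
    have h1 := (insertEquiv h β (Sum.inr j)).2
    rcases x with _ | _ | x | l
    · rw [hs1, hs3]; omega
    · rw [hs2, hs3]; omega
    · rw [hr3, hr4]; have := x.2; omega
    · rw [hr4, hr4, hs3, hs3, val_succAbove, val_succAbove, val_insertEquiv_inr,
        val_insertEquiv_inr]
      split_ifs <;> omega
  have e6 : ∀ i, ¬ (r none < r (some (some (Sum.inl i)))) := by
    intro i
    have := i.2
    rw [hr1, hr3]; omega
  have e7 : ∀ i, ¬ (r (some none) < r (some (some (Sum.inl i)))) := by
    intro i
    have := i.2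
    rw [hr2, hr3]; omega
  have e8 : ¬ s (some none) < s none := by rw [hs1, hs2]; omega
  have e9 : ¬ r (some none) < r none := by rw [hr1, hr2]; omega
  have e10 : ∀ i, ∀ x, (x = none ∨ x = some none ∨ ∃ l, x = some (some (Sum.inl l))) →
      ¬ (r (some (some (Sum.inl i))) < r x ∧ s x < s (some (some (Sum.inl i)))) := by
    rintro i x hx
    rcases e4 i x with h | ⟨j, rfl⟩
    · exact h
    · simp at hx
  simp only [koszul, Fintype.sum_option, Fintype.sum_sum_type, e1, e2, e3, e5, e6, e7, e8, e9,
    if_false, false_and, and_false, lt_irrefl, sum_const_zero, zero_add, add_zero]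
  simp only [e10 _ none (Or.inl rfl), e10 _ (some none) (Or.inr (Or.inl rfl)),
    fun i l => e10 i (some (some (Sum.inl l))) (Or.inr (Or.inr ⟨l, rfl⟩)), if_false,
    sum_const_zero, zero_add, ← mul_sum, ← sum_mul]
  ring

lemma zmod_two_mul_self (x : ZMod 2) : x * x = x := by
  revert x; decide

lemma sum_filter_lt_succAbove {M : Type*} [AddCommMonoid M] {m : ℕ} (β : Fin (m + 1))
    (w : Fin (m + 1) → M) :
    ∑ j ∈ univ.filter (· < β), w j = ∑ j : Fin m, if j.1 < β.1 then w (β.succAbove j) else 0 := by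
  rw [sum_filter, Fin.sum_univ_succAbove _ β, if_neg (lt_irrefl _), zero_add]
  refine sum_congr rfl fun j _ => ?_
  have : β.succAbove j < β ↔ j.1 < β.1 := by
    rw [Fin.lt_def, val_succAbove]
    split_ifs <;> omega
  simp only [this]

/-- Modulo 2 squares are linear, so the diagonal terms and the total degree of `w` each occur twice
and cancel. -/
lemma treeExponent_eq (b : ℤ) {k m : ℕ} (β : Fin (m + 1)) (v : Fin (k + 1) → ZMod 2)
    (w : Fin (m + 1) → ZMod 2) :
    treeExponent b β v w = b * (∑ i : Fin k, v i.castSucc) +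
      (∑ j ∈ univ.filter (· < β), w j) * (∑ i : Fin k, v i.castSucc + w β) := by
  simp only [treeExponent, mul_sub, zmod_two_mul_self, sum_sub_distrib, ← sum_mul,
    Fin.sum_univ_castSucc (f := v)]
  generalize ∑ j ∈ univ.filter (· < β), w j = y
  generalize ∑ i : Fin k, v i.castSucc = x
  generalize ∑ i, w i = z
  have h2 : (2 : ZMod 2) = 0 := rfl
  linear_combination (y * z - y - y * w β) * h2

/-- The sign of the contraction along the edge of a tree, followed by the reordering of the legs, is
the Koszul sign for the reordering of all the flags. -/
lemma treeExponent_add_koszul {n : ℕ} (I : Finset (Fin n)) (b : ℤ)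
    (a : Fin (I.card + 1) → ZMod 2) (c : Fin (Iᶜ.card + 1) → ZMod 2)
    (hb : a (Fin.last _) + c (slot I) = b) :
    treeExponent b (slot I) a c +
        koszul (fun i => i.1) (fun i => (shuffle I i).1)
          (fun i => Sum.elim a c (treeFlags I (some (some (shuffle I i))))) =
      koszul (listPos (treeFlags I)) (stdPos n) (fun x => Sum.elim a c (treeFlags I x)) +
        b * ∑ i, Sum.elim a c (treeFlags I (some (some i))) := by
  set col : Option (Option (Fin n)) → ZMod 2 := fun x => Sum.elim a c (treeFlags I x) with hcol
  -- The intermediate order: legs as the contraction produces them, then `f`, `f'`. By the cocycle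
  -- rule the full Koszul sign splits into that of the insertion and that of the shuffle of the
  -- legs. The term `b * ∑` is the sign for moving a form of degree `b` past the legs.
  set mid : Option (Option (Fin n)) → ℕ :=
    fun x => stdPos n ((Equiv.optionCongr (Equiv.optionCongr (shuffle I).symm)) x) with hmid
  have hmidinj : mid.Injective := (stdPos_injective n).comp (Equiv.injective _)
  have h1 : koszul mid (stdPos n) col = koszul (fun i => i.1) (fun i => (shuffle I i).1)
      (fun i => Sum.elim a c (treeFlags I (some (some (shuffle I i))))) := by
    rw [← koszul_equiv (Equiv.optionCongr (Equiv.optionCongr (shuffle I)))]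
    have h2 : ∀ i : Fin n, ¬ n < i.1 := fun i => i.2.le.not_gt
    have h3 : ∀ i : Fin n, ¬ n + 1 < i.1 := fun i => by omega
    simp [koszul, hmid, Fintype.sum_option, h2, h3, hcol]
  rw [← koszul_trans (listPos_injective _) hmidinj (stdPos_injective n), h1]
  have h4 := koszul_equiv (Equiv.optionCongr (Equiv.optionCongr (legEquiv I)))
    (listPos (treeFlags I)) mid col
  rw [koszul_insert (card_add_card_compl I) (slot I)] at h4
  rotate_left
  · simp [listPos]
  · simp [listPos]
  · intro i; simp [listPos, treeFlags_legEquiv_inl]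
  · intro i; simp [listPos, treeFlags_legEquiv_inr]
  · simp [hmid]
  · simp [hmid]
  · intro x; simp [hmid, shuffle]
  have h5 : ∑ i, Sum.elim a c (treeFlags I (some (some i))) =
      ∑ i, a (Fin.castSucc i) + ∑ j, c ((slot I).succAbove j) := by
    rw [← (legEquiv I).sum_comp, Fintype.sum_sum_type]
    simp only [treeFlags_legEquiv_inl, treeFlags_legEquiv_inr, Sum.elim_inl, Sum.elim_inr]
  simp only [Equiv.optionCongr_apply, Option.map_some, Option.map_none, hcol,
    treeFlags_legEquiv_inl, treeFlags_legEquiv_inr, Sum.elim_inl, Sum.elim_inr, treeFlags_none,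
    treeFlags_some_none] at h4
  rw [← h4, h5, treeExponent_eq, sum_filter_lt_succAbove, ← hb]
  have h6 : ∑ j : Fin Iᶜ.card, c ((slot I).succAbove j) =
      (∑ j : Fin Iᶜ.card, if j.1 < (slot I).1 then c ((slot I).succAbove j) else 0) +
      ∑ j : Fin Iᶜ.card, if j.1 < (slot I).1 then 0 else c ((slot I).succAbove j) := by
    rw [← sum_add_distrib]
    refine sum_congr rfl fun j _ => ?_
    split_ifs <;> simp
  rw [h6]
  generalize (∑ j : Fin Iᶜ.card, if j.1 < (slot I).1 then c ((slot I).succAbove j) else 0) = y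
  generalize (∑ j : Fin Iᶜ.card, if j.1 < (slot I).1 then 0 else c ((slot I).succAbove j)) = z
  have h2 : (2 : ZMod 2) = 0 := rfl
  linear_combination (-(a (Fin.last _) * (y + z)) - c (slot I) * z) * h2

end

section

/-! ### Composition along an edge with the Koszul sign of all flags -/

variable {V : Type*} [AddCommGroup V] [Module ℂ V]

/-- The contraction of the factors at the two flags of an edge by `B`. -/
def edgeForm (B : V →ₗ[ℂ] V →ₗ[ℂ] ℂ) (n : ℕ) :
    MultilinearMap ℂ (fun _ : Option (Option (Fin n)) => V) (T V n) where
  toFun u := B (u none) (u (some none)) • PiTensorProduct.tprod ℂ fun i => u (some (some i))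
  map_update_add' := by
    intro _ u x y z
    have h : ∀ (i : Fin n) (y : V), (fun j : Fin n => Function.update u (some (some i)) y
        (some (some j))) = Function.update (fun j => u (some (some j))) i y := by
      intro i y
      ext j
      by_cases hj : j = i
      · subst hj; simp
      · simp [hj]
    rcases x with _ | _ | i
    · simp [add_smul]
    · simp [add_smul]
    · simp only [h, MultilinearMap.map_update_add]
      simp
  map_update_smul' := by
    intro _ u x y z
    have h : ∀ (i : Fin n) (y : V), (fun j : Fin n => Function.update u (some (some i)) y
        (some (some j))) = Function.update (fun j => u (some (some j))) i y := by
      intro i y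
      ext j
      by_cases hj : j = i
      · subst hj; simp
      · simp [hj]
    rcases x with _ | _ | i
    · simp [mul_smul]
    · simp [mul_smul]
    · simp only [h, MultilinearMap.map_update_smul]
      simp only [ne_eq, reduceCtorEq, not_false_eq_true, Function.update_of_ne, Option.some.injEq]
      rw [smul_comm]

variable {𝒱 : ℤ → Submodule ℂ V} [DirectSum.Decomposition 𝒱] (C : InnerComplex 𝒱)

/-- The exponent of the sign of `edgeMap`. -/
def edgeExponent (degB : ℤ) {n k m : ℕ} (e : Option (Option (Fin n)) ≃ Fin (k + 1) ⊕ Fin (m + 1))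
    (v : Fin (k + 1) → ZMod 2) (w : Fin (m + 1) → ZMod 2) : ZMod 2 :=
  koszul (listPos e) (stdPos n) (fun _ => 1) +
    koszul (listPos e) (stdPos n) (fun x => Sum.elim v w (e x)) +
    degB * ∑ i, Sum.elim v w (e (some (some i)))

/-- Contraction along an edge, for any distribution `e` of the flags to two vertices, with
the Koszul sign and the orientation. -/
def edgeMap {n k m : ℕ} (e : Option (Option (Fin n)) ≃ Fin (k + 1) ⊕ Fin (m + 1)) :
    T V (k + 1) ⊗[ℂ] T V (m + 1) →ₗ[ℂ] T V n :=
  ∑ v : Fin (k + 1) → ZMod 2, ∑ w : Fin (m + 1) → ZMod 2,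
    sgn (edgeExponent C.degB e v w) •
      (PiTensorProduct.lift ((edgeForm C.B n).domDomCongr e) ∘ₗ
        (PiTensorProduct.tmulEquiv ℂ V).toLinearMap ∘ₗ
        TensorProduct.map (PiTensorProduct.map fun i => parityProj 𝒱 (v i))
          (PiTensorProduct.map fun j => parityProj 𝒱 (w j)))

lemma edgeMap_tprod {n k m : ℕ} (e : Option (Option (Fin n)) ≃ Fin (k + 1) ⊕ Fin (m + 1))
    {a : Fin (k + 1) → ℤ} {v : Fin (k + 1) → V} (hv : ∀ i, v i ∈ 𝒱 (a i))
    {c : Fin (m + 1) → ℤ} {w : Fin (m + 1) → V} (hw : ∀ i, w i ∈ 𝒱 (c i)) :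
    edgeMap C e (PiTensorProduct.tprod ℂ v ⊗ₜ PiTensorProduct.tprod ℂ w) =
      sgn (edgeExponent C.degB e (fun i => a i) (fun i => c i)) •
        C.B (Sum.elim v w (e none)) (Sum.elim v w (e (some none))) •
          PiTensorProduct.tprod ℂ fun i => Sum.elim v w (e (some (some i))) := by
  classical
  simp only [edgeMap, LinearMap.sum_apply, LinearMap.smul_apply, LinearMap.comp_apply,
    TensorProduct.map_tmul, PiTensorProduct.map_tprod, tprod_parityProj hv, tprod_parityProj hw]
  rw [sum_eq_single (fun i => (a i : ZMod 2)), sum_eq_single (fun i => (c i : ZMod 2))]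
  · simp only [if_true, LinearEquiv.coe_coe, PiTensorProduct.tmulEquiv_apply,
      PiTensorProduct.lift.tprod, MultilinearMap.domDomCongr_apply]
    rfl
  · intro b _ hb
    simp [hb.symm]
  · simp
  · intro b _ hb
    simp [hb.symm]
  · simp

lemma kAct_tprod_koszul {n : ℕ} (π : Equiv.Perm (Fin n)) {c : Fin n → ℤ} {v : Fin n → V}
    (hv : ∀ i, v i ∈ 𝒱 (c i)) :
    kAct 𝒱 π (PiTensorProduct.tprod ℂ v) =
      sgn (koszul (fun i => i.1) (fun i => (π i).1) fun i => (c i : ZMod 2)) •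
        PiTensorProduct.tprod ℂ (fun i => v (π.symm i)) :=
  kAct_tprod π hv

/-- Identifies the operadic composition, twisted by the orientation, with a map whose sign makes
sense for any numbering of the flags; equivariance is proved for the latter. -/
lemma edgeMap_treeFlags {n : ℕ} (I : Finset (Fin n)) :
    edgeMap C (treeFlags I) = ((orientation I : ℤ) : ℂ) • evTree C I := by
  apply tensor_ext₂ 𝒱
  intro a v hv c w hw
  rw [edgeMap_tprod C _ hv hw, LinearMap.smul_apply, evTree, LinearMap.comp_apply,
    compEV_tprod C _ _ hv hw, contract_tprod, treeFlags_none, treeFlags_some_none, Sum.elim_inl,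
    Sum.elim_inr]
  -- The sign comparison needs the degrees at the edge to add up to that of `B`; otherwise both
  -- sides vanish.
  by_cases hB : a (Fin.last _) + c (slot I) = C.degB
  swap
  · rw [C.B_degree _ _ _ (hv _) _ (hw _) hB]
    simp
  have hF : ∀ x, (fun x : Fin n => Sum.elim (fun i => v (Fin.castSucc i))
      (fun j => w ((slot I).succAbove j))
        ((insertEquiv (card_add_card_compl I) (slot I)).symm x)) x =
      Sum.elim v w (treeFlags I (some (some (shuffle I x)))) := by
    intro x
    obtain ⟨y, rfl⟩ := (insertEquiv (card_add_card_compl I) (slot I)).surjective x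
    rcases y with y | y <;>
      simp [shuffle, treeFlags_legEquiv_inl, treeFlags_legEquiv_inr]
  have hhom : ∀ x : Fin n, Sum.elim v w (treeFlags I (some (some (shuffle I x)))) ∈
      𝒱 (Sum.elim a c (treeFlags I (some (some (shuffle I x))))) := by
    intro x
    rcases treeFlags I (some (some (shuffle I x))) with y | y
    · exact hv y
    · exact hw y
  rw [funext hF, map_smul, map_smul, kAct_tprod_koszul _ hhom]
  have hcol : ∀ x, ((Sum.elim a c x : ℤ) : ZMod 2) =
      Sum.elim (fun i => (a i : ZMod 2)) (fun i => (c i : ZMod 2)) x := by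
    rintro (x | x) <;> rfl
  simp only [hcol, Equiv.apply_symm_apply]
  have hs := treeExponent_add_koszul I C.degB (fun i => a i) (fun i => c i)
    (by rw [← hB]; push_cast; rfl)
  have h3 : sgn (edgeExponent C.degB (treeFlags I) (fun i => a i) (fun i => c i)) =
      ((orientation I : ℤ) : ℂ) * (sgn (treeExponent C.degB (slot I) (fun i => a i) (fun i => c i)) *
        sgn (koszul (fun i => i.1) (fun i => (shuffle I i).1)
          (fun i => Sum.elim (fun i => (a i : ZMod 2)) (fun i => (c i : ZMod 2))
            (treeFlags I (some (some (shuffle I i))))))) := by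
    rw [← sgn_add, hs, orientation_eq, koszul_comm (stdPos_injective n) (listPos_injective _),
      ← sgn_add, edgeExponent]
    congr 1
    ring
  rw [h3]
  simp only [smul_smul]
  congr 1
  ring

/-- Renumbering within the vertices never inverts flags of different vertices. -/
lemma koszul_listPos {n k m : ℕ} (e : Option (Option (Fin n)) ≃ Fin (k + 1) ⊕ Fin (m + 1))
    (ρ : Equiv.Perm (Fin (k + 1))) (τ : Equiv.Perm (Fin (m + 1)))
    (v : Fin (k + 1) → ZMod 2) (w : Fin (m + 1) → ZMod 2) :
    koszul (listPos e) (listPos (e.trans (Equiv.sumCongr ρ τ))) (fun x => Sum.elim v w (e x)) =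
      koszul (fun i => i.1) (fun i => (ρ i).1) v + koszul (fun i => i.1) (fun i => (τ i).1) w := by
  rw [← koszul_equiv e.symm]
  have h1 : ∀ (i : Fin (k + 1)) (j : Fin (m + 1)), ¬ (k + 1 + j.1 < i.1) := by
    intro i j; have := i.2; omega
  simp [koszul, listPos, Fintype.sum_sum_type, h1, -Fin.val_fin_lt]
  rfl

lemma sum_elim_sumCongr {X Y α β : Type*} (e : X ≃ α ⊕ β) (ρ : Equiv.Perm α) (τ : Equiv.Perm β)
    (v : α → Y) (w : β → Y) (x : X) :
    Sum.elim (fun i => v (ρ.symm i)) (fun i => w (τ.symm i)) ((e.trans (Equiv.sumCongr ρ τ)) x) =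
      Sum.elim v w (e x) := by
  rw [Equiv.trans_apply]
  rcases e x with y | y <;> simp

lemma edgeExponent_sumCongr (b : ℤ) {n k m : ℕ}
    (e : Option (Option (Fin n)) ≃ Fin (k + 1) ⊕ Fin (m + 1))
    (ρ : Equiv.Perm (Fin (k + 1))) (τ : Equiv.Perm (Fin (m + 1)))
    (v : Fin (k + 1) → ZMod 2) (w : Fin (m + 1) → ZMod 2) :
    koszul (fun i => i.1) (fun i => (ρ i).1) v + koszul (fun i => i.1) (fun i => (τ i).1) w +
        edgeExponent b (e.trans (Equiv.sumCongr ρ τ)) (fun i => v (ρ.symm i))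
          (fun i => w (τ.symm i)) =
      koszul (fun i => i.1) (fun i => (ρ i).1) (fun _ => 1) +
        koszul (fun i => i.1) (fun i => (τ i).1) (fun _ => 1) + edgeExponent b e v w := by
  have h : ∀ c, koszul (listPos e) (stdPos n) c =
      koszul (listPos e) (listPos (e.trans (Equiv.sumCongr ρ τ))) c +
        koszul (listPos (e.trans (Equiv.sumCongr ρ τ))) (stdPos n) c := fun c =>
    (koszul_trans (listPos_injective _) (listPos_injective _) (stdPos_injective n) c).symm
  have h1 := koszul_listPos e ρ τ v w
  have h2 := koszul_listPos e ρ τ (fun _ => 1) (fun _ => 1)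
  have h3 : (fun x => Sum.elim (fun _ => 1) (fun _ => 1) (e x)) = fun _ => (1 : ZMod 2) := by
    ext x
    rcases e x with y | y <;> rfl
  rw [h3] at h2
  simp only [edgeExponent, sum_elim_sumCongr, h, ← h1, ← h2]
  generalize koszul (listPos e) (listPos (e.trans (Equiv.sumCongr ρ τ))) (fun _ => 1) = x
  have h0 : (2 : ZMod 2) = 0 := rfl
  linear_combination (-x) * h0

/-- The Koszul signs of `kAct` are absorbed by the cocycle rule; the odd flags of the orientation
leave the signs of `ρ` and `τ`. -/
lemma edgeMap_kAct {n k m : ℕ} (e : Option (Option (Fin n)) ≃ Fin (k + 1) ⊕ Fin (m + 1))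
    (ρ : Equiv.Perm (Fin (k + 1))) (τ : Equiv.Perm (Fin (m + 1))) :
    edgeMap C (e.trans (Equiv.sumCongr ρ τ)) ∘ₗ TensorProduct.map (kAct 𝒱 ρ) (kAct 𝒱 τ) =
      (((ρ.sign : ℤ) : ℂ) * ((τ.sign : ℤ) : ℂ)) • edgeMap C e := by
  apply tensor_ext₂ 𝒱
  intro a v hv c w hw
  rw [LinearMap.smul_apply, edgeMap_tprod C _ hv hw, LinearMap.comp_apply, TensorProduct.map_tmul,
    kAct_tprod_koszul ρ hv, kAct_tprod_koszul τ hw, TensorProduct.smul_tmul_smul, map_smul,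
    edgeMap_tprod C _ (fun i => hv (ρ.symm i)) (fun i => hw (τ.symm i))]
  simp only [sum_elim_sumCongr]
  rw [smul_smul _ (sgn _), smul_smul _ (sgn _), ← sgn_koszul_one, ← sgn_koszul_one, ← sgn_add,
    ← sgn_add, ← sgn_add, ← sgn_add, edgeExponent_sumCongr C.degB e ρ τ (fun i => (a i : ZMod 2))
      (fun i => (c i : ZMod 2))]

/-- A permutation of the legs of a graph with one edge. -/
abbrev legPerm {n : ℕ} (π : Equiv.Perm (Fin n)) : Equiv.Perm (Option (Option (Fin n))) :=
  Equiv.optionCongr (Equiv.optionCongr π)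

lemma koszul_legPerm {n : ℕ} (π : Equiv.Perm (Fin n)) (c : Option (Option (Fin n)) → ZMod 2) :
    koszul (stdPos n) (fun x => stdPos n (legPerm π x)) c =
      koszul (fun i => i.1) (fun i => (π i).1) fun i => c (some (some i)) := by
  have h2 : ∀ i : Fin n, ¬ n < i.1 := fun i => i.2.le.not_gt
  have h3 : ∀ i : Fin n, ¬ n + 1 < i.1 := fun i => by omega
  simp [koszul, Fintype.sum_option, h2, h3]

lemma edgeExponent_legPerm (b : ℤ) {n k m : ℕ}
    (e : Option (Option (Fin n)) ≃ Fin (k + 1) ⊕ Fin (m + 1)) (π : Equiv.Perm (Fin n))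
    (v : Fin (k + 1) → ZMod 2) (w : Fin (m + 1) → ZMod 2) :
    edgeExponent b ((legPerm π).symm.trans e) v w =
      koszul (fun i => i.1) (fun i => (π i).1) (fun _ => 1) +
        koszul (fun i => i.1) (fun i => (π i).1) (fun i => Sum.elim v w (e (some (some i)))) +
        edgeExponent b e v w := by
  have h : ∀ c : Option (Option (Fin n)) → ZMod 2,
      koszul (listPos ((legPerm π).symm.trans e)) (stdPos n) (fun x => c ((legPerm π).symm x)) =
        koszul (listPos e) (stdPos n) c +
          koszul (fun i => i.1) (fun i => (π i).1) (fun i => c (some (some i))) := by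
    intro c
    rw [← koszul_equiv (legPerm π), ← koszul_legPerm,
      koszul_trans (t := fun x => stdPos n (legPerm π x)) (listPos_injective e)
        (stdPos_injective n) ((stdPos_injective n).comp (legPerm π).injective)]
    simp only [listPos, Equiv.trans_apply, Equiv.symm_apply_apply]
    rfl
  have h1 := h fun _ => 1
  have h2 := h fun x => Sum.elim v w (e x)
  have h3 : ∑ i, Sum.elim v w (((legPerm π).symm.trans e) (some (some i))) =
      ∑ i, Sum.elim v w (e (some (some i))) := by
    rw [← Equiv.sum_comp π]
    simp
  rw [edgeExponent, edgeExponent, h1, h3]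
  simp only [Equiv.trans_apply]
  rw [h2]
  ring

lemma edgeMap_legPerm {n k m : ℕ} (e : Option (Option (Fin n)) ≃ Fin (k + 1) ⊕ Fin (m + 1))
    (π : Equiv.Perm (Fin n)) :
    edgeMap C ((legPerm π).symm.trans e) = ((π.sign : ℤ) : ℂ) • (kAct 𝒱 π ∘ₗ edgeMap C e) := by
  apply tensor_ext₂ 𝒱
  intro a v hv c w hw
  have hhom : ∀ x : Fin n, Sum.elim v w (e (some (some x))) ∈
      𝒱 (Sum.elim a c (e (some (some x)))) := by
    intro x
    rcases e (some (some x)) with y | y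
    · exact hv y
    · exact hw y
  have hcol : ∀ x, ((Sum.elim a c x : ℤ) : ZMod 2) =
      Sum.elim (fun i => (a i : ZMod 2)) (fun i => (c i : ZMod 2)) x := by
    rintro (x | x) <;> rfl
  rw [LinearMap.smul_apply, LinearMap.comp_apply, edgeMap_tprod C _ hv hw,
    edgeMap_tprod C _ hv hw, map_smul, map_smul, kAct_tprod_koszul π hhom, edgeExponent_legPerm,
    ← sgn_koszul_one, sgn_add, sgn_add]
  simp only [hcol, smul_smul, Equiv.trans_apply, optionCongr_symm_none, optionCongr_symm_some]
  congr 1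
  ring

/-! ### The differential is equivariant -/

lemma dEV_kAct {n : ℕ} (π : Equiv.Perm (Fin n)) :
    dEV C n ∘ₗ kAct 𝒱 π = kAct 𝒱 π ∘ₗ dEV C n := by
  classical
  apply tensor_ext 𝒱
  intro c v hv
  rw [LinearMap.comp_apply, LinearMap.comp_apply, kAct_tprod_koszul π hv, map_smul,
    dEV_tprod C (fun i => hv (π.symm i)), dEV_tprod C hv, map_sum, smul_sum, ← Equiv.sum_comp π]
  refine sum_congr rfl fun i _ => ?_
  have hu : ∀ j, Function.update v i (C.d (v i)) j ∈ 𝒱 (Function.update c i (c i - 1) j) := by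
    intro j
    by_cases hj : j = i
    · subst hj; simpa using C.d_mem _ _ (hv j)
    · simpa [hj] using hv j
  rw [map_smul, kAct_tprod_koszul π hu, smul_smul, smul_smul]
  congr 1
  · rw [← sgn_add, ← sgn_add]
    congr 1
    have h1 : ∑ l ∈ univ.filter (· < π i), (c (π.symm l) : ZMod 2) =
        ∑ l, if π l < π i then (c l : ZMod 2) else 0 := by
      rw [sum_filter, ← Equiv.sum_comp π]
      simp
    have h0 : ∀ x : ZMod 2, x + x = 0 := CharTwo.add_self_eq_zero
    -- Lowering the degree of the factor `i` by one changes the Koszul exponent by the degrees of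
    -- the factors inverted with `i`.
    have h2 : koszul (fun i => i.1) (fun i => (π i).1)
          (fun j => ((Function.update c i (c i - 1) j : ℤ) : ZMod 2)) =
        koszul (fun i => i.1) (fun i => (π i).1) (fun j => (c j : ZMod 2)) +
          ∑ l, ((if i < l ∧ π l < π i then (c l : ZMod 2) else 0) +
            if l < i ∧ π i < π l then (c l : ZMod 2) else 0) := by
      have h3 : ∀ j, ((Function.update c i (c i - 1) j : ℤ) : ZMod 2) =
          c j + if j = i then 1 else 0 := by
        intro j
        by_cases hj : j = i
        · subst hj
          simp [sub_eq_add_neg]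
        · simp [hj]
      have h4 : ∀ a b : Fin n, (if a.1 < b.1 ∧ (π b).1 < (π a).1 then
          ((c a : ZMod 2) + if a = i then 1 else 0) * (c b + if b = i then 1 else 0) else 0) =
          (if a.1 < b.1 ∧ (π b).1 < (π a).1 then (c a : ZMod 2) * c b else 0) +
          (if a = i then (if i < b ∧ π b < π i then (c b : ZMod 2) else 0) else 0) +
          (if b = i then (if a < i ∧ π i < π a then (c a : ZMod 2) else 0) else 0) := by
        intro a b
        by_cases ha : a = i <;> by_cases hb : b = i
        · subst ha; subst hb; simp
        · subst ha
          simp only [hb, if_true, if_false, add_zero, add_mul, one_mul, Fin.val_fin_lt]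
          split_ifs <;> simp
        · subst hb
          simp only [ha, if_true, if_false, add_zero, mul_add, mul_one, Fin.val_fin_lt]
          split_ifs <;> simp
        · simp [ha, hb]
      simp only [koszul, h3, h4, sum_add_distrib]
      simp [add_assoc, sum_ite_irrel]
    rw [h1, h2, sum_filter]
    -- The same inversions account for the change of the set of factors that `d` passes: those in
    -- front of `π i` instead of those in front of `i`.
    have h5 : (∑ l, if π l < π i then (c l : ZMod 2) else 0) =
        (∑ l, if l < i then (c l : ZMod 2) else 0) +
          ∑ l, ((if i < l ∧ π l < π i then (c l : ZMod 2) else 0) +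
            if l < i ∧ π i < π l then (c l : ZMod 2) else 0) := by
      rw [← sum_add_distrib]
      refine sum_congr rfl fun l _ => ?_
      by_cases hl : l = i
      · subst hl; simp
      · have hl' : π l ≠ π i := π.injective.ne hl
        rcases lt_or_gt_of_ne hl with h | h <;> rcases lt_or_gt_of_ne hl' with h' | h' <;>
          simp [h, h', h.not_gt, h'.not_gt, h0]
    rw [h5]
    ring
  · congr 1
    ext j
    by_cases hj : j = π i
    · subst hj; simp
    · have : π.symm j ≠ i := fun h => hj (by rw [← h]; simp)
      simp [hj, this]

end

section

/-! ### Planar trees and Seidel's sign -/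

/-- An order-connected set is the interval from its minimum to its maximum, and `slot I` counts the
legs below the minimum. -/
lemma mem_iff_of_ordConnected {n : ℕ} {I : Finset (Fin n)} (hI : (I : Set (Fin n)).OrdConnected)
    (x : Fin n) : x ∈ I ↔ (slot I).1 ≤ x.1 ∧ x.1 < (slot I).1 + I.card := by
  rcases I.eq_empty_or_nonempty with rfl | hne
  · simp
  have h1 : I = Icc (I.min' hne) (I.max' hne) := by
    ext y
    rw [mem_Icc]
    exact ⟨fun hy => ⟨I.min'_le _ hy, I.le_max' _ hy⟩, fun hy => by
      have := hI.out (I.min'_mem hne) (I.max'_mem hne) hy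
      simpa using this⟩
  have h2 : (slot I).1 = (I.min' hne).1 := by
    have : (Iᶜ.filter fun j => ∀ i ∈ I, j < i) = Iio (I.min' hne) := by
      ext j
      simp only [mem_filter, mem_compl, mem_Iio]
      refine ⟨fun h => h.2 _ (I.min'_mem hne), fun h => ⟨fun hj => ?_, fun i hi => ?_⟩⟩
      · exact (I.min'_le _ hj).not_gt h
      · exact h.trans_le (I.min'_le _ hi)
    simp only [slot]
    rw [this, Fin.card_Iio]
  have hle : (I.min' hne).1 ≤ (I.max' hne).1 := I.min'_le _ (I.max'_mem hne)
  have h3 : I.card = (I.max' hne).1 + 1 - (I.min' hne).1 := by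
    conv_lhs => rw [h1]
    rw [Fin.card_Icc]
  rw [h2, h3]
  conv_lhs => rw [h1]
  rw [mem_Icc, Fin.le_def, Fin.le_def]
  omega

/-- Insertion of a block lists both groups of legs increasingly, and an increasing enumeration is
unique. Thus a planar tree needs no shuffle after contraction. -/
lemma legEquiv_of_ordConnected {n : ℕ} {I : Finset (Fin n)}
    (hI : (I : Set (Fin n)).OrdConnected) :
    legEquiv I = insertEquiv (card_add_card_compl I) (slot I) := by
  have h1 : (fun i => insertEquiv (card_add_card_compl I) (slot I) (Sum.inl i)) =
      I.orderEmbOfFin rfl := by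
    apply orderEmbOfFin_unique
    · intro i
      rw [mem_iff_of_ordConnected hI, val_insertEquiv_inl]
      have := i.2
      omega
    · intro i j hij
      rw [Fin.lt_def, val_insertEquiv_inl, val_insertEquiv_inl]
      have : i.1 < j.1 := hij
      omega
  have h2 : (fun j => insertEquiv (card_add_card_compl I) (slot I) (Sum.inr j)) =
      Iᶜ.orderEmbOfFin rfl := by
    apply orderEmbOfFin_unique
    · intro i
      rw [mem_compl, mem_iff_of_ordConnected hI, val_insertEquiv_inr]
      split_ifs <;> omega
    · intro i j hij
      rw [Fin.lt_def, val_insertEquiv_inr, val_insertEquiv_inr]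
      have : i.1 < j.1 := hij
      split_ifs <;> omega
  ext x
  rcases x with i | j
  · rw [legEquiv, finSumEquivOfFinset_inl, ← congrFun h1 i]
  · rw [legEquiv, finSumEquivOfFinset_inr, ← congrFun h2 j]

lemma card_filter_val_lt {F : Type*} [Fintype F] {N : ℕ} (e : F ≃ Fin N) (a : F) :
    #{b | (e b).1 < (e a).1} = (e a).1 := by
  rw [← Fin.card_Iio (e a), ← card_map e.toEmbedding]
  congr 1
  ext i
  simp only [mem_map, mem_filter, mem_univ, true_and, mem_Iio, Equiv.coe_toEmbedding]
  constructor
  · rintro ⟨b, hb, rfl⟩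
    rwa [Fin.card_Iio] at hb
  · intro h
    exact ⟨e.symm i, by simpa using h, by simp⟩

/-- The form of `koszul_shift` in which the position weights multiply shifted degrees, as they do in
`decalage`. -/
lemma koszul_add_koszul_one {n k m : ℕ} (e : Option (Option (Fin n)) ≃ Fin (k + 1) ⊕ Fin (m + 1))
    (c : Option (Option (Fin n)) → ZMod 2) :
    koszul (listPos e) (stdPos n) (fun _ => 1) + koszul (listPos e) (stdPos n) c =
      koszul (listPos e) (stdPos n) (fun x => 1 - c x) +
        ∑ x, (listPos e x : ZMod 2) * (1 - c x) + ∑ x, (stdPos n x : ZMod 2) * (1 - c x) := by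
  have h1 : ∀ c, koszul (listPos e) (stdPos n) (fun _ => 1) + koszul (listPos e) (stdPos n) c =
      koszul (listPos e) (stdPos n) (fun a => 1 - c a) +
        ∑ a, c a * ((listPos e a : ZMod 2) + (stdPos n a : ZMod 2)) := by
    intro c
    rw [koszul_shift (listPos_injective e) (stdPos_injective n)]
    congr 1
    refine sum_congr rfl fun a _ => ?_
    rw [show #{b | listPos e b < listPos e a} = listPos e a from
      card_filter_val_lt (e.trans finSumFinEquiv) a,
      show #{b | stdPos n b < stdPos n a} = stdPos n a from card_filter_val_lt (flagEquiv n) a]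
  -- For constant `c = 1` the Koszul terms cancel or vanish, which shows that the ranks of the two
  -- orders have the same total modulo 2.
  have h2 : ∑ a, ((listPos e a : ZMod 2) + (stdPos n a : ZMod 2)) = 0 := by
    have := h1 fun _ => 1
    rw [CharTwo.add_self_eq_zero] at this
    simpa [koszul] using this.symm
  rw [h1 c, add_assoc, ← sum_add_distrib]
  congr 1
  have h3 : ∀ x, (listPos e x : ZMod 2) * (1 - c x) + (stdPos n x : ZMod 2) * (1 - c x) =
      ((listPos e x : ZMod 2) + (stdPos n x : ZMod 2)) -
        c x * ((listPos e x : ZMod 2) + (stdPos n x : ZMod 2)) := fun x => by ring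
  simp only [h3, sum_sub_distrib, h2]
  rw [zero_sub, ZMod.neg_eq_self_mod_two]

/-- The heart of Seidel's sign. In shifted degrees the parities at `f` and `f'` add up to one and
each vertex has even total, so the insertion sign reduces to the degree behind the slot,
equivalently the degree in front of it plus that of `f'`. The last term cancels against the weights
of `f` and `f'` at the end of the standard order; the other position weights are the décalage signs.
-/
lemma edgeExponent_of_ordConnected {n : ℕ} {I : Finset (Fin n)}
    (hI : (I : Set (Fin n)).OrdConnected) {b : ℤ} (hb : Odd b)
    (a : Fin (I.card + 1) → ZMod 2) (c : Fin (Iᶜ.card + 1) → ZMod 2)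
    (hac : a (Fin.last _) + c (slot I) = b) (ha : ∑ i, (1 - a i) = 0) (hc : ∑ j, (1 - c j) = 0) :
    edgeExponent b (treeFlags I) a c +
        ∑ i : Fin n, ((i.1 + 1 : ℕ) : ZMod 2) *
          (1 - Sum.elim a c (treeFlags I (some (some i)))) =
      ∑ j ∈ univ.filter (· < slot I), (1 - c j) +
        ∑ i, ((i.1 + 1 : ℕ) : ZMod 2) * (1 - a i) +
        ∑ j, ((j.1 + 1 : ℕ) : ZMod 2) * (1 - c j) := by
  have hb1 : (b : ZMod 2) = 1 := (ZMod.intCast_eq_one_iff_odd (n := b)).2 hb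
  set e := treeFlags I with he
  have hleg := legEquiv_of_ordConnected hI
  have hK := koszul_equiv (Equiv.optionCongr (Equiv.optionCongr (legEquiv I)))
    (listPos e) (stdPos n) (fun x => 1 - Sum.elim a c (e x))
  rw [koszul_insert (card_add_card_compl I) (slot I)] at hK
  rotate_left
  · simp [listPos, he]
  · simp [listPos, he]
  · intro i; simp [listPos, he, treeFlags_legEquiv_inl]
  · intro i; simp [listPos, he, treeFlags_legEquiv_inr]
  · simp
  · simp
  · intro x; simp [hleg]
  simp only [Equiv.optionCongr_apply, Option.map_some, Option.map_none, he,
    treeFlags_legEquiv_inl, treeFlags_legEquiv_inr, Sum.elim_inl, Sum.elim_inr, treeFlags_none,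
    treeFlags_some_none] at hK
  rw [← he] at hK
  have hlist : ∑ x, (listPos e x : ZMod 2) * (1 - Sum.elim a c (e x)) =
      ∑ i, (i.1 : ZMod 2) * (1 - a i) + ∑ j, (j.1 : ZMod 2) * (1 - c j) := by
    have h1 : ∑ x, (listPos e x : ZMod 2) * (1 - Sum.elim a c (e x)) =
      ∑ y, ((finSumFinEquiv y).1 : ZMod 2) * (1 - Sum.elim a c y) :=
        e.sum_comp fun y => ((finSumFinEquiv y).1 : ZMod 2) * (1 - Sum.elim a c y)
    rw [h1, Fintype.sum_sum_type]
    congr 1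
    -- Positions at the second vertex are offset by `I.card + 1`; the offset multiplies its total
    -- shifted degree, which is even.
    simp only [finSumFinEquiv_apply_right, Fin.val_natAdd, Sum.elim_inr, Nat.cast_add, add_mul,
      sum_add_distrib, ← mul_sum, hc, mul_zero, zero_add]
  have hstd : ∑ x, (stdPos n x : ZMod 2) * (1 - Sum.elim a c (e x)) =
      n * (1 - a (Fin.last _)) + ((n + 1) * (1 - c (slot I)) +
        ∑ i : Fin n, (i.1 : ZMod 2) * (1 - Sum.elim a c (e (some (some i))))) := by
    simp [Fintype.sum_option, he]
  have hsum : ∑ i : Fin n, (1 - Sum.elim a c (e (some (some i)))) =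
      ∑ i : Fin I.card, (1 - a i.castSucc) + ∑ j, (1 - c ((slot I).succAbove j)) := by
    rw [← (legEquiv I).sum_comp, Fintype.sum_sum_type]
    simp only [he, treeFlags_legEquiv_inl, treeFlags_legEquiv_inr, Sum.elim_inl, Sum.elim_inr]
  have hsum' : ∑ i : Fin n, Sum.elim a c (e (some (some i))) =
      n - ∑ i : Fin n, (1 - Sum.elim a c (e (some (some i)))) := by
    simp
  have h6 : ∑ j : Fin Iᶜ.card, (1 - c ((slot I).succAbove j)) =
      (∑ j : Fin Iᶜ.card, if j.1 < (slot I).1 then 1 - c ((slot I).succAbove j) else 0) +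
      ∑ j : Fin Iᶜ.card, if j.1 < (slot I).1 then 0 else 1 - c ((slot I).succAbove j) := by
    rw [← sum_add_distrib]
    refine sum_congr rfl fun j _ => ?_
    split_ifs <;> simp
  rw [edgeExponent, koszul_add_koszul_one, hlist, hstd, ← hK, hb1, hsum',
    sum_filter_lt_succAbove, hsum]
  rw [Fin.sum_univ_succAbove _ (slot I), h6] at hc
  rw [Fin.sum_univ_castSucc] at ha
  rw [hb1] at hac
  push_cast
  simp only [add_mul, one_mul, sum_add_distrib]
  rw [hsum, Fin.sum_univ_castSucc (f := fun i => 1 - a i),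
    Fin.sum_univ_succAbove (fun j => 1 - c j) (slot I), h6]
  generalize (∑ j : Fin Iᶜ.card, if j.1 < (slot I).1 then 1 - c ((slot I).succAbove j) else 0) = y
    at *
  generalize (∑ j : Fin Iᶜ.card, if j.1 < (slot I).1 then 0 else 1 - c ((slot I).succAbove j)) = z
    at *
  generalize ∑ i : Fin I.card, (1 - a i.castSucc) = x at *
  generalize c (slot I) = u at *
  generalize a (Fin.last _) = v at *
  generalize (∑ i : Fin n, (i.1 : ZMod 2) * (1 - Sum.elim a c (e (some (some i))))) = A
  generalize (∑ i, (i.1 : ZMod 2) * (1 - a i)) = A1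
  generalize (∑ i, (i.1 : ZMod 2) * (1 - c i)) = A2
  generalize (n : ZMod 2) = N
  have h0 : (2 : ZMod 2) = 0 := rfl
  -- The three parity constraints eliminate `v`, `x` and `z`; what is left is an identity in
  -- finitely many elements of `ZMod 2`.
  obtain rfl : v = 1 - u := by linear_combination hac
  obtain rfl : x = -u := by linear_combination ha
  obtain rfl : z = -(1 - u) - y := by linear_combination hc
  clear hK hlist hstd hsum hsum' h6 hleg he hac ha hc
  decide +revert

end

/-! ### Seidel's sign for tensors of even degree -/

section

/-- `cohDegB - 1 = 1 - degB` is even. This parity is all that the sign computations need from the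
degree of the tensors. -/
lemma even_degree {V : Type*} [AddCommGroup V] [Module ℂ V] {𝒱 : ℤ → Submodule ℂ V}
    (C : InnerComplex 𝒱) (hB : Odd C.degB) (k : ℤ) : Even (2 + k * (C.cohDegB - 1)) := by
  obtain ⟨j, hj⟩ := hB
  exact ⟨1 - k * j, by rw [InnerComplex.cohDegB, hj]; ring⟩

variable {V : Type*} [AddCommGroup V] [Module ℂ V]
variable {𝒱 : ℤ → Submodule ℂ V} [DirectSum.Decomposition 𝒱] (C : InnerComplex 𝒱)

lemma decalage_tprod {n : ℕ} {c : Fin n → ℤ} {v : Fin n → V} (hv : ∀ i, v i ∈ 𝒱 (c i)) :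
    decalage 𝒱 n (PiTensorProduct.tprod ℂ v) =
      sgn (∑ i : Fin n, ((i.1 + 1 : ℕ) : ZMod 2) * (1 - c i)) • PiTensorProduct.tprod ℂ v :=
  signOp_tprod hv _

/-- The sign `(-1) ^ (|w₁| + ⋯ + |w_q|)`, where `q` is the number of factors before `β`. -/
def slotSign (𝒱 : ℤ → Submodule ℂ V) [DirectSum.Decomposition 𝒱] {n : ℕ} (β : Fin n) :
    T V n →ₗ[ℂ] T V n :=
  signOp 𝒱 fun c => ∑ l ∈ univ.filter (· < β), (1 - c l)

lemma decalage_edgeMap_tprod (hB : Odd C.degB) {n : ℕ} {I : Finset (Fin n)}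
    (hI : (I : Set (Fin n)).OrdConnected)
    {a : Fin (I.card + 1) → ℤ} {p : Fin (I.card + 1) → V} (hp : ∀ i, p i ∈ 𝒱 (a i))
    {c : Fin (Iᶜ.card + 1) → ℤ} {q : Fin (Iᶜ.card + 1) → V} (hq : ∀ j, q j ∈ 𝒱 (c j))
    (ha : Even (∑ i, (1 - a i))) (hc : Even (∑ j, (1 - c j))) :
    decalage 𝒱 n (edgeMap C (treeFlags I)
        (PiTensorProduct.tprod ℂ p ⊗ₜ[ℂ] PiTensorProduct.tprod ℂ q)) =
      contract C.B (card_add_card_compl I) (slot I)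
        (decalage 𝒱 (I.card + 1) (PiTensorProduct.tprod ℂ p) ⊗ₜ[ℂ]
          slotSign 𝒱 (slot I) (decalage 𝒱 (Iᶜ.card + 1) (PiTensorProduct.tprod ℂ q))) := by
  rw [edgeMap_tprod C _ hp hq, decalage_tprod hp, decalage_tprod hq, map_smul (slotSign _ _),
    slotSign, signOp_tprod hq]
  simp only [TensorProduct.tmul_smul, ← TensorProduct.smul_tmul', map_smul, contract_tprod,
    treeFlags_none, treeFlags_some_none, Sum.elim_inl, Sum.elim_inr]
  by_cases hac : a (Fin.last _) + c (slot I) = C.degB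
  swap
  · rw [C.B_degree _ _ _ (hp _) _ (hq _) hac]
    simp
  have hF : ∀ x, Sum.elim p q (treeFlags I (some (some x))) =
      Sum.elim (fun i => p (Fin.castSucc i)) (fun j => q ((slot I).succAbove j))
        ((insertEquiv (card_add_card_compl I) (slot I)).symm x) := by
    intro x
    obtain ⟨y, rfl⟩ := (legEquiv I).surjective x
    rw [← legEquiv_of_ordConnected hI, Equiv.symm_apply_apply]
    rcases y with y | y <;> simp [treeFlags_legEquiv_inl, treeFlags_legEquiv_inr]
  have hhom : ∀ x : Fin n, Sum.elim p q (treeFlags I (some (some x))) ∈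
      𝒱 (Sum.elim a c (treeFlags I (some (some x)))) := by
    intro x
    rcases treeFlags I (some (some x)) with y | y
    · exact hp y
    · exact hq y
  have hcol : ∀ x, ((Sum.elim a c x : ℤ) : ZMod 2) =
      Sum.elim (fun i => (a i : ZMod 2)) (fun i => (c i : ZMod 2)) x := by
    rintro (x | x) <;> rfl
  rw [decalage_tprod hhom, ← funext hF]
  simp only [hcol, smul_smul]
  congr 1
  have h1 := edgeExponent_of_ordConnected hI hB (fun i => (a i : ZMod 2)) (fun i => (c i : ZMod 2))
    (by rw [← hac]; push_cast; rfl)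
    (by have := (ZMod.intCast_eq_zero_iff_even (n := _)).2 ha; push_cast at this; exact this)
    (by have := (ZMod.intCast_eq_zero_iff_even (n := _)).2 hc; push_cast at this; exact this)
  have h2 := congrArg sgn h1
  rw [sgn_add, sgn_add, sgn_add] at h2
  linear_combination C.B (p (Fin.last _)) (q (slot I)) * h2

/-- Seidel's sign for a planar tree, for tensors in an even degree. -/
lemma decalage_edgeMap (hB : Odd C.degB) {n : ℕ} {I : Finset (Fin n)}
    (hI : (I : Set (Fin n)).OrdConnected) {D E : ℤ} (hD : Even D) (hE : Even E)
    {x : T V (I.card + 1)} (hx : x ∈ evDegree 𝒱 (I.card + 1) D)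
    {y : T V (Iᶜ.card + 1)} (hy : y ∈ evDegree 𝒱 (Iᶜ.card + 1) E) :
    decalage 𝒱 n (edgeMap C (treeFlags I) (x ⊗ₜ[ℂ] y)) =
      contract C.B (card_add_card_compl I) (slot I)
        (decalage 𝒱 (I.card + 1) x ⊗ₜ[ℂ]
          slotSign 𝒱 (slot I) (decalage 𝒱 (Iᶜ.card + 1) y)) := by
  induction hx using Submodule.span_induction with
  | zero => simp
  | add x x' _ _ h h' => simp only [TensorProduct.add_tmul, map_add, h, h']
  | smul r x _ h => simp only [← TensorProduct.smul_tmul', map_smul, h]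
  | mem x hx =>
    obtain ⟨a, p, hp, ha, rfl⟩ := hx
    induction hy using Submodule.span_induction with
    | zero => simp
    | add x x' _ _ h h' => simp only [TensorProduct.tmul_add, map_add, h, h']
    | smul r x _ h => simp only [TensorProduct.tmul_smul, map_smul, h]
    | mem y hy =>
      obtain ⟨c, q, hq, hc, rfl⟩ := hy
      apply decalage_edgeMap_tprod C hB hI hp hq
      · rw [sum_sub_distrib]; simpa using ha ▸ hD
      · rw [sum_sub_distrib]; simpa using hc ▸ hE

lemma seidel_sign (hB : Odd C.degB) {n : ℕ} {I : Finset (Fin n)}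
    (hI : (I : Set (Fin n)).OrdConnected)
    {a : Fin (I.card + 1) → ℤ} {p : Fin (I.card + 1) → V} (hp : ∀ i, p i ∈ 𝒱 (a i))
    {c : Fin (Iᶜ.card + 1) → ℤ} {q : Fin (Iᶜ.card + 1) → V} (hq : ∀ j, q j ∈ 𝒱 (c j))
    (ha : Even (∑ i, (1 - a i))) (hc : Even (∑ j, (1 - c j))) :
    decalage 𝒱 n (orientation I • evTree C I
        (PiTensorProduct.tprod ℂ p ⊗ₜ[ℂ] PiTensorProduct.tprod ℂ q)) =
      (∑ j ∈ univ.filter (· < slot I), (1 - c j)).negOnePow •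
        contract C.B (card_add_card_compl I) (slot I)
          (decalage 𝒱 (I.card + 1) (PiTensorProduct.tprod ℂ p) ⊗ₜ[ℂ]
            decalage 𝒱 (Iᶜ.card + 1) (PiTensorProduct.tprod ℂ q)) := by
  rw [units_smul_eq, ← LinearMap.smul_apply, ← edgeMap_treeFlags,
    decalage_edgeMap_tprod C hB hI hp hq ha hc, negOnePow_smul, decalage_tprod hq,
    map_smul (slotSign _ _), slotSign, signOp_tprod hq]
  simp only [TensorProduct.tmul_smul, map_smul]
  rw [smul_comm]
  push_cast
  rfl

end

section

/-! ### Equivariance of the sum over trees -/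

instance fintypeGen (n b : ℕ) : Fintype (Gen n b) := Fintype.ofFinite _

lemma numCycles_conj {n : ℕ} (π σ : Equiv.Perm (Fin n)) :
    numCycles (π * σ * π⁻¹) = numCycles σ := by
  rw [numCycles, numCycles, Equiv.Perm.cycleType_conj]
  congr 1
  exact Fintype.card_congr (π.symm.subtypeEquiv fun i => by
    simp [Equiv.Perm.mul_apply, Equiv.Perm.inv_def, ← Equiv.eq_symm_apply])

/-- Conjugation of generators. -/
def genConj {n b : ℕ} (π : Equiv.Perm (Fin n)) : Gen n b ≃ Gen n b where
  toFun x := ⟨(π * x.1.1 * π⁻¹, x.1.2), x.2.1, x.2.2.1, by rw [numCycles_conj]; exact x.2.2.2⟩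
  invFun x := ⟨(π⁻¹ * x.1.1 * π, x.1.2), x.2.1, x.2.2.1, by
    have := numCycles_conj π⁻¹ x.1.1
    rw [inv_inv] at this
    rw [this]
    exact x.2.2.2⟩
  left_inv x := by ext <;> simp [mul_assoc]
  right_inv x := by ext <;> simp [mul_assoc]

lemma gen_eq_single {n b : ℕ} (x : Gen n b) : gen n b x.1.1 x.1.2 = Finsupp.single x 1 := by
  rw [gen, dif_pos x.2]

/-- The functional on the basis. -/
abbrev coord {n b : ℕ} (x : Gen n b) : Module.Dual ℂ (STilde n b) := Finsupp.lapply x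

lemma coord_gen {n b : ℕ} (x : Gen n b) (σ : Equiv.Perm (Fin n)) (g : ℕ) :
    coord x (gen n b σ g) = open Classical in if (σ, g) = x.1 then 1 else 0 := by
  classical
  by_cases h : IsGen n b (σ, g)
  · rw [gen, dif_pos h, Finsupp.lapply_apply, Finsupp.single_apply]
    congr 1
    rw [Subtype.ext_iff]
  · rw [gen, dif_neg h, map_zero, if_neg]
    intro h2
    exact h (h2 ▸ x.2)

lemma coord_genConj_gen {n b : ℕ} (π : Equiv.Perm (Fin n)) (x : Gen n b) (σ : Equiv.Perm (Fin n))
    (g : ℕ) : coord (genConj π x) (gen n b (π * σ * π⁻¹) g) = coord x (gen n b σ g) := by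
  rw [coord_gen, coord_gen]
  congr 1
  simp [genConj, Prod.ext_iff]

lemma sAct_dualMap_coord {n b : ℕ} (π : Equiv.Perm (Fin n)) (x : Gen n b) :
    (sAct n b π⁻¹).dualMap (coord x) = ((π.sign : ℤ) : ℂ) • coord (genConj π x) := by
  apply Finsupp.lhom_ext'
  intro y
  apply LinearMap.ext_ring
  simp only [LinearMap.comp_apply, Finsupp.lsingle_apply, LinearMap.dualMap_apply, sAct,
    Finsupp.linearCombination_single, one_smul, map_smul, LinearMap.smul_apply]
  rw [Equiv.Perm.sign_inv, ← gen_eq_single y]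
  congr 1
  rw [← coord_genConj_gen π]
  simp [mul_assoc]

section

variable {V : Type*} [AddCommGroup V] [Module ℂ V]
variable {𝒱 : ℤ → Submodule ℂ V} [DirectSum.Decomposition 𝒱] {C : InnerComplex 𝒱}
  (Ω : StableMorphism C)

lemma sign_smul_sign_smul {n : ℕ} {M : Type*} [AddCommGroup M] [Module ℂ M]
    (π : Equiv.Perm (Fin n)) (x : M) : ((π.sign : ℤ) : ℂ) • ((π.sign : ℤ) : ℂ) • x = x := by
  rw [smul_smul, ← sgn_koszul_one, sgn_mul_self, one_smul]

lemma StableMorphism.map_coord_genConj {n b : ℕ} (π : Equiv.Perm (Fin n)) (x : Gen n b) :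
    Ω.Ω n b (coord (genConj π x)) = ((π.sign : ℤ) : ℂ) • kAct 𝒱 π (Ω.Ω n b (coord x)) := by
  rw [← Ω.equivariant, sAct_dualMap_coord, map_smul, sign_smul_sign_smul]

/-- `π_{f f'}(σ τ (f f'))` for any distribution of the flags to two vertices. -/
def glue {n k m : ℕ} (e : Option (Option (Fin n)) ≃ Fin (k + 1) ⊕ Fin (m + 1))
    (σ : Equiv.Perm (Fin (k + 1))) (τ : Equiv.Perm (Fin (m + 1))) : Equiv.Perm (Fin n) :=
  eraseFlags (e.symm.permCongr
    (Equiv.Perm.sumCongr σ τ * Equiv.swap (e none) (e (some none))))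

/-- The part of `Ω ∘ d_F` for any distribution of the flags to two vertices. -/
def edgeSum {n k m : ℕ} (e : Option (Option (Fin n)) ≃ Fin (k + 1) ⊕ Fin (m + 1)) (b₁ b₂ b : ℕ)
    (ξ : Module.Dual ℂ (STilde n b)) : T V n :=
  ∑ x : Gen (k + 1) b₁, ∑ y : Gen (m + 1) b₂,
    ξ (gen n b (glue e x.1.1 y.1.1) (x.1.2 + y.1.2)) •
      edgeMap C e (Ω.Ω (k + 1) b₁ (coord x) ⊗ₜ Ω.Ω (m + 1) b₂ (coord y))

/-- There are finitely many generators, so the dual of the composition can be expanded in products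
of coordinates. The orientation that comes with `muTree` then combines with `evTree` to `edgeMap`.
-/
lemma treeTerm_eq_edgeSum {n : ℕ} (I : Finset (Fin n)) (b₁ b₂ b : ℕ)
    (ξ : Module.Dual ℂ (STilde n b)) :
    treeTerm Ω I b₁ b₂ b ξ = edgeSum Ω (treeFlags I) b₁ b₂ b ξ := by
  classical
  have h : (TensorProduct.dualDistribEquiv ℂ (STilde (I.card + 1) b₁)
      (STilde (Iᶜ.card + 1) b₂)).symm ((muTree I b₁ b₂ b).dualMap ξ) =
      ∑ x : Gen (I.card + 1) b₁, ∑ y : Gen (Iᶜ.card + 1) b₂,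
        (((orientation I : ℤ) : ℂ) *
          ξ (gen n b (glueTree I x.1.1 y.1.1) (x.1.2 + y.1.2))) • (coord x ⊗ₜ coord y) := by
    rw [LinearEquiv.symm_apply_eq]
    have key : ∀ (x : Gen (I.card + 1) b₁) (y : Gen (Iᶜ.card + 1) b₂),
        (muTree I b₁ b₂ b).dualMap ξ (Finsupp.single x 1 ⊗ₜ Finsupp.single y 1) =
        TensorProduct.dualDistrib ℂ _ _ (∑ x : Gen (I.card + 1) b₁, ∑ y : Gen (Iᶜ.card + 1) b₂,
        (((orientation I : ℤ) : ℂ) *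
          ξ (gen n b (glueTree I x.1.1 y.1.1) (x.1.2 + y.1.2))) • (coord x ⊗ₜ coord y))
            (Finsupp.single x 1 ⊗ₜ Finsupp.single y 1) := by
      intro x y
      simp only [LinearMap.dualMap_apply, muTree, TensorProduct.lift.tmul,
        Finsupp.linearCombination_single, one_smul, map_smul, map_sum, LinearMap.sum_apply,
        LinearMap.smul_apply, TensorProduct.dualDistrib_apply, Finsupp.lapply_apply]
      rw [sum_eq_single x, sum_eq_single y]
      · simp
      · intro z _ hz
        simp [hz.symm]
      · simp
      · intro z _ hz
        simp [hz.symm]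
      · simp
    apply TensorProduct.ext
    apply Finsupp.lhom_ext'
    intro x
    apply LinearMap.ext_ring
    apply Finsupp.lhom_ext'
    intro y
    apply LinearMap.ext_ring
    exact key x y
  rw [treeTerm, LinearMap.comp_apply, LinearMap.comp_apply, LinearMap.comp_apply,
    LinearEquiv.coe_coe, h, edgeSum, edgeMap_treeFlags]
  simp only [map_sum, map_smul, TensorProduct.map_tmul, LinearMap.smul_apply, smul_smul, mul_comm]
  rfl

lemma removeNone_permCongr {α β : Type*} (e : α ≃ β) (σ : Equiv.Perm (Option α)) :
    Equiv.removeNone ((Equiv.optionCongr e).permCongr σ) = e.permCongr (Equiv.removeNone σ) := by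
  ext x
  apply Option.some_injective
  rw [Equiv.permCongr_apply]
  rcases h : σ (some (e.symm x)) with _ | y
  · have h1 := Equiv.removeNone_none σ h
    have h2 : (Equiv.optionCongr e).permCongr σ (some x) = none := by
      simp [Equiv.permCongr_apply, h]
    rw [Equiv.removeNone_none _ h2, Equiv.permCongr_apply, optionCongr_symm_none, ← h1]
    rfl
  · have h1 := Equiv.removeNone_some σ ⟨y, h⟩
    have h2 : (Equiv.optionCongr e).permCongr σ (some x) = some (e y) := by
      simp [Equiv.permCongr_apply, h]
    rw [Equiv.removeNone_some _ ⟨_, h2⟩, h2]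
    rw [h] at h1
    rw [Option.some_injective _ h1]

lemma eraseFlags_legPerm {n : ℕ} (π : Equiv.Perm (Fin n))
    (σ : Equiv.Perm (Option (Option (Fin n)))) :
    eraseFlags ((legPerm π).permCongr σ) = π.permCongr (eraseFlags σ) := by
  rw [eraseFlags, removeNone_permCongr, removeNone_permCongr, eraseFlags]

lemma glue_legPerm {n k m : ℕ} (e : Option (Option (Fin n)) ≃ Fin (k + 1) ⊕ Fin (m + 1))
    (π : Equiv.Perm (Fin n)) (σ : Equiv.Perm (Fin (k + 1))) (τ : Equiv.Perm (Fin (m + 1))) :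
    glue ((legPerm π).symm.trans e) σ τ = π * glue e σ τ * π⁻¹ := by
  have : ∀ ρ : Equiv.Perm (Fin n), π * ρ * π⁻¹ = π.permCongr ρ := fun ρ => by
    ext; simp
  rw [this, glue, glue, ← eraseFlags_legPerm]
  congr 1

lemma glue_sumCongr {n k m : ℕ} (e : Option (Option (Fin n)) ≃ Fin (k + 1) ⊕ Fin (m + 1))
    (ρ σ : Equiv.Perm (Fin (k + 1))) (ρ' τ : Equiv.Perm (Fin (m + 1))) :
    glue (e.trans (Equiv.sumCongr ρ ρ')) (ρ * σ * ρ⁻¹) (ρ' * τ * ρ'⁻¹) = glue e σ τ := by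
  have h1 : Equiv.Perm.sumCongr (ρ * σ * ρ⁻¹) (ρ' * τ * ρ'⁻¹) =
      Equiv.Perm.sumCongr ρ ρ' * Equiv.Perm.sumCongr σ τ * (Equiv.Perm.sumCongr ρ ρ')⁻¹ := by
    rw [Equiv.Perm.sumCongr_inv, Equiv.Perm.sumCongr_mul, Equiv.Perm.sumCongr_mul]
  have h2 : ∀ x y, Equiv.swap (Equiv.sumCongr ρ ρ' x) (Equiv.sumCongr ρ ρ' y) =
      Equiv.Perm.sumCongr ρ ρ' * Equiv.swap x y * (Equiv.Perm.sumCongr ρ ρ')⁻¹ := fun x y =>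
    Equiv.swap_apply_apply (Equiv.Perm.sumCongr ρ ρ') x y
  rw [glue, glue, h1, Equiv.trans_apply, Equiv.trans_apply, h2]
  congr 1
  apply Equiv.ext
  intro x
  simp only [Equiv.permCongr_apply, Equiv.symm_symm, Equiv.Perm.mul_apply, Equiv.symm_trans_apply,
    Equiv.trans_apply]
  change e.symm ((Equiv.Perm.sumCongr ρ ρ')⁻¹ _) = _
  congr 1
  have h3 : ∀ z, (Equiv.Perm.sumCongr ρ ρ')⁻¹ (Equiv.Perm.sumCongr ρ ρ' z) = z :=
    fun z => (Equiv.Perm.sumCongr ρ ρ').symm_apply_apply z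
  rw [h3, h3]
  exact congrArg (fun z => Equiv.Perm.sumCongr σ τ (Equiv.swap (e none) (e (some none)) z))
    (h3 (e x))

/-- The contribution of a tree does not depend on how the flags are numbered at its vertices:
conjugation permutes the generators, and the sign from `Ω` cancels the one from `edgeMap_kAct`. -/
lemma edgeSum_sumCongr {n k m : ℕ} (e : Option (Option (Fin n)) ≃ Fin (k + 1) ⊕ Fin (m + 1))
    (ρ : Equiv.Perm (Fin (k + 1))) (ρ' : Equiv.Perm (Fin (m + 1))) (b₁ b₂ b : ℕ)
    (ξ : Module.Dual ℂ (STilde n b)) :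
    edgeSum Ω (e.trans (Equiv.sumCongr ρ ρ')) b₁ b₂ b ξ = edgeSum Ω e b₁ b₂ b ξ := by
  rw [edgeSum, edgeSum, ← (genConj ρ).sum_comp]
  refine sum_congr rfl fun x _ => ?_
  rw [← (genConj ρ').sum_comp]
  refine sum_congr rfl fun y _ => ?_
  have h := LinearMap.congr_fun (edgeMap_kAct C e ρ ρ')
    (Ω.Ω (k + 1) b₁ (coord x) ⊗ₜ Ω.Ω (m + 1) b₂ (coord y))
  rw [LinearMap.comp_apply, TensorProduct.map_tmul, LinearMap.smul_apply] at h
  rw [Ω.map_coord_genConj, Ω.map_coord_genConj, TensorProduct.smul_tmul_smul, map_smul, h,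
    mul_smul, smul_comm ((ρ'.sign : ℤ) : ℂ), mul_smul, sign_smul_sign_smul, sign_smul_sign_smul]
  congr 3
  exact glue_sumCongr e ρ x.1.1 ρ' y.1.1

lemma edgeSum_legPerm {n k m : ℕ} (e : Option (Option (Fin n)) ≃ Fin (k + 1) ⊕ Fin (m + 1))
    (π : Equiv.Perm (Fin n)) (b₁ b₂ b : ℕ) (x : Gen n b) :
    edgeSum Ω ((legPerm π).symm.trans e) b₁ b₂ b (coord (genConj π x)) =
      ((π.sign : ℤ) : ℂ) • kAct 𝒱 π (edgeSum Ω e b₁ b₂ b (coord x)) := by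
  simp only [edgeSum, edgeMap_legPerm, glue_legPerm, coord_genConj_gen, map_sum, map_smul,
    smul_sum, LinearMap.smul_apply, LinearMap.comp_apply]
  refine sum_congr rfl fun y _ => sum_congr rfl fun z _ => ?_
  rw [smul_comm]

/-- Needed because the arities of a tree and of its relabelling are equal only as a consequence of
an equality of cardinalities. -/
lemma edgeSum_finCongr {n k m k' m' : ℕ} (hk : k = k') (hm : m = m')
    (e : Option (Option (Fin n)) ≃ Fin (k + 1) ⊕ Fin (m + 1)) (b₁ b₂ b : ℕ)
    (ξ : Module.Dual ℂ (STilde n b)) :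
    edgeSum Ω (e.trans (Equiv.sumCongr (finCongr (congrArg (· + 1) hk))
      (finCongr (congrArg (· + 1) hm)))) b₁ b₂ b ξ = edgeSum Ω e b₁ b₂ b ξ := by
  subst hk hm
  congr 1
  ext x : 1
  rw [Equiv.trans_apply]
  rcases e x with y | y <;> simp

lemma isLeft_treeFlags {n : ℕ} (I : Finset (Fin n)) (i : Fin n) :
    (treeFlags I (some (some i))).isLeft = true ↔ i ∈ I := by
  obtain ⟨y, rfl⟩ := (legEquiv I).surjective i
  rcases y with y | y
  · rw [treeFlags_legEquiv_inl]
    simp [legEquiv]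
  · rw [treeFlags_legEquiv_inr]
    have : legEquiv I (Sum.inr y) ∈ Iᶜ := by simp [legEquiv, -mem_compl]
    simpa using this

/-- The tree `I` relabelled by `π` and the tree `π(I)` have the same flags at each vertex, but
numbered differently, since `π` need not be monotone and the slot may move. The discrepancy is
absorbed by `edgeSum_sumCongr`. -/
lemma edgeSum_map {n : ℕ} (I : Finset (Fin n)) (π : Equiv.Perm (Fin n)) (b₁ b₂ b : ℕ)
    (x : Gen n b) :
    edgeSum Ω (treeFlags (I.map π.toEmbedding)) b₁ b₂ b (coord (genConj π x)) =
      ((π.sign : ℤ) : ℂ) • kAct 𝒱 π (edgeSum Ω (treeFlags I) b₁ b₂ b (coord x)) := by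
  set J := I.map π.toEmbedding with hJ
  have hk : J.card = I.card := card_map _
  have hm : Jᶜ.card = Iᶜ.card := by rw [card_compl, card_compl, hk]
  set e₁ := (legPerm π).symm.trans (treeFlags I) with he₁
  set e₂ := (treeFlags J).trans (Equiv.sumCongr (finCongr (congrArg (· + 1) hk))
    (finCongr (congrArg (· + 1) hm))) with he₂
  have hiso : ∀ x, (e₁ x).isLeft = true → (e₂ x).isLeft = true := by
    intro x
    simp only [he₁, he₂, Equiv.trans_apply, Equiv.sumCongr_apply, Sum.isLeft_map]
    rcases x with _ | _ | i
    · simp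
    · simp
    · rw [optionCongr_symm_some, optionCongr_symm_some, isLeft_treeFlags, isLeft_treeFlags, hJ]
      intro h
      rw [mem_map_equiv]
      exact h
  -- A permutation of a finite disjoint union that preserves the left summand is a sum of two
  -- permutations.
  obtain ⟨⟨ρ, ρ'⟩, hρ⟩ := Equiv.Perm.mem_sumCongrHom_range_of_perm_mapsTo_inl
    (σ := e₁.symm.trans e₂) (by
      rintro _ ⟨y, rfl⟩
      have := hiso (e₁.symm (Sum.inl y)) (by simp)
      rcases h : e₂ (e₁.symm (Sum.inl y)) with z | z
      · exact ⟨z, by rw [Equiv.trans_apply, h]⟩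
      · simp [h] at this)
  have h : e₂ = e₁.trans (Equiv.sumCongr ρ ρ') := by
    have h2 : Equiv.sumCongr ρ ρ' = e₁.symm.trans e₂ := hρ
    rw [h2]
    ext x : 1
    simp
  rw [← edgeSum_finCongr Ω hk hm, ← he₂, h, edgeSum_sumCongr, he₁, edgeSum_legPerm]

end

end

section

/-! ### Long cycles -/

lemma isCycle_of_gen {n : ℕ} (x : Gen n 0) :
    x.1.1.IsCycle ∧ (∀ i, x.1.1 i ≠ i) ∧ x.1.2 = 0 := by
  obtain ⟨⟨σ, g⟩, h1, h2, h3⟩ := x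
  simp only [numCycles] at h3 ⊢
  have hn : 3 ≤ n := by omega
  -- Otherwise `σ` is the identity, which has `n ≥ 3` cycles instead of one.
  have hc : σ.cycleType.card ≠ 0 := by
    intro h0
    rw [Equiv.Perm.card_cycleType_eq_zero] at h0
    subst h0
    simp at h3
    omega
  have hc1 : σ.cycleType.card = 1 := by omega
  have hf : Fintype.card {i : Fin n // σ i = i} = 0 := by omega
  refine ⟨Equiv.Perm.card_cycleType_eq_one.1 hc1, fun i hi => ?_, by omega⟩
  exact (Fintype.card_eq_zero_iff.1 hf).false ⟨i, hi⟩

lemma numCycles_finRotate {n : ℕ} (hn : 2 ≤ n) : numCycles (finRotate n) = 1 := by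
  obtain ⟨m, rfl⟩ := Nat.exists_eq_add_of_le' hn
  have h : Fintype.card {i : Fin (m + 2) // finRotate (m + 2) i = i} = 0 := by
    rw [Fintype.card_eq_zero_iff]
    refine ⟨fun ⟨i, hi⟩ => ?_⟩
    have := support_finRotate (n := m)
    have h2 : i ∈ (finRotate (m + 2)).support := by rw [this]; simp
    exact Equiv.Perm.mem_support.1 h2 hi
  rw [numCycles, h, cycleType_finRotate]
  rfl

/-- The long cycle `(1 2 ⋯ n)`. -/
def rotGen (n : ℕ) (hn : 3 ≤ n) : Gen n 0 :=
  ⟨(finRotate n, 0), by omega, by omega, by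
    simp only [numCycles_finRotate (show 2 ≤ n by omega)]⟩

lemma dualGen_finRotate (n : ℕ) (hn : 3 ≤ n) :
    dualGen n 0 (finRotate n) 0 = coord (rotGen n hn) := by
  rw [dualGen, dif_pos (show IsGen n 0 (finRotate n, 0) from (rotGen n hn).2)]
  rfl

/-- Powers of the rotation commute with it, so a conjugating permutation can be corrected by one of
them to fix the last leg. This matters because the sum over trees singles out that leg. -/
lemma exists_genConj_rotGen {n : ℕ} (x : Gen (n + 1) 0) (hn : 3 ≤ n + 1) :
    ∃ π : Equiv.Perm (Fin (n + 1)), π (Fin.last n) = Fin.last n ∧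
      x = genConj π (rotGen (n + 1) hn) := by
  obtain ⟨m, rfl⟩ : ∃ m, n = m + 1 := ⟨n - 1, by omega⟩
  obtain ⟨h1, h2, h3⟩ := isCycle_of_gen x
  have hconj : IsConj (finRotate (m + 2)) x.1.1 := by
    rw [Equiv.Perm.isConj_iff_cycleType_eq, cycleType_finRotate, h1.cycleType]
    have : x.1.1.support = univ := by
      ext i
      simp [h2 i]
    rw [this]
    simp
  obtain ⟨π₀, hπ₀⟩ := isConj_iff.1 hconj
  have hsupp : ∀ i, finRotate (m + 2) i ≠ i := fun i => by
    rw [← Equiv.Perm.mem_support, support_finRotate]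
    simp
  obtain ⟨k, hk⟩ := isCycle_finRotate.exists_pow_eq (hsupp (Fin.last _))
    (hsupp (π₀⁻¹ (Fin.last _)))
  refine ⟨π₀ * finRotate (m + 2) ^ k, ?_, ?_⟩
  · rw [Equiv.Perm.mul_apply, hk]
    exact π₀.apply_symm_apply _
  · apply Subtype.ext
    apply Prod.ext
    · rw [← hπ₀]
      simp only [genConj, rotGen, Equiv.coe_fn_mk, mul_inv_rev]
      have : finRotate (m + 2) ^ k * finRotate (m + 2) * (finRotate (m + 2) ^ k)⁻¹ =
          finRotate (m + 2) := by
        rw [← pow_succ, pow_succ', mul_assoc, mul_inv_cancel, mul_one]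
      conv_lhs => rw [← this]
      group
    · exact h3

/-! ### Gluing two cycles -/

/-- Erasing the flags follows a leg to the next leg: either directly, or through one of the two
flags. These are the only cases needed when neither flag is sent to a flag. -/
lemma eraseFlags_of_some {L : Type*} (P : Equiv.Perm (Option (Option L))) {i j : L}
    (h : P (some (some i)) = some (some j)) : eraseFlags P i = j := by
  have h1 := Equiv.removeNone_some P ⟨_, h⟩
  rw [h] at h1
  have h1 := Option.some_injective _ h1
  have h2 := Equiv.removeNone_some (Equiv.removeNone P) ⟨_, h1⟩
  rw [h1] at h2
  exact Option.some_injective _ h2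

lemma eraseFlags_of_none {L : Type*} (P : Equiv.Perm (Option (Option L))) {i j : L}
    (h : P (some (some i)) = none) (h' : P none = some (some j)) : eraseFlags P i = j := by
  have h1 := Equiv.removeNone_none P h
  rw [h'] at h1
  have h1 := Option.some_injective _ h1
  have h2 := Equiv.removeNone_some (Equiv.removeNone P) ⟨_, h1⟩
  rw [h1] at h2
  exact Option.some_injective _ h2

lemma eraseFlags_of_some_none {L : Type*} (P : Equiv.Perm (Option (Option L))) {i j : L}
    (h : P (some (some i)) = some none) (h' : P (some none) = some (some j)) :
    eraseFlags P i = j := by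
  have h1 := Equiv.removeNone_some P ⟨_, h⟩
  rw [h] at h1
  have h1 := Option.some_injective _ h1
  have h2 := Equiv.removeNone_none (Equiv.removeNone P) h1
  have h3 := Equiv.removeNone_some P ⟨_, h'⟩
  rw [h'] at h3
  rw [Option.some_injective _ h3] at h2
  exact Option.some_injective _ h2

section Glue

variable {n : ℕ} (I : Finset (Fin n)) (σ : Equiv.Perm (Fin (I.card + 1)))
  (τ : Equiv.Perm (Fin (Iᶜ.card + 1)))

/-- The permutation `σ τ (f f')` of all flags. -/
abbrev gluePerm : Equiv.Perm (Option (Option (Fin n))) :=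
  (treeFlags I).symm.permCongr
    (Equiv.Perm.sumCongr σ τ * Equiv.swap (treeFlags I none) (treeFlags I (some none)))

lemma gluePerm_none : gluePerm I σ τ none = (treeFlags I).symm (Sum.inr (τ (slot I))) := by
  simp [gluePerm, Equiv.permCongr_apply]

lemma gluePerm_some_none :
    gluePerm I σ τ (some none) = (treeFlags I).symm (Sum.inl (σ (Fin.last _))) := by
  simp [gluePerm, Equiv.permCongr_apply]

lemma gluePerm_inl (a : Fin I.card) : gluePerm I σ τ (some (some (legEquiv I (Sum.inl a)))) =
    (treeFlags I).symm (Sum.inl (σ a.castSucc)) := by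
  simp only [gluePerm, Equiv.permCongr_apply, Equiv.symm_symm, treeFlags_legEquiv_inl,
    Equiv.Perm.mul_apply, treeFlags_none, treeFlags_some_none]
  rw [Equiv.swap_apply_of_ne_of_ne]
  · simp
  · simp
  · simp

lemma gluePerm_inr (b : Fin Iᶜ.card) : gluePerm I σ τ (some (some (legEquiv I (Sum.inr b)))) =
    (treeFlags I).symm (Sum.inr (τ ((slot I).succAbove b))) := by
  simp only [gluePerm, Equiv.permCongr_apply, Equiv.symm_symm, treeFlags_legEquiv_inr,
    Equiv.Perm.mul_apply, treeFlags_none, treeFlags_some_none]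
  rw [Equiv.swap_apply_of_ne_of_ne]
  · simp
  · simp
  · simp

lemma treeFlags_symm_inl (a : Fin I.card) :
    (treeFlags I).symm (Sum.inl a.castSucc) = some (some (legEquiv I (Sum.inl a))) := by
  rw [Equiv.symm_apply_eq, treeFlags_legEquiv_inl]

lemma treeFlags_symm_inr (b : Fin Iᶜ.card) :
    (treeFlags I).symm (Sum.inr ((slot I).succAbove b)) =
      some (some (legEquiv I (Sum.inr b))) := by
  rw [Equiv.symm_apply_eq, treeFlags_legEquiv_inr]

variable {I σ τ}

/-- In the next four lemmas the glued permutation follows `σ` until it meets `f` and continues at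
the successor of `f'` under `τ`; likewise with the two vertices exchanged. -/
lemma glue_inl_inl {a a' : Fin I.card} (h : σ a.castSucc = a'.castSucc) :
    glue (treeFlags I) σ τ (legEquiv I (Sum.inl a)) = legEquiv I (Sum.inl a') :=
  eraseFlags_of_some _ ((gluePerm_inl I σ τ a).trans (by rw [h, treeFlags_symm_inl]))

lemma glue_inl_inr {a : Fin I.card} {b : Fin Iᶜ.card} (h : σ a.castSucc = Fin.last _)
    (h' : τ (slot I) = (slot I).succAbove b) :
    glue (treeFlags I) σ τ (legEquiv I (Sum.inl a)) = legEquiv I (Sum.inr b) :=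
  eraseFlags_of_none _ ((gluePerm_inl I σ τ a).trans (by
    rw [h, Equiv.symm_apply_eq, treeFlags_none]))
    ((gluePerm_none I σ τ).trans (by rw [h', treeFlags_symm_inr]))

lemma glue_inr_inr {b b' : Fin Iᶜ.card}
    (h : τ ((slot I).succAbove b) = (slot I).succAbove b') :
    glue (treeFlags I) σ τ (legEquiv I (Sum.inr b)) = legEquiv I (Sum.inr b') :=
  eraseFlags_of_some _ ((gluePerm_inr I σ τ b).trans (by rw [h, treeFlags_symm_inr]))

lemma glue_inr_inl {b : Fin Iᶜ.card} {a : Fin I.card} (h : τ ((slot I).succAbove b) = slot I)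
    (h' : σ (Fin.last _) = a.castSucc) :
    glue (treeFlags I) σ τ (legEquiv I (Sum.inr b)) = legEquiv I (Sum.inl a) :=
  eraseFlags_of_some_none _ ((gluePerm_inr I σ τ b).trans (by
    rw [h, Equiv.symm_apply_eq, treeFlags_some_none]))
    ((gluePerm_some_none I σ τ).trans (by rw [h', treeFlags_symm_inl]))

lemma perm_eq_of_eq_off {α : Type*} {f g : Equiv.Perm α} (x₀ : α) (h : ∀ x, x ≠ x₀ → f x = g x) :
    f = g := by
  ext x
  by_cases hx : x = x₀
  · subst hx
    by_contra hne
    have h1 : f.symm (g x) ≠ x := fun h1 => hne (by conv_lhs => rw [← h1, Equiv.apply_symm_apply])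
    have h2 := h _ h1
    rw [Equiv.apply_symm_apply] at h2
    exact h1 (g.injective h2).symm
  · exact h x hx

lemma exists_castSucc_of_ne_last {k : ℕ} {x : Fin (k + 1)} (h : x ≠ Fin.last k) :
    ∃ a : Fin k, x = a.castSucc := ⟨x.castPred h, by simp⟩

lemma exists_succAbove_of_ne {k : ℕ} {β x : Fin (k + 1)} (h : x ≠ β) :
    ∃ a : Fin k, x = β.succAbove a := by
  obtain ⟨a, ha⟩ := Fin.exists_succAbove_eq h
  exact ⟨a, ha.symm⟩

/-- The glued permutation determines `σ` off `f`: a leg of `I` whose image leaves `I` was sent to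
`f`, the others keep their image. The value at the remaining point is forced. The same holds for
`τ`. -/
lemma glue_injective {σ' : Equiv.Perm (Fin (I.card + 1))} {τ' : Equiv.Perm (Fin (Iᶜ.card + 1))}
    (hσ : σ (Fin.last _) ≠ Fin.last _) (hσ' : σ' (Fin.last _) ≠ Fin.last _)
    (hτ : τ (slot I) ≠ slot I) (hτ' : τ' (slot I) ≠ slot I)
    (h : glue (treeFlags I) σ τ = glue (treeFlags I) σ' τ') : σ = σ' ∧ τ = τ' := by
  obtain ⟨a₀, ha₀⟩ := exists_castSucc_of_ne_last hσ
  obtain ⟨a₀', ha₀'⟩ := exists_castSucc_of_ne_last hσ'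
  obtain ⟨b₀, hb₀⟩ := exists_succAbove_of_ne hτ
  obtain ⟨b₀', hb₀'⟩ := exists_succAbove_of_ne hτ'
  constructor
  · apply perm_eq_of_eq_off (Fin.last _)
    intro x hx
    obtain ⟨a, rfl⟩ := exists_castSucc_of_ne_last hx
    have h1 := congrArg (fun f => f (legEquiv I (Sum.inl a))) h
    by_cases h2 : σ a.castSucc = Fin.last _ <;> by_cases h3 : σ' a.castSucc = Fin.last _
    · rw [h2, h3]
    · obtain ⟨c, hc⟩ := exists_castSucc_of_ne_last h3
      rw [glue_inl_inr h2 hb₀, glue_inl_inl hc] at h1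
      simp at h1
    · obtain ⟨c, hc⟩ := exists_castSucc_of_ne_last h2
      rw [glue_inl_inr h3 hb₀', glue_inl_inl hc] at h1
      simp at h1
    · obtain ⟨c, hc⟩ := exists_castSucc_of_ne_last h2
      obtain ⟨c', hc'⟩ := exists_castSucc_of_ne_last h3
      rw [glue_inl_inl hc, glue_inl_inl hc'] at h1
      rw [hc, hc', Sum.inl_injective ((legEquiv I).injective h1)]
  · apply perm_eq_of_eq_off (slot I)
    intro x hx
    obtain ⟨a, rfl⟩ := exists_succAbove_of_ne hx
    have h1 := congrArg (fun f => f (legEquiv I (Sum.inr a))) h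
    by_cases h2 : τ ((slot I).succAbove a) = slot I <;>
      by_cases h3 : τ' ((slot I).succAbove a) = slot I
    · rw [h2, h3]
    · obtain ⟨c, hc⟩ := exists_succAbove_of_ne h3
      rw [glue_inr_inl h2 ha₀, glue_inr_inr hc] at h1
      simp at h1
    · obtain ⟨c, hc⟩ := exists_succAbove_of_ne h2
      rw [glue_inr_inl h3 ha₀', glue_inr_inr hc] at h1
      simp at h1
    · obtain ⟨c, hc⟩ := exists_succAbove_of_ne h2
      obtain ⟨c', hc'⟩ := exists_succAbove_of_ne h3
      rw [glue_inr_inr hc, glue_inr_inr hc'] at h1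
      rw [hc, hc', Sum.inr_injective ((legEquiv I).injective h1)]

end Glue

/-! ### Planarity: the trees that produce the long cycle -/

lemma val_finRotate {n : ℕ} (i : Fin n) :
    (finRotate n i).1 = if i.1 + 1 = n then 0 else i.1 + 1 := by
  obtain ⟨m, rfl⟩ : ∃ m, n = m + 1 := ⟨n - 1, by have := i.2; omega⟩
  by_cases h : i.1 + 1 = m + 1
  · have : i = Fin.last m := Fin.ext (by simpa using h)
    subst this
    simp
  · have h2 : i.1 < m := by omega
    rw [if_neg h]
    have : i = ⟨i.1, by omega⟩ := rfl
    rw [this, finRotate_of_lt h2]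

lemma exists_last_before_exit (P : ℕ → Prop) {x y : ℕ} (hxy : x ≤ y) (hx : P x) (hy : ¬ P y) :
    ∃ u, x ≤ u ∧ u < y ∧ P u ∧ ¬ P (u + 1) := by
  induction y, hxy using Nat.le_induction with
  | base => exact absurd hx hy
  | succ y hxy ih =>
    by_cases h : P y
    · exact ⟨y, hxy, Nat.lt_succ_self y, h, hy⟩
    · obtain ⟨u, h1, h2, h3⟩ := ih h
      exact ⟨u, h1, by omega, h3⟩

/-- A glued permutation leaves `I` only at the leg that `σ` sends to `f`. If `I` had a gap, the
rotation would leave it twice: before the gap, and again before the last leg. -/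
lemma ordConnected_of_glue_eq {n : ℕ} {I : Finset (Fin n)} (hlast : ∀ i ∈ I, i.1 + 1 ≠ n)
    {σ : Equiv.Perm (Fin (I.card + 1))} {τ : Equiv.Perm (Fin (Iᶜ.card + 1))}
    (h : glue (treeFlags I) σ τ = finRotate n) : (I : Set (Fin n)).OrdConnected := by
  have key : ∀ i ∈ I, ∀ j ∈ I, finRotate n i ∉ I → finRotate n j ∉ I → i = j := by
    have h1 : ∀ i ∈ I, finRotate n i ∉ I →
        ∃ a, i = legEquiv I (Sum.inl a) ∧ σ a.castSucc = Fin.last _ := by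
      intro i hi hi'
      obtain ⟨a | b, rfl⟩ := (legEquiv I).surjective i
      · refine ⟨a, rfl, ?_⟩
        by_contra hne
        obtain ⟨c, hc⟩ := exists_castSucc_of_ne_last hne
        rw [← h, glue_inl_inl hc] at hi'
        exact hi' (by simp [legEquiv])
      · have : legEquiv I (Sum.inr b) ∈ Iᶜ := by simp [legEquiv, -mem_compl]
        exact absurd hi (mem_compl.1 this)
    intro i hi j hj hi' hj'
    obtain ⟨a, rfl, ha⟩ := h1 i hi hi'
    obtain ⟨b, rfl, hb⟩ := h1 j hj hj'
    rw [← hb] at ha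
    rw [Fin.castSucc_injective _ (σ.injective ha)]
  refine ⟨fun x hx z hz y hy => ?_⟩
  by_contra hyI
  set P : ℕ → Prop := fun i => ∃ h : i < n, (⟨i, h⟩ : Fin n) ∈ I with hP
  have hPx : P x.1 := ⟨x.2, hx⟩
  have hPz : P z.1 := ⟨z.2, hz⟩
  have hPy : ¬ P y.1 := fun ⟨_, h⟩ => hyI h
  -- The last leg lies outside `I`, which yields the second exit without wrapping around.
  have hPn : ¬ P (n - 1) := fun ⟨h1, h2⟩ => hlast _ h2 (by simp only; omega)
  obtain ⟨u, hu1, hu2, ⟨hu3, hu4⟩, hu5⟩ := exists_last_before_exit P hy.1 hPx hPy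
  obtain ⟨w, hw1, hw2, ⟨hw3, hw4⟩, hw5⟩ :=
    exists_last_before_exit P (by have := z.2; omega) hPz hPn
  have hexit : ∀ u (hu : u < n), ¬ P (u + 1) → u + 1 < n → finRotate n ⟨u, hu⟩ ∉ I := by
    intro u hu h1 h2 h3
    apply h1
    refine ⟨h2, ?_⟩
    have : finRotate n ⟨u, hu⟩ = ⟨u + 1, h2⟩ := by
      apply Fin.ext
      rw [val_finRotate, if_neg (by simp only; omega)]
    rwa [this] at h3
  have := key _ hu4 _ hw4 (hexit u hu3 hu5 (by have := y.2; omega))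
    (hexit w hw3 hw5 (by omega))
  have h1 : u = w := congrArg Fin.val this
  have h2 : y.1 ≤ z.1 := hy.2
  omega

lemma glue_finRotate {n : ℕ} {I : Finset (Fin n)} (hI : (I : Set (Fin n)).OrdConnected)
    (hlast : ∀ i ∈ I, i.1 + 1 ≠ n) (hne : I.Nonempty) :
    glue (treeFlags I) (finRotate _) (finRotate _) = finRotate n := by
  have hk := card_add_card_compl I
  have hk0 : 0 < I.card := hne.card_pos
  -- The last leg belongs to the second vertex, so `f'` is not last there and its successor is the
  -- leg right after the block.
  have hβ : (slot I).1 < Iᶜ.card := by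
    by_contra hcon
    have h1 := (slot I).2
    have h2 : (⟨n - 1, by omega⟩ : Fin n) ∈ I := by
      rw [mem_iff_of_ordConnected hI]
      simp only
      omega
    exact hlast _ h2 (by simp only; omega)
  have hleg := legEquiv_of_ordConnected hI
  have hl : ∀ a, (legEquiv I (Sum.inl a)).1 = (slot I).1 + a.1 := fun a => by
    rw [hleg, val_insertEquiv_inl]
  have hr : ∀ b, (legEquiv I (Sum.inr b)).1 =
      if b.1 < (slot I).1 then b.1 else b.1 + I.card := fun a => by
    rw [hleg, val_insertEquiv_inr]
  ext x
  obtain ⟨a | b, rfl⟩ := (legEquiv I).surjective x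
  · rw [val_finRotate, hl]
    by_cases ha : a.1 + 1 < I.card
    · have h1 : finRotate (I.card + 1) a.castSucc = (⟨a.1 + 1, ha⟩ : Fin I.card).castSucc := by
        apply Fin.ext
        rw [val_finRotate]
        simp only [Fin.val_castSucc]
        rw [if_neg (by omega)]
      rw [glue_inl_inl h1, hl, if_neg (by omega)]
      simp only
      omega
    · have ha' := a.2
      have h1 : finRotate (I.card + 1) a.castSucc = Fin.last _ := by
        apply Fin.ext
        rw [val_finRotate]
        simp only [Fin.val_castSucc, Fin.val_last]
        rw [if_neg (by omega)]
        omega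
      have h2 : finRotate (Iᶜ.card + 1) (slot I) = (slot I).succAbove ⟨slot I, hβ⟩ := by
        apply Fin.ext
        rw [val_finRotate, val_succAbove, if_neg (by omega), if_neg (by simp)]
      rw [glue_inl_inr h1 h2, hr, if_neg (by simp), if_neg (by omega)]
      simp only
      omega
  · have hb := b.2
    have h0 : finRotate (I.card + 1) (Fin.last _) = (⟨0, hk0⟩ : Fin I.card).castSucc := by
      apply Fin.ext
      rw [val_finRotate]
      simp
    rw [val_finRotate, hr]
    -- The predecessor of `f'` is the leg just before the slot, or, if the slot is first, the last
    -- leg by wrapping around.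
    by_cases h1 : (b.1 + 1 = (slot I).1) ∨ (b.1 + 1 = Iᶜ.card ∧ (slot I).1 = 0)
    · have h2 : finRotate (Iᶜ.card + 1) ((slot I).succAbove b) = slot I := by
        apply Fin.ext
        rw [val_finRotate, val_succAbove]
        split_ifs <;> omega
      rw [glue_inr_inl h2 h0, hl]
      simp only
      split_ifs <;> omega
    · have h3 : ∃ b' : Fin Iᶜ.card, b'.1 = if b.1 + 1 = Iᶜ.card then 0 else b.1 + 1 :=
        ⟨⟨if b.1 + 1 = Iᶜ.card then 0 else b.1 + 1, by split_ifs <;> omega⟩, rfl⟩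
      obtain ⟨b', hb'⟩ := h3
      have h2 : finRotate (Iᶜ.card + 1) ((slot I).succAbove b) = (slot I).succAbove b' := by
        apply Fin.ext
        rw [val_finRotate, val_succAbove, val_succAbove, hb']
        split_ifs <;> omega
      rw [glue_inr_inr h2, hr, hb']
      split_ifs <;> omega

end

section

variable {V : Type*} [AddCommGroup V] [Module ℂ V]
variable {𝒱 : ℤ → Submodule ℂ V} [DirectSum.Decomposition 𝒱] {C : InnerComplex 𝒱}
  (Ω : StableMorphism C)

/-! ### The quantum relation at the long cycle -/

/-- The sum over all trees with one edge, in genus zero. -/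
def treeSum (n : ℕ) (ξ : Module.Dual ℂ (STilde n 0)) : T V n :=
  ∑ I ∈ univ.filter (fun I : Finset (Fin n) => ∀ i ∈ I, i.1 + 1 ≠ n),
    edgeSum Ω (treeFlags I) 0 0 0 ξ

lemma quantumRelation_iff (n : ℕ) :
    QuantumRelation Ω n 0 ↔ ∀ ξ, dEV C n (Ω.Ω n 0 ξ) = treeSum Ω n ξ := by
  simp [QuantumRelation, loopTerm, treeSum, treeTerm_eq_edgeSum]

/-- Relabelling permutes the trees; as `π` fixes the last leg, it respects the choice of which
vertex comes first. -/
lemma treeSum_genConj {n : ℕ} (π : Equiv.Perm (Fin (n + 1))) (hπ : π (Fin.last n) = Fin.last n)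
    (x : Gen (n + 1) 0) :
    treeSum Ω (n + 1) (coord (genConj π x)) =
      ((π.sign : ℤ) : ℂ) • kAct 𝒱 π (treeSum Ω (n + 1) (coord x)) := by
  rw [treeSum, treeSum, map_sum, smul_sum]
  symm
  apply sum_equiv (Equiv.finsetCongr π)
  · intro I
    have h : ∀ J : Finset (Fin (n + 1)), (∀ i ∈ J, i.1 + 1 ≠ n + 1) ↔ Fin.last n ∉ J := by
      intro J
      refine ⟨fun h h2 => h _ h2 (by simp), fun h i hi h2 => h ?_⟩
      have : i = Fin.last n := Fin.ext (by simpa using h2)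
      exact this ▸ hi
    simp only [mem_filter, mem_univ, true_and, h, Equiv.finsetCongr_apply, mem_map_equiv]
    rw [show π.symm (Fin.last n) = Fin.last n by rw [Equiv.symm_apply_eq, hπ]]
  · intro I _
    rw [Equiv.finsetCongr_apply, edgeSum_map]

lemma quantumRelation_iff_rotGen {n : ℕ} (hn : 3 ≤ n + 1) :
    QuantumRelation Ω (n + 1) 0 ↔
      dEV C (n + 1) (Ω.Ω (n + 1) 0 (coord (rotGen (n + 1) hn))) =
        treeSum Ω (n + 1) (coord (rotGen (n + 1) hn)) := by
  constructor
  · intro h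
    exact (quantumRelation_iff Ω _).1 h _
  · intro h ξ
    -- The coordinates span the dual because there are finitely many generators.
    have hlin : ξ = ∑ x, ξ (Finsupp.single x 1) • coord x := by
      apply Finsupp.lhom_ext'
      intro y
      apply LinearMap.ext_ring
      simp only [LinearMap.comp_apply, Finsupp.lsingle_apply, LinearMap.sum_apply,
        LinearMap.smul_apply, Finsupp.lapply_apply]
      rw [sum_eq_single y]
      · simp
      · intro z _ hz
        simp [hz.symm]
      · simp
    rw [hlin]
    simp only [map_sum, map_smul, loopTerm, LinearMap.zero_apply, zero_add, smul_zero,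
      sum_const_zero, Nat.antidiagonal_zero, sum_singleton]
    rw [sum_comm]
    refine sum_congr rfl fun x _ => ?_
    obtain ⟨π, hπ, rfl⟩ := exists_genConj_rotGen x hn
    rw [Ω.map_coord_genConj, map_smul, ← LinearMap.comp_apply, dEV_kAct, LinearMap.comp_apply, h,
      ← treeSum_genConj Ω π hπ, treeSum, smul_sum]
    refine sum_congr rfl fun I _ => ?_
    simp [treeTerm_eq_edgeSum]

/-- For an interval exactly one pair of permutations can glue to the long cycle, namely the two
rotations; stability of the vertices requires at least two legs at each. -/
lemma edgeSum_rotGen {n : ℕ} (hn : 3 ≤ n) {I : Finset (Fin n)} (hlast : ∀ i ∈ I, i.1 + 1 ≠ n) :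
    edgeSum Ω (treeFlags I) 0 0 0 (coord (rotGen n hn)) =
      open Classical in
      if (I : Set (Fin n)).OrdConnected ∧ 2 ≤ I.card ∧ 2 ≤ Iᶜ.card then
        edgeMap C (treeFlags I) (Ω.Ω (I.card + 1) 0 (dualGen (I.card + 1) 0 (finRotate _) 0) ⊗ₜ
          Ω.Ω (Iᶜ.card + 1) 0 (dualGen (Iᶜ.card + 1) 0 (finRotate _) 0)) else 0 := by
  classical
  have key : ∀ (x : Gen (I.card + 1) 0) (y : Gen (Iᶜ.card + 1) 0),
      coord (rotGen n hn) (gen n 0 (glue (treeFlags I) x.1.1 y.1.1) (x.1.2 + y.1.2)) =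
        if (I : Set (Fin n)).OrdConnected ∧ x.1.1 = finRotate _ ∧ y.1.1 = finRotate _
          then 1 else 0 := by
    intro x y
    obtain ⟨-, hx, hx'⟩ := isCycle_of_gen x
    obtain ⟨-, hy, hy'⟩ := isCycle_of_gen y
    rw [coord_gen, hx', hy']
    have hne : I.Nonempty := by
      rw [← card_pos]
      have := x.2.2.1
      omega
    have hrot : ∀ k (i : Fin (k + 1)), 1 ≤ k → finRotate (k + 1) i ≠ i := by
      intro k i hk h
      have := congrArg Fin.val h
      rw [val_finRotate] at this
      split_ifs at this <;> omega
    congr 1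
    simp only [rotGen, Prod.mk.injEq, add_zero, and_true, eq_iff_iff]
    constructor
    · intro h
      have hI := ordConnected_of_glue_eq hlast h
      refine ⟨hI, glue_injective (hx _) (hrot _ _ ?_) (hy _) (hrot _ _ ?_)
        (h.trans (glue_finRotate hI hlast hne).symm)⟩
      · have := x.2.2.1; omega
      · have := y.2.2.1; omega
    · rintro ⟨hI, hx, hy⟩
      rw [hx, hy, glue_finRotate hI hlast hne]
  simp only [edgeSum, key]
  split_ifs with h
  · obtain ⟨hI, hk, hm⟩ := h
    have huniq : ∀ k (hk : 3 ≤ k) (x : Gen k 0), x ≠ rotGen k hk → x.1.1 ≠ finRotate k := by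
      intro k hk x hx h
      apply hx
      apply Subtype.ext
      exact Prod.ext h (isCycle_of_gen x).2.2
    rw [sum_eq_single (rotGen _ (by omega : 3 ≤ I.card + 1)),
      sum_eq_single (rotGen _ (by omega : 3 ≤ Iᶜ.card + 1)), dualGen_finRotate, dualGen_finRotate]
    · rw [if_pos ⟨hI, rfl, rfl⟩, one_smul]
    · intro y _ hy
      rw [if_neg (fun h => huniq _ _ y hy h.2.2), zero_smul]
    · simp
    · intro x _ hx
      exact sum_eq_zero fun y _ => by rw [if_neg (fun h => huniq _ _ x hx h.2.1), zero_smul]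
    · simp
  -- A generator at each vertex already forces the bounds on the cardinalities, so in this case `I`
  -- is not an interval or there is no such pair.
  · refine sum_eq_zero fun x _ => sum_eq_zero fun y _ => ?_
    rw [if_neg, zero_smul]
    rintro ⟨hI, -, -⟩
    have h1 := x.2.2.1
    have h2 := y.2.2.1
    exact h ⟨hI, by omega, by omega⟩

/-! ### Seidel's signs for the differential -/

lemma m₁_of_mem {i : ℤ} {x : V} (hx : x ∈ 𝒱 i) : m₁ C x = sgn (i : ZMod 2) • C.d x := by
  have h : ∀ z : ZMod 2, z = 0 ∨ z = 1 := by decide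
  rw [m₁, LinearMap.comp_apply, LinearMap.sub_apply, parityProj_of_mem hx, parityProj_of_mem hx]
  rcases h (i : ZMod 2) with h | h <;> simp [h]

/-- Applying `d` to a factor raises its shifted degree by one, so the décalage weight changes by its
position. This replaces the degrees in front of it by shifted degrees, at the cost of a minus sign.
-/
lemma decalage_dEV {d : ℕ} {D : ℤ} (hD : Even D) {x : T V (d + 1)}
    (hx : x ∈ evDegree 𝒱 (d + 1) D) :
    decalage 𝒱 (d + 1) (dEV C (d + 1) x) =
      applyAt (Fin.last d) (m₁ C) (decalage 𝒱 (d + 1) x) +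
        ∑ q : Fin d, applyAt q.castSucc (-C.d)
          (slotSign 𝒱 q.castSucc (decalage 𝒱 (d + 1) x)) := by
  induction hx using Submodule.span_induction with
  | zero => simp
  | add x x' _ _ h h' => simp only [map_add, h, h', sum_add_distrib]; abel
  | smul r x _ h => simp only [map_smul, h, smul_add, smul_sum]
  | mem x hx =>
    obtain ⟨c, v, hv, hc, rfl⟩ := hx
    have heven : ∑ i, (1 - (c i : ZMod 2)) = 0 := by
      have h1 : ∑ i, (1 - c i) = D := by rw [sum_sub_distrib]; simpa using hc
      rw [← h1] at hD
      have := (ZMod.intCast_eq_zero_iff_even (n := _)).2 hD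
      push_cast at this
      exact this
    have hterm : ∀ i, decalage 𝒱 (d + 1) (sgn (∑ l ∈ univ.filter (· < i), (c l : ZMod 2)) •
        PiTensorProduct.tprod ℂ (Function.update v i (C.d (v i)))) =
        (sgn (∑ i : Fin (d + 1), ((i.1 + 1 : ℕ) : ZMod 2) * (1 - c i)) *
          sgn (∑ l ∈ univ.filter (· < i), (1 - (c l : ZMod 2)))) •
          -PiTensorProduct.tprod ℂ (Function.update v i (C.d (v i))) := by
      intro i
      have hu : ∀ j, Function.update v i (C.d (v i)) j ∈
          𝒱 (Function.update c i (c i - 1) j) := by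
        intro j
        by_cases hj : j = i
        · subst hj; simpa using C.d_mem _ _ (hv j)
        · simpa [hj] using hv j
      have h1 : ∑ j : Fin (d + 1), ((j.1 + 1 : ℕ) : ZMod 2) *
          (1 - ((Function.update c i (c i - 1) j : ℤ) : ZMod 2)) =
          ∑ j : Fin (d + 1), ((j.1 + 1 : ℕ) : ZMod 2) * (1 - c j) + (i.1 + 1) := by
        have h2 : ∀ j : Fin (d + 1), ((j.1 + 1 : ℕ) : ZMod 2) *
            (1 - ((Function.update c i (c i - 1) j : ℤ) : ZMod 2)) =
            ((j.1 + 1 : ℕ) : ZMod 2) * (1 - c j) + if j = i then (i.1 + 1 : ZMod 2) else 0 := by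
          intro j
          by_cases hj : j = i
          · subst hj
            simp only [Function.update_self, if_true]
            push_cast
            ring
          · simp [hj]
        simp only [h2, sum_add_distrib]
        simp
      have h3 : ∑ l ∈ univ.filter (· < i), (1 - (c l : ZMod 2)) =
          i.1 - ∑ l ∈ univ.filter (· < i), (c l : ZMod 2) := by
        rw [sum_sub_distrib]
        simp [filter_gt_eq_Iio]
      rw [map_smul, decalage_tprod hu, h1, smul_smul, h3, smul_neg, ← neg_smul, ← sgn_add,
        ← sgn_add, ← neg_one_mul, ← sgn_one, ← sgn_add]
      congr 2
      have h0 : (2 : ZMod 2) = 0 := rfl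
      linear_combination (∑ l ∈ univ.filter (· < i), (c l : ZMod 2)) * h0
    rw [dEV_tprod C hv, map_sum, decalage_tprod hv, Fin.sum_univ_castSucc]
    refine (add_comm _ _).trans ?_
    congr 1
    · rw [hterm, map_smul, applyAt_tprod, m₁_of_mem (hv _), mul_smul]
      congr 1
      rw [MultilinearMap.map_update_smul, smul_neg, ← neg_smul, ← neg_one_mul, ← sgn_one,
        ← sgn_add]
      congr 2
      -- The total shifted degree is even, so at the last factor the sign of all preceding factors
      -- is its own shifted degree; with the minus sign this is the sign of `m₁`.
      have h4 : univ.filter (· < Fin.last d) = univ.erase (Fin.last d) := by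
        ext l
        simp [Fin.lt_last_iff_ne_last]
      rw [← sum_erase_add _ _ (mem_univ (Fin.last d)), ← h4] at heven
      linear_combination heven
    · refine sum_congr rfl fun q _ => ?_
      rw [hterm, map_smul, map_smul, mul_smul]
      congr 1
      rw [slotSign, signOp_tprod hv, map_smul, applyAt_tprod]
      congr 1
      rw [LinearMap.neg_apply, ← neg_one_smul ℂ (C.d _), MultilinearMap.map_update_smul,
        neg_one_smul]

lemma decalage_decalage {n : ℕ} (x : T V n) : decalage 𝒱 n (decalage 𝒱 n x) = x := by
  have : decalage 𝒱 n ∘ₗ decalage 𝒱 n = LinearMap.id := by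
    apply tensor_ext 𝒱
    intro c v hv
    rw [LinearMap.comp_apply, decalage_tprod hv, map_smul, decalage_tprod hv, smul_smul,
      sgn_mul_self, one_smul, LinearMap.id_apply]
  exact LinearMap.congr_fun this x

lemma contract_neg (B : V →ₗ[ℂ] V →ₗ[ℂ] ℂ) {k m n : ℕ} (h : k + m = n) (β : Fin (m + 1)) :
    contract (-B) h β = -contract B h β := by
  apply TensorProduct.ext
  apply PiTensorProduct.ext
  ext v : 1
  apply PiTensorProduct.ext
  ext w : 1
  change contract (-B) h β (PiTensorProduct.tprod ℂ v ⊗ₜ PiTensorProduct.tprod ℂ w) =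
    -contract B h β (PiTensorProduct.tprod ℂ v ⊗ₜ PiTensorProduct.tprod ℂ w)
  rw [contract_tprod, contract_tprod]
  simp

/-- The insertion of the disc tensor with `k + 1` factors into the factor in position `β` of the
disc tensor with `m + 1` factors. -/
def discInsert {k m n : ℕ} (h : k + m = n) (β : Fin (m + 1)) : T V n :=
  contract C.B h β (discTensor Ω (k + 1) ⊗ₜ[ℂ] slotSign 𝒱 β (discTensor Ω (m + 1)))

lemma discInsert_congr {k m k' m' n : ℕ} (h : k + m = n) (h' : k' + m' = n) (hk : k = k')
    (β : Fin (m + 1)) (β' : Fin (m' + 1)) (hβ : β.1 = β'.1) :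
    discInsert Ω h β = discInsert Ω h' β' := by
  obtain rfl : m = m' := by omega
  subst hk
  obtain rfl : β = β' := Fin.ext hβ
  rfl

/-- Each surviving tree is an interval; its first vertex carries the disc tensor that is inserted,
its second vertex the one that receives it. -/
lemma decalage_treeSum (hB : Odd C.degB) {d : ℕ} (hd : 3 ≤ d + 1) :
    decalage 𝒱 (d + 1) (treeSum Ω (d + 1) (coord (rotGen (d + 1) hd))) =
      ∑ p ∈ univ.filter (fun p : Fin d => 2 ≤ p.1 + 1 ∧ p.1 + 1 ≤ d - 1),
        ∑ q : Fin (d - p.1),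
          discInsert Ω (show p.1 + 1 + (d - p.1) = d + 1 by omega) q.castSucc := by
  classical
  have h1 : decalage 𝒱 (d + 1) (treeSum Ω (d + 1) (coord (rotGen (d + 1) hd))) =
      ∑ I ∈ univ.filter (fun I : Finset (Fin (d + 1)) => (∀ i ∈ I, i.1 + 1 ≠ d + 1) ∧
        (I : Set (Fin (d + 1))).OrdConnected ∧ 2 ≤ I.card ∧ 2 ≤ Iᶜ.card),
        discInsert Ω (card_add_card_compl I) (slot I) := by
    rw [treeSum, map_sum, ← filter_filter, sum_filter _ (s := filter _ _)]
    refine sum_congr rfl fun I hI => ?_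
    rw [edgeSum_rotGen Ω hd (mem_filter.1 hI).2]
    split_ifs with h
    · have hdeg := fun n => Ω.degree n 0 (dualGen n 0 (finRotate n) 0)
      rw [decalage_edgeMap C hB h.1 ?_ ?_ (hdeg _) (hdeg _)]
      · rfl
      · simpa using even_degree C hB _
      · simpa using even_degree C hB _
    · simp
  rw [h1, sum_sigma']
  symm
  have hmem : ∀ (p q : ℕ) (i : Fin (d + 1)),
      i ∈ univ.filter (fun i : Fin (d + 1) => q ≤ i.1 ∧ i.1 ≤ q + p) ↔ q ≤ i.1 ∧ i.1 ≤ q + p := by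
    simp
  have hcard : ∀ p q : ℕ, q + p < d + 1 →
      (univ.filter (fun i : Fin (d + 1) => q ≤ i.1 ∧ i.1 ≤ q + p)).card = p + 1 := by
    intro p q h
    have : univ.filter (fun i : Fin (d + 1) => q ≤ i.1 ∧ i.1 ≤ q + p) =
        Icc ⟨q, by omega⟩ ⟨q + p, h⟩ := by
      ext i
      simp [Fin.le_def]
    rw [this, Fin.card_Icc]
    simp only
    omega
  have hoc : ∀ p q : ℕ, ((univ.filter (fun i : Fin (d + 1) => q ≤ i.1 ∧ i.1 ≤ q + p) :
      Finset (Fin (d + 1))) : Set (Fin (d + 1))).OrdConnected := by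
    intro p q
    refine ⟨fun x hx y hy z hz => ?_⟩
    have h1 := (hmem _ _ _).1 hx
    have h2 := (hmem _ _ _).1 hy
    have h3 : x.1 ≤ z.1 := hz.1
    have h4 : z.1 ≤ y.1 := hz.2
    exact (hmem _ _ _).2 ⟨by omega, by omega⟩
  have hslot : ∀ p q : ℕ, q + p < d + 1 →
      (slot (univ.filter (fun i : Fin (d + 1) => q ≤ i.1 ∧ i.1 ≤ q + p))).1 = q := by
    intro p q h
    have h1 := mem_iff_of_ordConnected (hoc p q)
    rw [hcard p q h] at h1
    have h2 := (h1 ⟨q, by omega⟩).1 ((hmem _ _ _).2 (by simp))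
    have h3 := (h1 ⟨q + p, h⟩).1 ((hmem _ _ _).2 (by simp))
    simp only at h2 h3
    omega
  -- The pair `(p, q)` gives the legs `q, …, q + p`. The bound `q < d - p` excludes the last leg
  -- `d`, and the filter on `p` says that both vertices have at least two legs.
  refine sum_bij (fun x _ => univ.filter (fun i : Fin (d + 1) => x.2.1 ≤ i.1 ∧ i.1 ≤ x.2.1 + x.1.1))
    ?_ ?_ ?_ ?_
  · rintro ⟨p, q⟩ hpq
    simp only [mem_sigma, mem_filter, mem_univ, true_and, and_true] at hpq
    have h2 := q.2
    simp only [mem_filter, mem_univ, true_and, card_compl, Fintype.card_fin]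
    rw [hcard _ _ (by omega)]
    exact ⟨fun i hi => by omega, hoc _ _, by omega, by omega⟩
  · rintro ⟨p, q⟩ hpq ⟨p', q'⟩ hpq' heq
    have h2 := q.2
    have h2' := q'.2
    simp only at h2 h2' heq
    have h3 := hcard p.1 q.1 (by omega)
    have h4 := hslot p.1 q.1 (by omega)
    rw [heq, hcard _ _ (by omega)] at h3
    rw [heq, hslot _ _ (by omega)] at h4
    obtain rfl : p = p' := Fin.ext (by omega)
    obtain rfl : q = q' := Fin.ext (by omega)
    rfl
  · intro I hI
    simp only [mem_filter, mem_univ, true_and] at hI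
    obtain ⟨hlast, hI, hk, hm⟩ := hI
    have hkm := card_add_card_compl I
    have hmemI := mem_iff_of_ordConnected hI
    have hs := (slot I).2
    have hslt : (slot I).1 < Iᶜ.card := by
      by_contra hcon
      exact hlast (Fin.last d) ((hmemI _).2 (by simp only [Fin.val_last]; omega)) (by simp)
    refine ⟨⟨⟨I.card - 1, by omega⟩, ⟨(slot I).1, by simp only; omega⟩⟩, ?_, ?_⟩
    · simp only [mem_sigma, mem_filter, mem_univ, true_and, and_true]
      omega
    · ext i
      rw [hmem, hmemI]
      simp only
      omega
  · rintro ⟨p, q⟩ hpq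
    have h2 := q.2
    apply discInsert_congr
    · rw [hcard _ _ (by omega)]
    · rw [hslot _ _ (by omega)]
      rfl

theorem quantumRelation_iff_tensorRelation (hB : Odd C.degB) {d : ℕ} (hd : 2 ≤ d) :
    QuantumRelation Ω (d + 1) 0 ↔ TensorRelation Ω d := by
  have hd' : 3 ≤ d + 1 := by omega
  rw [quantumRelation_iff_rotGen Ω hd']
  have hinj : Function.Injective (decalage 𝒱 (d + 1)) :=
    Function.LeftInverse.injective decalage_decalage
  have hdeg := Ω.degree (d + 1) 0 (coord (rotGen (d + 1) hd'))
  -- The décalage is an involution and may be applied to both sides. Moving the tree sum across the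
  -- equality produces `-B`, which is `B.flip`.
  rw [← hinj.eq_iff, decalage_treeSum Ω hB hd',
    decalage_dEV (by simpa using even_degree C hB d) hdeg, ← dualGen_finRotate, ← sub_eq_zero,
    TensorRelation, C.B_flip hB, sub_eq_add_neg, ← sum_neg_distrib]
  simp only [← sum_neg_distrib, contract_neg]
  rfl

end

section

variable {V : Type*} [AddCommGroup V] [Module ℂ V]

/-! ### Tensors as operations -/

/-- `V` may be infinite-dimensional, so dual vectors are sought for finitely many basis vectors
only: non-degeneracy makes the functionals `B (b i)` independent, hence evaluation `V → ℂ^s` is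
onto. -/
lemma exists_dual_vectors (B : V →ₗ[ℂ] V →ₗ[ℂ] ℂ) (hB : ∀ x, (∀ y, B x y = 0) → x = 0)
    {ι : Type*} [DecidableEq ι] (b : Module.Basis ι ℂ V) (s : Finset ι) :
    ∃ a : ι → V, ∀ i ∈ s, ∀ j ∈ s, B (b i) (a j) = if i = j then 1 else 0 := by
  let L : V →ₗ[ℂ] (s → ℂ) := LinearMap.pi fun i => B (b i)
  have hL : LinearMap.range L = ⊤ := by
    by_contra hne
    obtain ⟨f, hf, hle⟩ := Submodule.exists_le_ker_of_lt_top _ (lt_top_iff_ne_top.2 hne)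
    have hsum : ∀ x : s → ℂ, f x = ∑ i, x i * f (Pi.single i 1) := by
      intro x
      conv_lhs => rw [pi_eq_sum_univ' x]
      simp only [map_sum, map_smul, smul_eq_mul]
    -- A functional that vanishes on the range is a combination of the `b i` in the left kernel of
    -- `B`.
    have h1 : ∑ i : s, f (Pi.single i 1) • b i = 0 := by
      apply hB
      intro y
      have h2 : f (L y) = 0 := hle ⟨y, rfl⟩
      rw [hsum] at h2
      simp only [map_sum, map_smul, LinearMap.sum_apply, LinearMap.smul_apply, smul_eq_mul]
      rw [← h2]
      exact sum_congr rfl fun i _ => mul_comm _ _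
    have h2 := Fintype.linearIndependent_iff.1
      (b.linearIndependent.comp (fun i : s => i.1) Subtype.val_injective) _ h1
    apply hf
    apply LinearMap.ext
    intro x
    rw [hsum]
    simp [h2]
  have h := fun j : s => LinearMap.range_eq_top.1 hL (Pi.single j 1)
  choose a ha using h
  refine ⟨fun i => if h : i ∈ s then a ⟨i, h⟩ else 0, fun i hi j hj => ?_⟩
  dsimp only
  rw [dif_pos hj]
  have := congrFun (ha ⟨j, hj⟩) ⟨i, hi⟩
  simpa [L, Pi.single_apply] using this

/-- Only finitely many basis vectors occur in `t`. Evaluating at vectors dual to the first `d`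
indices of `g` and taking the last coordinate isolates the coefficient of `g`. -/
lemma toHom_injective (B : V →ₗ[ℂ] V →ₗ[ℂ] ℂ) (hB : ∀ x, (∀ y, B x y = 0) → x = 0) (d : ℕ) :
    Function.Injective (toHom B d) := by
  classical
  rw [← LinearMap.ker_eq_bot, LinearMap.ker_eq_bot']
  intro t ht
  let b := Module.Basis.ofVectorSpace ℂ V
  let b' := Basis.piTensorProduct (fun _ : Fin (d + 1) => b)
  obtain ⟨a, ha⟩ := exists_dual_vectors B hB b
    ((b'.repr t).support.biUnion fun f => univ.image f)
  apply b'.repr.injective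
  rw [map_zero]
  ext g
  by_contra hg
  have hmem : ∀ f ∈ (b'.repr t).support, ∀ i, f i ∈
      (b'.repr t).support.biUnion fun f => univ.image f := fun f hf i =>
    mem_biUnion.2 ⟨f, hf, mem_image_of_mem _ (mem_univ _)⟩
  have hg' : g ∈ (b'.repr t).support := by simpa using hg
  have h1 : toHom B d t (PiTensorProduct.tprod ℂ fun i => a (g i.castSucc)) =
      ∑ f ∈ (b'.repr t).support, b'.repr t f •
        (if ∀ i : Fin d, f i.castSucc = g i.castSucc then (1 : ℂ) else 0) • b (f (Fin.last d)) := by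
    conv_lhs => rw [← b'.linearCombination_repr t, Finsupp.linearCombination_apply, Finsupp.sum]
    rw [map_sum, LinearMap.sum_apply]
    refine sum_congr rfl fun f hf => ?_
    rw [map_smul, LinearMap.smul_apply, Basis.piTensorProduct_apply, toHom_tprod]
    congr 2
    rw [prod_congr rfl fun i _ => ha _ (hmem f hf _) _ (hmem g hg' _), prod_boole]
    simp
  rw [ht, LinearMap.zero_apply] at h1
  have h2 := congrArg (fun x => b.repr x (g (Fin.last d))) h1
  simp only [map_zero, Finsupp.zero_apply, map_sum, map_smul, Finsupp.finsetSum_apply,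
    Finsupp.smul_apply, Module.Basis.repr_self, smul_eq_mul] at h2
  rw [sum_eq_single g] at h2
  · apply hg
    simpa using h2.symm
  · intro f _ hfg
    by_cases hc : ∀ i : Fin d, f i.castSucc = g i.castSucc
    · have : f (Fin.last d) ≠ g (Fin.last d) := fun hl => hfg (by
        ext i : 1
        refine Fin.lastCases ?_ (fun i => ?_) i
        · exact hl
        · exact hc i)
      rw [Finsupp.single_eq_of_ne this.symm]
      simp
    · rw [if_neg hc]
      simp
  · exact fun h => absurd hg' h

/-- Where every pairing before the slot has the right degree, `e l + (1 - c l)` is odd, so `1 - e l`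
and `c l - 1` have the same parity. Otherwise some pairing vanishes and `Y = 0`. -/
lemma sgn_slot_mul {𝒱 : ℤ → Submodule ℂ V} (C : InnerComplex 𝒱)
    (hB : Odd C.degB) {M : ℕ} {e : Fin (M + 1) → ℤ} {w : Fin (M + 1) → V}
    (hw : ∀ j, w j ∈ 𝒱 (e j)) {a : ℕ → V} {c : ℕ → ℤ} (ha : ∀ i, a i ∈ 𝒱 (1 - c i)) (q : Fin M)
    (Y : ℂ) (hY : ∀ l : Fin M, l < q → C.B (w l.castSucc) (a l) = 0 → Y = 0) :
    sgn (∑ l ∈ univ.filter (· < q.castSucc), (1 - (e l : ZMod 2))) * Y =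
      sgn ((∑ i ∈ range q, c i - (q : ℤ) : ℤ) : ZMod 2) * Y := by
  by_cases h : ∀ l : Fin M, l < q → e l.castSucc + (1 - c l) = C.degB
  · congr 2
    have h1 : ∑ l ∈ univ.filter (· < q.castSucc), (1 - (e l : ZMod 2)) =
        ∑ i ∈ range q, ((c i : ZMod 2) - 1) := by
      symm
      refine sum_bij (fun i hi => (⟨i, by have := q.2; have := mem_range.1 hi; omega⟩ :
        Fin (M + 1))) ?_ ?_ ?_ ?_
      · intro i hi
        simpa [Fin.lt_def] using hi
      · intro i _ j _ hij
        simpa using hij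
      · intro l hl
        exact ⟨l.1, by simpa [Fin.lt_def] using hl, rfl⟩
      · intro i hi
        have hi' := mem_range.1 hi
        have h2 := h ⟨i, by have := q.2; omega⟩ (Fin.lt_def.2 hi')
        have h3 := congrArg (fun z : ℤ => (z : ZMod 2)) h2
        simp only [(ZMod.intCast_eq_one_iff_odd (n := _)).2 hB] at h3
        push_cast at h3
        have h0 : (2 : ZMod 2) = 0 := rfl
        rw [Fin.castSucc_mk] at h3
        linear_combination h3 - (1 - (c i : ZMod 2)) * h0
    rw [h1]
    push_cast
    simp
  · push Not at h
    obtain ⟨l, hl, hne⟩ := h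
    rw [hY l hl (C.B_degree _ _ _ (hw _) _ (ha _) hne)]
    simp

variable {𝒱 : ℤ → Submodule ℂ V} [DirectSum.Decomposition 𝒱]

variable (𝒱) in
lemma tensor_induction {n : ℕ} {P : T V n → Prop} (zero : P 0) (add : ∀ x y, P x → P y → P (x + y))
    (smul : ∀ (r : ℂ) x, P x → P (r • x))
    (tprod : ∀ (c : Fin n → ℤ) (v : Fin n → V), (∀ i, v i ∈ 𝒱 (c i)) →
      P (PiTensorProduct.tprod ℂ v)) (x : T V n) : P x := by
  set S : Set (T V n) := {t | ∃ (c : Fin n → ℤ) (v : Fin n → V),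
    (∀ i, v i ∈ 𝒱 (c i)) ∧ t = PiTensorProduct.tprod ℂ v}
  have htop : Submodule.span ℂ S = ⊤ := by
    -- Homogeneous pure tensors span because the quotient map by their span agrees with zero on
    -- them.
    rw [← Submodule.ker_mkQ (Submodule.span ℂ S), LinearMap.ker_eq_top]
    apply tensor_ext 𝒱
    intro c v hv
    rw [LinearMap.zero_apply, Submodule.mkQ_apply, Submodule.Quotient.mk_eq_zero]
    exact Submodule.subset_span ⟨c, v, hv, rfl⟩
  have hx : x ∈ Submodule.span ℂ S := htop ▸ Submodule.mem_top
  induction hx using Submodule.span_induction with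
  | mem x hx =>
    obtain ⟨c, v, hv, rfl⟩ := hx
    exact tprod c v hv
  | zero => exact zero
  | add x y _ _ hx hy => exact add x y hx hy
  | smul r x _ hx => exact smul r x hx

lemma toHom_applyAt_last (B : V →ₗ[ℂ] V →ₗ[ℂ] ℂ) (d : ℕ) (φ : V →ₗ[ℂ] V) (t : T V (d + 1))
    (a : Fin d → V) :
    toHom B d (applyAt (Fin.last d) φ t) (PiTensorProduct.tprod ℂ a) =
      φ (toHom B d t (PiTensorProduct.tprod ℂ a)) := by
  induction t using PiTensorProduct.induction_on with
  | smul_tprod r w =>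
    rw [map_smul, map_smul, map_smul, applyAt_tprod, LinearMap.smul_apply, LinearMap.smul_apply,
      toHom_tprod, toHom_tprod, map_smul, map_smul, Function.update_self]
    congr 2
    refine prod_congr rfl fun i _ => ?_
    rw [Function.update_of_ne (Fin.castSucc_lt_last i).ne]
  | add x y hx hy => simp only [map_add, LinearMap.add_apply, hx, hy]

/-- The arguments `a₁, …, a_q, z, a_{q+p+1}, …` -/
def insertArg (a : ℕ → V) (p q : ℕ) (z : V) (j : ℕ) : V :=
  if j < q then a j else if j = q then z else a (j + p - 1)

variable (C : InnerComplex 𝒱)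

/-- `B_d` gives the sign of the degree of `x`, `m₁` that of `y`; they agree wherever `B x (d y)` can
be non-zero, as then `i + j - 1` is odd. -/
lemma B_neg_d {i j : ℤ} (hB : Odd C.degB) {x y : V} (hx : x ∈ 𝒱 i) (hy : y ∈ 𝒱 j) :
    C.B (-C.d x) y = C.B x (m₁ C y) := by
  have h := C.B_d i x hx y
  rw [negOnePow_smul] at h
  rw [m₁_of_mem hy, map_neg, LinearMap.neg_apply, map_smul, ← eq_neg_of_add_eq_zero_right h]
  by_cases hij : i + (j - 1) = C.degB
  · congr 2
    have h3 := congrArg (fun z : ℤ => (z : ZMod 2)) hij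
    simp only [(ZMod.intCast_eq_one_iff_odd (n := _)).2 hB] at h3
    push_cast at h3
    have h0 : (2 : ZMod 2) = 0 := rfl
    linear_combination h3 - (j - 1) * h0
  · rw [C.B_degree _ _ _ hx _ (C.d_mem _ _ hy) hij]
    simp

lemma toHom_applyAt_castSucc (hB : Odd C.degB) {d : ℕ} (u : T V (d + 1)) {a : ℕ → V} {c : ℕ → ℤ}
    (ha : ∀ i, a i ∈ 𝒱 (1 - c i)) (q : Fin d) :
    toHom C.B d (applyAt q.castSucc (-C.d) (slotSign 𝒱 q.castSucc u))
        (PiTensorProduct.tprod ℂ fun i : Fin d => a i) =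
      sgn ((∑ i ∈ range q, c i - (q : ℤ) : ℤ) : ZMod 2) •
        toHom C.B d u (PiTensorProduct.tprod ℂ fun j : Fin d =>
          insertArg a 1 q (m₁ C (a q)) j) := by
  induction u using tensor_induction 𝒱 with
  | zero => simp
  | add x y hx hy => simp only [map_add, LinearMap.add_apply, hx, hy, smul_add]
  | smul r x hx => simp only [map_smul, LinearMap.smul_apply, hx]; rw [smul_comm]
  | tprod e w hw =>
    rw [slotSign, signOp_tprod hw, map_smul, map_smul, LinearMap.smul_apply, applyAt_tprod,
      toHom_tprod, toHom_tprod, Function.update_of_ne (Fin.castSucc_lt_last q).ne', smul_smul,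
      smul_smul]
    congr 1
    have h1 : ∏ i : Fin d, C.B (Function.update w q.castSucc ((-C.d) (w q.castSucc)) i.castSucc)
        (a i) = ∏ i : Fin d, C.B (w i.castSucc) (insertArg a 1 q (m₁ C (a q)) i) := by
      refine prod_congr rfl fun i _ => ?_
      by_cases hi : i = q
      · subst hi
        rw [Function.update_self, LinearMap.neg_apply, B_neg_d C hB (hw _) (ha _), insertArg,
          if_neg (lt_irrefl _), if_pos rfl]
      · have h2 : i.castSucc ≠ q.castSucc := fun h => hi (Fin.castSucc_injective _ h)
        have h3 : i.1 ≠ q.1 := fun h => hi (Fin.ext h)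
        rw [Function.update_of_ne h2, insertArg, if_neg h3, Nat.add_sub_cancel, ite_self]
    rw [h1]
    apply sgn_slot_mul C hB hw ha q
    intro l hl h
    apply prod_eq_zero (mem_univ l)
    rw [insertArg, if_pos (Fin.lt_def.1 hl), h]

/-- Contraction of tensors is composition of operations. With `B.flip` the factor of `u` is the
first argument of `B`, exactly as when `toHom` pairs it with the output of the inner operation. -/
lemma toHom_contract (hB : Odd C.degB) {P M d : ℕ} (h : P + M = d + 1) (t : T V (P + 1))
    (u : T V (M + 1)) {a : ℕ → V} {c : ℕ → ℤ} (ha : ∀ i, a i ∈ 𝒱 (1 - c i)) (q : Fin M) :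
    toHom C.B d (contract C.B.flip h q.castSucc (t ⊗ₜ slotSign 𝒱 q.castSucc u))
        (PiTensorProduct.tprod ℂ fun i : Fin d => a i) =
      sgn ((∑ i ∈ range q, c i - (q : ℤ) : ℤ) : ZMod 2) •
        toHom C.B M u (PiTensorProduct.tprod ℂ fun j : Fin M =>
          insertArg a P q (toHom C.B P t (PiTensorProduct.tprod ℂ fun i : Fin P => a (q + i)))
            j) := by
  obtain ⟨m, rfl⟩ : ∃ m, M = m + 1 := ⟨M - 1, by have := q.2; omega⟩
  induction u using tensor_induction 𝒱 with
  | zero => simp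
  | add x y hx hy =>
    simp only [map_add, LinearMap.add_apply, TensorProduct.tmul_add, hx, hy, smul_add]
  | smul r x hx =>
    simp only [map_smul, LinearMap.smul_apply, TensorProduct.tmul_smul, hx]; rw [smul_comm]
  | tprod e w hw =>
    rw [slotSign, signOp_tprod hw]
    simp only [TensorProduct.tmul_smul, map_smul, LinearMap.smul_apply]
    -- The pairings of `u` not involving the slot, with the arguments behind the inner operation
    -- moved up by `P`; both sides contain this product.
    set Z := ∏ j : Fin m, C.B (w (q.castSucc.succAbove j.castSucc))
      (a (if j.1 < q.1 then j.1 else j.1 + P)) with hZ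
    have hR : ∀ z, toHom C.B (m + 1) (PiTensorProduct.tprod ℂ w)
        (PiTensorProduct.tprod ℂ fun j : Fin (m + 1) => insertArg a P q z j) =
        (C.B (w q.castSucc) z * Z) • w (Fin.last _) := by
      intro z
      rw [toHom_tprod, Fin.prod_univ_succAbove _ q, hZ]
      congr 2
      · rw [insertArg, if_neg (lt_irrefl _), if_pos rfl]
      · refine prod_congr rfl fun j _ => ?_
        rw [Fin.castSucc_succAbove_castSucc]
        congr 1
        rw [insertArg, val_succAbove]
        split_ifs <;> first | rfl | (congr 1; omega)
    have hL : toHom C.B d (contract C.B.flip h q.castSucc (t ⊗ₜ PiTensorProduct.tprod ℂ w))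
        (PiTensorProduct.tprod ℂ fun i : Fin d => a i) =
        (C.B (w q.castSucc) (toHom C.B P t (PiTensorProduct.tprod ℂ fun i : Fin P => a (q + i))) *
          Z) • w (Fin.last _) := by
      induction t using PiTensorProduct.induction_on with
      | add x y hx hy =>
        simp only [map_add, LinearMap.add_apply, TensorProduct.add_tmul, hx, hy, add_mul, add_smul]
      | smul_tprod r v =>
        simp only [map_smul, LinearMap.smul_apply, ← TensorProduct.smul_tmul']
        rw [contract_tprod, toHom_tprod, map_smul, LinearMap.smul_apply, toHom_tprod, map_smul]
        have hd : P + m = d := by omega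
        -- The slot is never the last factor, so the output factor of `u` remains the output of the
        -- composite.
        have hlast : (insertEquiv h q.castSucc).symm (Fin.last d) = Sum.inr (Fin.last m) := by
          rw [Equiv.symm_apply_eq]
          apply Fin.ext
          have := q.2
          rw [val_insertEquiv_inr]
          simp only [Fin.val_last, Fin.val_castSucc]
          rw [if_neg (by omega)]
          omega
        have hinl : ∀ i : Fin P, (insertEquiv h q.castSucc).symm
            (insertEquiv hd q (Sum.inl i)).castSucc = Sum.inl i := by
          intro i
          rw [Equiv.symm_apply_eq]
          apply Fin.ext
          rw [val_insertEquiv_inl, Fin.val_castSucc, val_insertEquiv_inl, Fin.val_castSucc]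
        have hinr : ∀ j : Fin m, (insertEquiv h q.castSucc).symm
            (insertEquiv hd q (Sum.inr j)).castSucc = Sum.inr j.castSucc := by
          intro j
          rw [Equiv.symm_apply_eq]
          apply Fin.ext
          rw [val_insertEquiv_inr, Fin.val_castSucc, val_insertEquiv_inr]
          rfl
        have hlast' : q.castSucc.succAbove (Fin.last m) = Fin.last (m + 1) := by
          apply Fin.ext
          have := q.2
          rw [val_succAbove]
          simp only [Fin.val_last, Fin.val_castSucc]
          rw [if_neg (by omega)]
        rw [hlast, ← (insertEquiv hd q).prod_comp, Fintype.prod_sum_type]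
        simp only [hinl, hinr, Sum.elim_inl, Sum.elim_inr, val_insertEquiv_inl,
          val_insertEquiv_inr, hlast', ← hZ, LinearMap.flip_apply, smul_smul, smul_eq_mul]
        congr 1
        ring
    rw [hL, hR, smul_smul, smul_smul]
    congr 1
    apply sgn_slot_mul C hB hw ha q
    intro l hl h0
    obtain ⟨j, rfl⟩ := Fin.exists_succAbove_eq hl.ne
    have hj : j.1 < q.1 := by
      have h1 : (q.succAbove j).1 < q.1 := hl
      rw [val_succAbove] at h1
      split_ifs at h1 <;> omega
    rw [hZ, prod_eq_zero (mem_univ j), mul_zero]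
    rw [Fin.castSucc_succAbove_castSucc, if_pos hj, ← h0, val_succAbove, if_pos hj]

end

section

variable {V : Type*} [AddCommGroup V] [Module ℂ V]
variable {𝒱 : ℤ → Submodule ℂ V} [DirectSum.Decomposition 𝒱] {C : InnerComplex 𝒱}
  (Ω : StableMorphism C)

/-! ### The A-infinity relations -/

lemma operations_one (a : Fin 1 → V) :
    operations Ω 1 (PiTensorProduct.tprod ℂ a) = m₁ C (a 0) := by
  simp [operations]

lemma operations_of_two_le {d : ℕ} (hd : 2 ≤ d) :
    operations Ω d = toHom C.B d (discTensor Ω (d + 1)) := by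
  obtain ⟨e, rfl⟩ := Nat.exists_eq_add_of_le' hd
  rfl

/-- `m_M (a_d, …, m_p (a_{q+p}, …, a_{q+1}), a_q, …, a_1)` -/
def insertOp (a : ℕ → V) (p M q : ℕ) : V :=
  operations Ω M (PiTensorProduct.tprod ℂ fun j : Fin M =>
    insertArg a p q (operations Ω p (PiTensorProduct.tprod ℂ fun i : Fin p => a (q + i))) j)

/-- The sign `(-1) ^ (|a₁| + ⋯ + |a_q| - q)`. -/
abbrev argSign (c : ℕ → ℤ) (q : ℕ) : ℂ := sgn ((∑ i ∈ range q, c i - (q : ℤ) : ℤ) : ZMod 2)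

lemma aInfRelation_iff (d : ℕ) :
    AInfRelation (cohomological 𝒱) (operations Ω) d ↔
      ∀ (a : ℕ → V) (c : ℕ → ℤ), (∀ i, a i ∈ 𝒱 (1 - c i)) →
        ∑ p ∈ range d, ∑ q ∈ range (d - p), argSign c q • insertOp Ω a (p + 1) (d - p) q = 0 := by
  unfold AInfRelation
  refine forall_congr' fun a => forall_congr' fun c => imp_congr Iff.rfl ?_
  rw [← Ico_succ_right_eq_Icc, Order.succ_eq_add_one, sum_Ico_eq_sum_range]
  simp only [Nat.add_sub_cancel]
  refine Eq.congr (sum_congr rfl fun p hp => ?_) rfl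
  have hp := mem_range.1 hp
  have h1 : d - (1 + p) + 1 = d - p := by omega
  rw [h1, add_comm 1 p]
  refine sum_congr rfl fun q hq => ?_
  rw [negOnePow_smul]
  have h2 : ∀ M, M = d - p → operations Ω M (PiTensorProduct.tprod ℂ fun j : Fin M =>
      if j.1 < q then a j
      else if j.1 = q then operations Ω (p + 1) (PiTensorProduct.tprod ℂ fun i : Fin (p + 1) =>
        a (q + i))
      else a (j + (p + 1) - 1)) = insertOp Ω a (p + 1) (d - p) q := by
    rintro M rfl
    rfl
  rw [h2 _ (by omega)]

lemma sum_range_ends {M : Type*} [AddCommMonoid M] (f : ℕ → M) (e : ℕ) :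
    ∑ p ∈ range (e + 2), f p = f (e + 1) + f 0 + ∑ p ∈ range e, f (p + 1) := by
  rw [sum_range_succ, sum_range_succ']
  abel

/-- Term by term: `m₁` on the last factor is the outer `m₁`, the adjoint `-d` gives the inner `m₁`,
and the contractions give the compositions of higher operations. -/
lemma toHom_tensorRelation (hB : Odd C.degB) {d : ℕ} (hd : 2 ≤ d) {a : ℕ → V} {c : ℕ → ℤ}
    (ha : ∀ i, a i ∈ 𝒱 (1 - c i)) :
    toHom C.B d (applyAt (Fin.last d) (m₁ C) (discTensor Ω (d + 1)) +
        ∑ q : Fin d, applyAt q.castSucc (-C.d) (slotSign 𝒱 q.castSucc (discTensor Ω (d + 1))) +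
        ∑ p ∈ univ.filter (fun p : Fin d => 2 ≤ p.1 + 1 ∧ p.1 + 1 ≤ d - 1),
          ∑ q : Fin (d - p.1),
            contract C.B.flip (show p.1 + 1 + (d - p.1) = d + 1 by omega) q.castSucc
              (discTensor Ω (p.1 + 1 + 1) ⊗ₜ[ℂ]
                slotSign 𝒱 q.castSucc (discTensor Ω (d - p.1 + 1))))
        (PiTensorProduct.tprod ℂ fun i : Fin d => a i) =
      ∑ p ∈ range d, ∑ q ∈ range (d - p), argSign c q • insertOp Ω a (p + 1) (d - p) q := by
  set H : ℕ → V := fun p => ∑ q ∈ range (d - p), argSign c q • insertOp Ω a (p + 1) (d - p) q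
    with hH
  have h1 : toHom C.B d (applyAt (Fin.last d) (m₁ C) (discTensor Ω (d + 1)))
      (PiTensorProduct.tprod ℂ fun i : Fin d => a i) = H (d - 1) := by
    have hd1 : d - (d - 1) = 1 := by omega
    simp only [hH, hd1]
    rw [sum_range_one, toHom_applyAt_last, insertOp, operations_one, ← operations_of_two_le Ω hd,
      show d - 1 + 1 = d by omega]
    simp [argSign, insertArg]
  have h2 : ∑ q : Fin d, toHom C.B d (applyAt q.castSucc (-C.d)
      (slotSign 𝒱 q.castSucc (discTensor Ω (d + 1))))
      (PiTensorProduct.tprod ℂ fun i : Fin d => a i) = H 0 := by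
    simp only [hH, Nat.sub_zero, zero_add]
    rw [← Fin.sum_univ_eq_sum_range (fun q => argSign c q • insertOp Ω a 1 d q)]
    refine sum_congr rfl fun q _ => ?_
    rw [toHom_applyAt_castSucc C hB _ ha, insertOp, operations_one, operations_of_two_le Ω hd]
    rfl
  have h3 : ∀ p ∈ univ.filter (fun p : Fin d => 2 ≤ p.1 + 1 ∧ p.1 + 1 ≤ d - 1),
      ∑ q : Fin (d - p.1), toHom C.B d
        (contract C.B.flip (show p.1 + 1 + (d - p.1) = d + 1 by omega) q.castSucc
          (discTensor Ω (p.1 + 1 + 1) ⊗ₜ[ℂ]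
            slotSign 𝒱 q.castSucc (discTensor Ω (d - p.1 + 1))))
        (PiTensorProduct.tprod ℂ fun i : Fin d => a i) = H p.1 := by
    intro p hp
    have hp := (mem_filter.1 hp).2
    simp only [hH]
    rw [← Fin.sum_univ_eq_sum_range (fun q => argSign c q • insertOp Ω a (p.1 + 1) (d - p.1) q)]
    refine sum_congr rfl fun q _ => ?_
    rw [toHom_contract C hB _ _ _ ha, insertOp, operations_of_two_le Ω hp.1,
      operations_of_two_le Ω (by omega : 2 ≤ d - p.1)]
  simp only [map_add, map_sum, LinearMap.add_apply, LinearMap.sum_apply]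
  rw [h1, h2, sum_congr rfl h3, sum_filter,
    Fin.sum_univ_eq_sum_range (fun p => if 2 ≤ p + 1 ∧ p + 1 ≤ d - 1 then H p else 0)]
  obtain ⟨e, rfl⟩ := Nat.exists_eq_add_of_le' hd
  rw [sum_range_ends, sum_range_ends]
  rw [if_neg (by omega), if_neg (by omega)]
  simp only [zero_add, show e + 2 - 1 = e + 1 by omega]
  congr 1
  refine sum_congr rfl fun p hp => ?_
  have := mem_range.1 hp
  rw [if_pos (by omega)]

theorem tensorRelation_iff_aInfRelation (hB : Odd C.degB) {d : ℕ} (hd : 2 ≤ d) :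
    TensorRelation Ω d ↔ AInfRelation (cohomological 𝒱) (operations Ω) d := by
  rw [aInfRelation_iff]
  constructor
  · intro h a c ha
    rw [← toHom_tensorRelation Ω hB hd ha]
    exact (congrArg (fun t => toHom C.B d t (PiTensorProduct.tprod ℂ fun i : Fin d => a i))
      h).trans (by simp)
  · intro h
    apply toHom_injective C.B C.B_nondegenerate d
    rw [map_zero]
    apply tensor_ext 𝒱
    intro c v hv
    -- The relation is stated for sequences; the arguments are continued by zero, and degrees are
    -- turned into cohomological ones.
    have ha : ∀ i : ℕ, (if h : i < d then v ⟨i, h⟩ else 0) ∈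
        𝒱 (1 - if h : i < d then 1 - c ⟨i, h⟩ else 0) := by
      intro i
      split_ifs with hi
      · rw [sub_sub_cancel]
        exact hv _
      · exact Submodule.zero_mem _
    have h1 := h _ _ ha
    rw [← toHom_tensorRelation Ω hB hd ha] at h1
    simp only [Fin.is_lt, dite_true, Fin.eta] at h1
    rw [LinearMap.zero_apply]
    exact h1

lemma aInfRelation_one : AInfRelation (cohomological 𝒱) (operations Ω) 1 := by
  rw [aInfRelation_iff]
  intro a c ha
  simp only [range_one, sum_singleton, Nat.sub_zero, zero_add, insertOp, insertArg]
  have h1 : m₁ C (m₁ C (a 0)) = 0 := by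
    rw [m₁_of_mem (ha 0), map_smul, m₁_of_mem (C.d_mem _ _ (ha 0)), C.d_d]
    simp
  simp [operations_one, h1]

lemma decalage_mem {n : ℕ} {D : ℤ} {x : T V n} (hx : x ∈ evDegree 𝒱 n D) :
    decalage 𝒱 n x ∈ evDegree 𝒱 n D := by
  induction hx using Submodule.span_induction with
  | zero => simp
  | add x y _ _ hx hy => rw [map_add]; exact Submodule.add_mem _ hx hy
  | smul r x _ hx => rw [map_smul]; exact Submodule.smul_mem _ _ hx
  | mem x hx =>
    obtain ⟨c, v, hv, hc, rfl⟩ := hx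
    rw [decalage_tprod hv]
    exact Submodule.smul_mem _ _ (Submodule.subset_span ⟨c, v, hv, hc, rfl⟩)

/-- The degree is a consequence of the degree of `Ω` alone, without any relation. -/
lemma operations_degree (d : ℕ) (hd : 1 ≤ d) (c : Fin d → ℤ) (a : Fin d → V)
    (ha : ∀ i, a i ∈ cohomological 𝒱 (c i)) :
    operations Ω d (PiTensorProduct.tprod ℂ a) ∈ cohomological 𝒱 (∑ i, c i + 2 - (d : ℤ)) := by
  rcases hd.eq_or_lt with rfl | hd
  · rw [operations_one, m₁_of_mem (𝒱 := 𝒱) (ha 0)]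
    refine Submodule.smul_mem _ _ ?_
    have h := C.d_mem _ _ (ha 0)
    have : 1 - c 0 - 1 = 1 - (∑ i : Fin 1, c i + 2 - ((1 : ℕ) : ℤ)) := by simp; ring
    rw [this] at h
    exact h
  · rw [operations_of_two_le Ω hd]
    have hx : discTensor Ω (d + 1) ∈ evDegree 𝒱 (d + 1) _ :=
      decalage_mem (Ω.degree (d + 1) 0 (dualGen (d + 1) 0 (finRotate (d + 1)) 0))
    generalize discTensor Ω (d + 1) = x at hx
    induction hx using Submodule.span_induction with
    | zero => simp
    | add x y _ _ hx hy =>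
      rw [map_add, LinearMap.add_apply]
      exact Submodule.add_mem _ hx hy
    | smul r x _ hx =>
      rw [map_smul, LinearMap.smul_apply]
      exact Submodule.smul_mem _ _ hx
    | mem x hx =>
      obtain ⟨e, w, hw, he, rfl⟩ := hx
      rw [toHom_tprod]
      -- If all pairings have the degree of `B`, the total degree of the tensor determines that of
      -- the last factor; otherwise the value is zero.
      by_cases h : ∀ i : Fin d, e i.castSucc + (1 - c i) = C.degB
      · refine Submodule.smul_mem _ _ ?_
        have hlast : e (Fin.last d) = 1 - (∑ i, c i + 2 - (d : ℤ)) := by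
          have h2 : ∑ i : Fin d, e i.castSucc = d * (C.degB - 1) + ∑ i, c i := by
            rw [sum_congr rfl fun i _ => show e i.castSucc = (C.degB - 1) + c i by
              have := h i; omega, sum_add_distrib]
            simp [mul_sub]
          rw [Fin.sum_univ_castSucc, h2, InnerComplex.cohDegB] at he
          push_cast at he
          linear_combination -he
        have := hw (Fin.last d)
        rw [hlast] at this
        exact this
      · push Not at h
        obtain ⟨i, hi⟩ := h
        rw [prod_eq_zero (mem_univ i) (C.B_degree _ _ _ (hw _) _ (ha i) hi), zero_smul]
        exact Submodule.zero_mem _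

/-- Stability leaves no generators here. On the other side the relation with one input is `d² = 0`,
so only `n = d + 1 ≥ 3` has content. -/
lemma quantumRelation_of_le_two {n : ℕ} (hn : n ≤ 2) : QuantumRelation Ω n 0 := by
  intro ξ
  have : IsEmpty (Gen n 0) := ⟨fun x => by have := x.2.2.1; omega⟩
  have : ξ = 0 := Subsingleton.elim _ _
  rw [this]
  simp

theorem forall_quantumRelation_iff (hB : Odd C.degB) :
    (∀ n : ℕ, QuantumRelation Ω n 0) ↔
      IsAInfAlgebra (cohomological 𝒱) (operations Ω) := by
  constructor
  · intro h
    refine ⟨operations_degree Ω, fun d hd => ?_⟩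
    rcases hd.eq_or_lt with rfl | hd
    · exact aInfRelation_one Ω
    · exact (tensorRelation_iff_aInfRelation Ω hB hd).1
        ((quantumRelation_iff_tensorRelation Ω hB hd).1 (h _))
  · intro h n
    by_cases hn : n ≤ 2
    · exact quantumRelation_of_le_two Ω hn
    · obtain ⟨d, rfl⟩ : ∃ d, n = d + 1 := ⟨n - 1, by omega⟩
      have hd : 2 ≤ d := by omega
      exact (quantumRelation_iff_tensorRelation Ω hB hd).2
        ((tensorRelation_iff_aInfRelation Ω hB hd).2 (h.relation d (by omega)))

end

end QuantumAInf

end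

/-! ### The theorem -/

theorem theorem4 {V : Type*} [AddCommGroup V] [Module ℂ V]
    (𝒱 : ℤ → Submodule ℂ V) [DirectSum.Decomposition 𝒱]
    (C : QuantumAInf.InnerComplex 𝒱) (hB : Odd C.degB)
    (Ω : QuantumAInf.StableMorphism C) :
    -- in genus zero the quantum relations are the A-infinity relations
    ((∀ n : ℕ, QuantumAInf.QuantumRelation Ω n 0) ↔
      QuantumAInf.IsAInfAlgebra (QuantumAInf.cohomological 𝒱) (QuantumAInf.operations Ω)) ∧
    -- arity by arity, in tensor form, and in terms of the operations
    (∀ d : ℕ, 2 ≤ d →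
      ((QuantumAInf.QuantumRelation Ω (d + 1) 0 ↔ QuantumAInf.TensorRelation Ω d) ∧
        (QuantumAInf.TensorRelation Ω d ↔
          QuantumAInf.AInfRelation (QuantumAInf.cohomological 𝒱)
            (QuantumAInf.operations Ω) d))) ∧
    -- the sign of the term given by a planar tree with one edge
    (∀ (n : ℕ) (I : Finset (Fin n)), (I : Set (Fin n)).OrdConnected →
      ∀ (a : Fin (I.card + 1) → ℤ) (p : Fin (I.card + 1) → V), (∀ i, p i ∈ 𝒱 (a i)) →
      ∀ (c : Fin (Iᶜ.card + 1) → ℤ) (q : Fin (Iᶜ.card + 1) → V), (∀ j, q j ∈ 𝒱 (c j)) →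
      ∑ i, (1 - a i) = 2 + (I.card : ℤ) * (C.cohDegB - 1) →
      ∑ j, (1 - c j) = 2 + (Iᶜ.card : ℤ) * (C.cohDegB - 1) →
      QuantumAInf.decalage 𝒱 n
          (QuantumAInf.orientation I •
            QuantumAInf.evTree C I
              (PiTensorProduct.tprod ℂ p ⊗ₜ[ℂ] PiTensorProduct.tprod ℂ q)) =
        (∑ j ∈ Finset.univ.filter (· < QuantumAInf.slot I), (1 - c j)).negOnePow •
          QuantumAInf.contract C.B (QuantumAInf.card_add_card_compl I) (QuantumAInf.slot I)
            (QuantumAInf.decalage 𝒱 (I.card + 1) (PiTensorProduct.tprod ℂ p) ⊗ₜ[ℂ]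
              QuantumAInf.decalage 𝒱 (Iᶜ.card + 1) (PiTensorProduct.tprod ℂ q))) := by
  refine ⟨QuantumAInf.forall_quantumRelation_iff Ω hB, fun d hd =>
    ⟨QuantumAInf.quantumRelation_iff_tensorRelation Ω hB hd,
      QuantumAInf.tensorRelation_iff_aInfRelation Ω hB hd⟩, ?_⟩
  intro n I hI a p hp c q hq ha hc
  exact QuantumAInf.seidel_sign C hB hI hp hq (ha ▸ QuantumAInf.even_degree C hB _)
    (hc ▸ QuantumAInf.even_degree C hB _)
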